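/- **Theorem 5.1.** Let $\Phi:\mathbb R^2\to\mathbb R^2$ be the map $$\Phi(x,y)=\bigl(1-x[\lambda(1-x)+y],\ \mu y(x-y)\bigr),\qquad \lambda=0.99,\ \mu=5,$$ and let $T=\{(x,y):0\le x\le 1,\ 0\le y\le x\}$. A *curvilinear rectangle* is the image of $[0,1]^2$ under a continuous injective map into $\mathbb R^2$ whose restrictions to the four edges (bottom, top, left, right) are regular $C^1$ arcs. There exist an integer $N\ge 1$ and a curvilinear rectangle $Q$ (in particular a region homeomorphic to a square) that meets $T$ and has the following properties. (a) Let $F=\Phi^N$. Then $F(Q)$ is pill-shaped and lies along the vertical edge $\{1\}\times[0,1]$ of $T$: it is homeomorphic to a square, is contained in $[0.875,1.025]\times[-0.03,0.22]$, contains the segment from $(1,0)$ to $(1,0.2)$ (in particular the fixed point $(1,0)$) in its interior, and the maximum of $y$ on $F(Q)$ is $0.22$. (b) Let $G=\Phi^{N+1}$. Then $G(Q)$ is homeomorphic to a square and is a thin region along the parabola $y=5x(1-x)$: it contains the arc $\{(1-y,5y(1-y)):0\le y\le 0.2\}$ in its interior, and each of its points is at Euclidean distance at most $0.1$ from $\{(x,5x(1-x)):0\le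 x\le1\}$. It just crosses the diagonal edge of $T$ inside the unit square: it has points with $y<x$ and points with $y>x$, it satisfies $y-x\le 0.1$, and all its points on the line $y=x$ lie in the open unit square. (c) Let $H=\Phi^{N+2}$. Then $H(Q)$ is homeomorphic to $Q$, and $H(Q)\cap Q$ is the union of two disjoint curvilinear rectangles $C_0,C_1$. Each $C_i$ crosses $Q$ vertically: it meets the bottom (top) edge of $Q$ exactly in its own bottom (top) edge, it does not meet the left and right edges of $Q$, and its left and right edges are transverse to the bottom and top edges of $Q$. Each set $R_i=\{p\in Q:H(p)\in C_i\}$ is a curvilinear rectangle crossing $Q$ horizontally: it meets the left (right) edge of $Q$ exactly in its own left (right) edge and does not meet the bottom and top edges of $Q$. Moreover $H$ maps the bottom and top edges of $R_0$ onto the bottom and top edges of $C_0$, respectively, and the bottom and top edges of $R_1$ onto the top and bottom edges of $C_1$, respectively (the fold). Moreover, there is a compact set $\Lambda\subseteq Q$ with $H(\Lambda)=\Lambda$ such that $H|_\Lambda$ is topologically conjugate to the full two-sided shift on $\{0,1\}^{\mathbb Z}$ (so $\Lambda$ is a Cantor set), and, with $\widehat\Lambda=\bigcup_{n\ge0}\Phi^n(\Lambda)$,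 the map $\Phi|_{\widehat\Lambda}$ is topologically conjugate to a two-sided subshift over a finite alphabet. Both $H$ on $\Lambda$ and $\Phi$ on $\widehat\Lambda$ are chaotic in the sense of Devaney (topologically transitive, with dense periodic points and sensitive dependence on initial conditions); some point of $\Lambda$ has an $H$-orbit dense in $\Lambda$, and some point of $\Lambda$ has a $\Phi$-orbit dense in $\widehat\Lambda$; and for every $n$ there is a periodic point of $\Phi$ in $\Lambda$ whose least period exceeds $n$. -/

import Mathlib

open Set Filter Topology

namespace FlipFlop

/-- The R-S flip-flop map `Φ_{l,m}` of the plane (parameters `l = λ`, `m = μ`). -/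
def flipFlopMap (l m : ℝ) (p : ℝ × ℝ) : ℝ × ℝ :=
  (1 - p.1 * (l * (1 - p.1) + p.2), m * p.2 * (p.1 - p.2))

/-- The triangle `T`. -/
def triangle : Set (ℝ × ℝ) := {p | 0 ≤ p.1 ∧ p.1 ≤ 1 ∧ 0 ≤ p.2 ∧ p.2 ≤ p.1}

/-- The closed unit square. -/
def unitSquare : Set (ℝ × ℝ) := Icc (0 : ℝ) 1 ×ˢ Icc (0 : ℝ) 1

/-- `S`, with the subspace topology, is homeomorphic to a closed square. -/
def IsTopologicalSquare (S : Set (ℝ × ℝ)) : Prop := Nonempty (S ≃ₜ unitSquare)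

/-- `γ`, restricted to `[0,1]`, is a regular `C¹` arc. -/
def IsRegularArc (γ : ℝ → ℝ × ℝ) : Prop :=
  ContDiffOn ℝ 1 γ (Icc 0 1) ∧ ∀ t ∈ Icc (0 : ℝ) 1, derivWithin γ (Icc 0 1) t ≠ 0

/-- The arcs `γ|[0,1]` and `δ|[0,1]` are transverse: wherever they meet, their tangent vectors
are linearly independent. -/
def ArcsTransverse (γ δ : ℝ → ℝ × ℝ) : Prop :=
  ∀ s ∈ Icc (0 : ℝ) 1, ∀ t ∈ Icc (0 : ℝ) 1, γ s = δ t →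
    LinearIndependent ℝ ![derivWithin γ (Icc 0 1) s, derivWithin δ (Icc 0 1) t]

/-- A curvilinear rectangle: a topological embedding of the closed unit square in the plane
(continuous and injective, hence an embedding by compactness) whose four edges are regular
`C¹` arcs. -/
structure CurvRect where
  /-- the parametrization (only its values on the unit square matter) -/
  param : ℝ × ℝ → ℝ × ℝ
  continuousOn_param : ContinuousOn param unitSquare
  injOn_param : InjOn param unitSquare
  regular_bottom : IsRegularArc fun s => param (s, 0)
  regular_top : IsRegularArc fun s => param (s, 1)
  regular_left : IsRegularArc fun t => param (0, t)
  regular_right : IsRegularArc fun t => param (1, t)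

namespace CurvRect

/-- The closed region filled by the rectangle. -/
def region (R : CurvRect) : Set (ℝ × ℝ) := R.param '' unitSquare

/-- The arc of the bottom edge. -/
def bottomArc (R : CurvRect) (s : ℝ) : ℝ × ℝ := R.param (s, 0)

/-- The arc of the top edge. -/
def topArc (R : CurvRect) (s : ℝ) : ℝ × ℝ := R.param (s, 1)

/-- The arc of the left edge. -/
def leftArc (R : CurvRect) (t : ℝ) : ℝ × ℝ := R.param (0, t)

/-- The arc of the right edge. -/
def rightArc (R : CurvRect) (t : ℝ) : ℝ × ℝ := R.param (1, t)

/-- The bottom edge. -/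
def bottom (R : CurvRect) : Set (ℝ × ℝ) := R.bottomArc '' Icc 0 1

/-- The top edge. -/
def top (R : CurvRect) : Set (ℝ × ℝ) := R.topArc '' Icc 0 1

/-- The left edge. -/
def left (R : CurvRect) : Set (ℝ × ℝ) := R.leftArc '' Icc 0 1

/-- The right edge. -/
def right (R : CurvRect) : Set (ℝ × ℝ) := R.rightArc '' Icc 0 1

end CurvRect

/-- `C` is a strip that runs inside `Q` from the bottom edge of `Q` to its top edge, stays away
from the left and right edges of `Q`, and whose sides cross the bottom and top edges of `Q`
transversely. -/
structure CrossesVertically (C Q : CurvRect) : Prop where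
  subset : C.region ⊆ Q.region
  inter_bottom : C.region ∩ Q.bottom = C.bottom
  inter_top : C.region ∩ Q.top = C.top
  disjoint_left : Disjoint C.region Q.left
  disjoint_right : Disjoint C.region Q.right
  left_bottom : ArcsTransverse C.leftArc Q.bottomArc
  left_top : ArcsTransverse C.leftArc Q.topArc
  right_bottom : ArcsTransverse C.rightArc Q.bottomArc
  right_top : ArcsTransverse C.rightArc Q.topArc

/-- `R` is a strip that runs inside `Q` from the left edge of `Q` to its right edge and stays
away from the bottom and top edges of `Q`. -/
structure CrossesHorizontally (R Q : CurvRect) : Prop where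
  subset : R.region ⊆ Q.region
  inter_left : R.region ∩ Q.left = R.left
  inter_right : R.region ∩ Q.right = R.right
  disjoint_bottom : Disjoint R.region Q.bottom
  disjoint_top : Disjoint R.region Q.top

/-- `H` stretches and folds `Q` across itself in a horseshoe pattern: `H(Q) ∩ Q` is the disjoint
union of two curvilinear rectangles `C₀`, `C₁`, each crossing `Q` (transversely) from bottom to
top; the points of `Q` mapped into `Cᵢ` form a rectangle `Rᵢ` crossing `Q` from left to right,
which is stretched to the full height of `Q`, right side up for `i = 0` and, because of the fold,
upside down for `i = 1`. -/
structure IsHorseshoe (H : ℝ × ℝ → ℝ × ℝ) (Q C₀ C₁ R₀ R₁ : CurvRect) : Prop where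
  inter_eq : H '' Q.region ∩ Q.region = C₀.region ∪ C₁.region
  disjoint : Disjoint C₀.region C₁.region
  vertical₀ : CrossesVertically C₀ Q
  vertical₁ : CrossesVertically C₁ Q
  preimage₀ : Q.region ∩ H ⁻¹' C₀.region = R₀.region
  preimage₁ : Q.region ∩ H ⁻¹' C₁.region = R₁.region
  horizontal₀ : CrossesHorizontally R₀ Q
  horizontal₁ : CrossesHorizontally R₁ Q
  image_bottom₀ : H '' R₀.bottom = C₀.bottom
  image_top₀ : H '' R₀.top = C₀.top
  image_bottom₁ : H '' R₁.bottom = C₁.top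
  image_top₁ : H '' R₁.top = C₁.bottom

/-- The restriction of `f` to the set `S` and the restriction of `g` to the set `B` are
self-maps of `S` and `B`, and they are topologically conjugate. -/
def ConjugateOn {α β : Type*} [TopologicalSpace α] [TopologicalSpace β]
    (f : α → α) (S : Set α) (g : β → β) (B : Set β) : Prop :=
  ∃ (hf : MapsTo f S S) (hg : MapsTo g B B) (e : S ≃ₜ B),
    Function.Semiconj e (hf.restrict f S S) (hg.restrict g B B)

/-- The two-sided shift on bi-infinite sequences over the alphabet `A`. -/
def shift {A : Type*} (a : ℤ → A) : ℤ → A := fun n => a (n + 1)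

/-- A (two-sided) subshift: a closed, shift-invariant set of sequences over the discrete alphabet
`{0, …, k-1}`, with the product topology. -/
def IsSubshift {k : ℕ} (X : Set (ℤ → Fin k)) : Prop := IsClosed X ∧ shift '' X = X

/-- Chaos in the sense of Devaney for `f` on the invariant set `S`: topological transitivity,
density of the periodic points, and sensitive dependence on initial conditions. -/
structure IsDevaneyChaoticOn {X : Type*} [MetricSpace X] (f : X → X) (S : Set X) : Prop where
  mapsTo : MapsTo f S S
  transitive : ∀ U V : Set X, IsOpen U → IsOpen V → (U ∩ S).Nonempty → (V ∩ S).Nonempty →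
    ∃ n : ℕ, (f^[n] '' (U ∩ S) ∩ V).Nonempty
  dense_periodic : S ⊆ closure (S ∩ Function.periodicPts f)
  sensitive : ∃ ε > 0, ∀ p ∈ S, ∀ δ > 0, ∃ q ∈ S, dist q p < δ ∧
    ∃ n : ℕ, ε ≤ dist (f^[n] q) (f^[n] p)

end FlipFlop

/-!
The map, here called `phi` for the given parameters, fixes `(1, 0)`, and on the axis `y = 0` all
orbits starting in a neighbourhood of `[18/100, 1]` approach this fixed point, while heights are
multiplied by about `5` per step near it. A rectangle `Q` stretched along the axis and extremely thin
is therefore carried, in a long passage of `N` steps (`IsLong`), to a pill-shaped region along the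
edge `x = 1`: thin horizontally, of height about `22/100` vertically. One step later it lies along
the parabola `y = 5x(1 - x)`, which crosses the diagonal; since `phi` maps the diagonal to the axis,
one more step brings two parts of it back to the axis: a neighbourhood of the fixed point and a
neighbourhood of the diagonal preimage `(1, 1/5)`, the latter upside down. These are the two legs of
a horseshoe for `phi^[N + 2]`.

*Estimates.* As `phi` is quadratic, the difference of two orbits evolves exactly by the derivative at
midpoints (`phi_sub`). Hence cone estimates for the derivative are estimates for differences at the
same time: nearly vertical differences stay so and grow, during a passage (`Passes.cone_sub`) and
during the return through the windows `box 0` and `box 1` (`ret_sub`). It follows that a passing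
point is determined by its abscissa and its final height, and such points exist by the intermediate
value theorem (`exists_passes`, `passPt`).

*The rectangles.* The first step folds `Q` along a curve near `x = 1/2`. The image of the fold is the
graph of a Lipschitz function `kap`, and `phi^[N]` maps `Q` onto the region between this graph and
the line `x = 1001/1000` (`image_Qset`). Points come back to `Q` only through the two windows
(`box_of_return`), and every nearly vertical curve that crosses a window comes back across the whole
strip (`exists_crossing`). All rectangles are obtained from coordinates, one of them a height at the
end of a passage (`Coords.exists_rect`); the height functions also yield the incidence and
transversality statements about edges (`exists_horseshoe`).

*The dynamics.* A nearly vertical curve in the image of `Q` contains, in each window, an arc that is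
stretched over another such curve (`IsVerticalCurve.transform`), so finite itineraries are realized,
and bi-infinite ones by compactness (`exists_isOrbit`). Two orbits with the same itinerary coincide:
a difference in the cone is expanded in the future (`eq_of_forward`), and outside the cone the
return map contracts (`Rset.contract`), so that the difference would be expanded in the past
(`IsOrbit.unique`). This gives an embedding `codePt` of the full shift, from which chaos, dense
orbits and long periods are inherited (`isDevaneyChaoticOn_of_code`).

*The subshift for* `phi`. The union of the images of the invariant set is the set of all points
`phi^[j] (codePt N a)` with phase `j < N + 2`. Different phases meet only in the fixed point
(`eq_zero_of_phase`): the symbol `1` shows in the orbit as a height above `1/2` at times that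
determine the phase, and orbits without it in the future run along the axis, where meeting is ruled
out by one-dimensional estimates (`axis_disjoint`). Spreading the itinerary out in time, with a
symbol every `N + 2` steps and `0` in between, makes exactly the same identifications
(`phasePt_eq_iff`), and conjugates `phi` to a subshift on two symbols.
-/

namespace FlipFlop

/-! ### The map and its derivative -/

/-- The flip-flop map at the parameters `λ = 0.99`, `μ = 5`. -/
noncomputable def phi : ℝ × ℝ → ℝ × ℝ := flipFlopMap 0.99 5

lemma phi_fst (p : ℝ × ℝ) : (phi p).1 = 1 - p.1 * (99 / 100 * (1 - p.1) + p.2) := by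
  simp only [phi, flipFlopMap]; norm_num

lemma phi_snd (p : ℝ × ℝ) : (phi p).2 = 5 * p.2 * (p.1 - p.2) := by
  simp only [phi, flipFlopMap]

/-- The derivative of `phi` at `m`, applied to `v`. -/
noncomputable def phiLin (m v : ℝ × ℝ) : ℝ × ℝ :=
  ((99 / 100 * (2 * m.1 - 1) - m.2) * v.1 - m.1 * v.2,
    5 * m.2 * v.1 + 5 * (m.1 - 2 * m.2) * v.2)

/-- The midpoint of two points of the plane. -/
noncomputable def mid (p q : ℝ × ℝ) : ℝ × ℝ := ((p.1 + q.1) / 2, (p.2 + q.2) / 2)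

/-- Since `phi` is quadratic, its increments are given exactly by the derivative at the
midpoint. -/
lemma phi_sub (p q : ℝ × ℝ) : phi q - phi p = phiLin (mid p q) (q - p) := by
  ext
  · simp only [phi_fst, phiLin, mid, Prod.fst_sub, Prod.snd_sub]; ring
  · simp only [phi_snd, phiLin, mid, Prod.fst_sub, Prod.snd_sub]; ring

/-- To the right of `x = 1/2` the determinant of `phiLin m`, here divided by `5`, is positive. -/
lemma phiLin_det (m : ℝ × ℝ) (hm : 1 / 2 < m.1) :
    0 < (99 / 100 * (2 * m.1 - 1) - m.2) * (m.1 - 2 * m.2) + m.1 * m.2 := by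
  nlinarith [sq_nonneg (2 * m.2 - 99 / 100 * (2 * m.1 - 1)),
    mul_pos (sub_pos.2 hm) (sub_pos.2 hm), mul_pos (sub_pos.2 hm) (by linarith : 0 < m.1)]

lemma phiLin_eq_zero {m v : ℝ × ℝ}
    (hm : (99 / 100 * (2 * m.1 - 1) - m.2) * (m.1 - 2 * m.2) + m.1 * m.2 ≠ 0)
    (h : phiLin m v = 0) : v = 0 := by
  have h1 : (99 / 100 * (2 * m.1 - 1) - m.2) * v.1 - m.1 * v.2 = 0 := congrArg Prod.fst h
  have h2 : 5 * m.2 * v.1 + 5 * (m.1 - 2 * m.2) * v.2 = 0 := congrArg Prod.snd h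
  ext
  · apply (mul_eq_zero.1 _).resolve_left hm
    linear_combination (m.1 - 2 * m.2) * h1 + m.1 / 5 * h2
  · apply (mul_eq_zero.1 _).resolve_left hm
    linear_combination (99 / 100 * (2 * m.1 - 1) - m.2) / 5 * h2 - m.2 * h1

/-- Injectivity to the right of `x = 1/2`: the midpoint of two points lies there as well, and a
difference mapped to `0` by an invertible `phiLin` vanishes. -/
lemma phi_injOn : InjOn phi {p | 1 / 2 < p.1} := by
  intro p hp q hq h
  have hm : 1 / 2 < (mid p q).1 := by
    simp only [mem_ofPred_eq] at hp hq; simp only [mid]; linarith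
  have := phiLin_eq_zero (phiLin_det _ hm).ne' (by rw [← phi_sub, h, sub_self])
  exact (sub_eq_zero.1 this).symm

lemma contDiff_phi {n : WithTop ℕ∞} : ContDiff ℝ n phi := by
  have : phi = fun p : ℝ × ℝ =>
      (1 - p.1 * (99 / 100 * (1 - p.1) + p.2), 5 * p.2 * (p.1 - p.2)) := by
    funext p; ext
    · rw [phi_fst]
    · rw [phi_snd]
  rw [this]; fun_prop

lemma continuous_phi : Continuous phi := (contDiff_phi (n := 0)).continuous

lemma contDiff_phi_iterate {n : WithTop ℕ∞} (k : ℕ) : ContDiff ℝ n phi^[k] := by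
  induction k with
  | zero => exact contDiff_id
  | succ k ih => rw [Function.iterate_succ']; exact contDiff_phi.comp ih

lemma continuous_iterate (k : ℕ) : Continuous phi^[k] := continuous_phi.iterate k

lemma fderiv_phi (m v : ℝ × ℝ) : fderiv ℝ phi m v = phiLin m v := by
  have h1 : HasFDerivAt (fun p : ℝ × ℝ => p.1) (ContinuousLinearMap.fst ℝ ℝ ℝ) m :=
    hasFDerivAt_fst
  have h2 : HasFDerivAt (fun p : ℝ × ℝ => p.2) (ContinuousLinearMap.snd ℝ ℝ ℝ) m :=
    hasFDerivAt_snd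
  have e : phi = fun p : ℝ × ℝ =>
      (1 - p.1 * (99 / 100 * (1 - p.1) + p.2), 5 * p.2 * (p.1 - p.2)) := by
    funext p; ext
    · rw [phi_fst]
    · rw [phi_snd]
  have h := ((h1.mul (((h1.const_sub 1).const_mul (99 / 100)).add h2)).const_sub 1).prodMk
    ((h2.const_mul 5).mul (h1.sub h2))
  have h' := (h.congr_of_eventuallyEq (f₁ := phi) (by rw [e]; rfl)).fderiv
  rw [h']
  ext <;> simp [phiLin] <;> ring

/-- The tangent map of an iterate. -/
noncomputable def tang (n : ℕ) (p v : ℝ × ℝ) : ℝ × ℝ := fderiv ℝ phi^[n] p v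

lemma tang_zero (p v : ℝ × ℝ) : tang 0 p v = v := by
  simp [tang, Function.iterate_zero, fderiv_id]

lemma tang_add (m n : ℕ) (p v : ℝ × ℝ) :
    tang (m + n) p v = tang m (phi^[n] p) (tang n p v) := by
  unfold tang
  rw [Function.iterate_add, fderiv_comp p
    ((contDiff_phi_iterate (n := 1) m).differentiable (by simp) _)
    ((contDiff_phi_iterate (n := 1) n).differentiable (by simp) _)]
  rfl

lemma tang_one (p v : ℝ × ℝ) : tang 1 p v = phiLin p v := by
  simp only [tang, Function.iterate_one, fderiv_phi]

lemma tang_succ (n : ℕ) (p v : ℝ × ℝ) :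
    tang (n + 1) p v = phiLin (phi^[n] p) (tang n p v) := by
  rw [add_comm, tang_add, tang_one]

/-! ### Cones -/

/-- The vertical cone of opening `k`. -/
def Cone (k : ℝ) (v : ℝ × ℝ) : Prop := |v.1| ≤ k * |v.2|

lemma Cone.mono {k l : ℝ} {v : ℝ × ℝ} (h : Cone k v) (hkl : k ≤ l) : Cone l v :=
  le_trans h (mul_le_mul_of_nonneg_right hkl (abs_nonneg _))

lemma Cone.eq_zero {k : ℝ} {v : ℝ × ℝ} (h : Cone k v) (h2 : v.2 = 0) : v = 0 := by
  unfold Cone at h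
  rw [h2, abs_zero, mul_zero] at h
  ext
  · exact abs_eq_zero.1 (le_antisymm h (abs_nonneg _))
  · exact h2

lemma cone_vertical {k : ℝ} (hk : 0 ≤ k) {v : ℝ × ℝ} (h : v.1 = 0) : Cone k v := by
  unfold Cone; rw [h, abs_zero]; positivity

/-- A bound `c b² ≤ b b'` gives `c |b| ≤ |b'|`. -/
lemma abs_le_of_sq_le {b b' c : ℝ} (h : c * b ^ 2 ≤ b * b') : c * |b| ≤ |b'| := by
  rcases eq_or_ne b 0 with rfl | hb
  · simp
  have hb' : 0 < |b| := abs_pos.2 hb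
  have : c * |b| * |b| ≤ |b'| * |b| := by
    calc c * |b| * |b| = c * b ^ 2 := by rw [mul_assoc, abs_mul_abs_self]; ring
      _ ≤ b * b' := h
      _ ≤ |b * b'| := le_abs_self _
      _ = |b'| * |b| := by rw [abs_mul]; ring
  exact le_of_mul_le_mul_right this hb'

/-- Compose two expansions in the second coordinate. -/
lemma sq_le_trans {b b' b'' c d : ℝ} (hc : 0 < c) (hd : 0 ≤ d) (h : c * b ^ 2 ≤ b * b')
    (h' : d * b' ^ 2 ≤ b' * b'') : c * d * b ^ 2 ≤ b * b'' := by
  rcases eq_or_ne b 0 with rfl | hb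
  · simp
  have hbb : 0 < b * b' := lt_of_lt_of_le (by positivity) h
  have h1 : d * (b * b') ≤ b * b'' := by
    have : d * (b * b') * (b * b') ≤ b * b'' * (b * b') := by
      nlinarith [mul_le_mul_of_nonneg_left h' (sq_nonneg b)]
    exact le_of_mul_le_mul_right this hbb
  nlinarith [mul_le_mul_of_nonneg_left h hd]

/-- The starting strip: a thin neighbourhood of a stretch of the axis on both sides of the fold near
`x = 1/2`. It reaches beyond the abscissas that occur in `Qset`, so that intermediate value
arguments along it have room on both sides. -/
def strip : Set (ℝ × ℝ) := {p | 31 / 200 ≤ p.1 ∧ p.1 ≤ 7 / 5 ∧ |p.2| ≤ 1 / 100000}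

/-- The corridor along the axis, to the right of the fold, in which heights are multiplied by more
than `2` at each step. There is no bound on the right. -/
def corridor : Set (ℝ × ℝ) := {p | 3 / 4 ≤ p.1 ∧ -(1 / 100) ≤ p.2 ∧ p.2 ≤ 7 / 100}

lemma mid_strip {p q : ℝ × ℝ} (hp : p ∈ strip) (hq : q ∈ strip) : mid p q ∈ strip := by
  obtain ⟨h1, h2, h3⟩ := hp
  obtain ⟨k1, k2, k3⟩ := hq
  rw [abs_le] at h3 k3
  refine ⟨?_, ?_, abs_le.2 ⟨?_, ?_⟩⟩ <;> simp only [mid] <;> linarith [h3.1, h3.2, k3.1, k3.2]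

lemma mid_corridor {p q : ℝ × ℝ} (hp : p ∈ corridor) (hq : q ∈ corridor) :
    mid p q ∈ corridor := by
  obtain ⟨h1, h2, h3⟩ := hp
  obtain ⟨k1, k2, k3⟩ := hq
  refine ⟨?_, ?_, ?_⟩ <;> simp only [mid] <;> linarith

lemma cone_corridor_aux {x y a b : ℝ} (hx : 3 / 4 ≤ x) (hy1 : -(1 / 100) ≤ y) (hy2 : y ≤ 7 / 100)
    (hb : 0 ≤ b) (h1 : a ≤ 3 * b) (h2 : -(3 * b) ≤ a) :
    2 * b ≤ 5 * y * a + 5 * (x - 2 * y) * b ∧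
    (99 / 100 * (2 * x - 1) - y) * a - x * b ≤ 7 / 5 * (5 * y * a + 5 * (x - 2 * y) * b) ∧
    -(7 / 5 * (5 * y * a + 5 * (x - 2 * y) * b)) ≤ (99 / 100 * (2 * x - 1) - y) * a - x * b := by
  have e1 := mul_nonneg (sub_nonneg.2 h1) (sub_nonneg.2 hx)
  have e2 := mul_nonneg (sub_nonneg.2 h1) (sub_nonneg.2 hy1)
  have e3 := mul_nonneg (sub_nonneg.2 h1) (sub_nonneg.2 hy2)
  have e4 := mul_nonneg (sub_nonneg.2 h2) (sub_nonneg.2 hx)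
  have e5 := mul_nonneg (sub_nonneg.2 h2) (sub_nonneg.2 hy1)
  have e6 := mul_nonneg (sub_nonneg.2 h2) (sub_nonneg.2 hy2)
  refine ⟨?_, ?_, ?_⟩ <;> linarith

/-- A step along the corridor narrows the vertical cone and doubles heights. Here and below,
`c * b ^ 2 ≤ b * b'` says that `b'` has the sign of `b` and at least `c` times its size. -/
lemma cone_corridor {m v : ℝ × ℝ} (hm : m ∈ corridor) (hv : Cone 3 v) :
    Cone (7 / 5) (phiLin m v) ∧ 2 * v.2 ^ 2 ≤ v.2 * (phiLin m v).2 := by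
  obtain ⟨hx, hy1, hy2⟩ := hm
  unfold Cone at *
  simp only [phiLin]
  rcases le_total 0 v.2 with hb | hb
  · rw [abs_of_nonneg hb, abs_le] at hv
    obtain ⟨k1, k2, k3⟩ := cone_corridor_aux hx hy1 hy2 hb hv.2 hv.1
    refine ⟨?_, by nlinarith⟩
    rw [abs_of_nonneg (a := 5 * m.2 * v.1 + 5 * (m.1 - 2 * m.2) * v.2) (by linarith)]
    exact abs_le.2 ⟨k3, k2⟩
  · rw [abs_of_nonpos hb, abs_le] at hv
    obtain ⟨k1, k2, k3⟩ := cone_corridor_aux (a := -v.1) (b := -v.2) hx hy1 hy2 (by linarith)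
      (by linarith) (by linarith)
    refine ⟨?_, by nlinarith⟩
    rw [abs_of_nonpos (a := 5 * m.2 * v.1 + 5 * (m.1 - 2 * m.2) * v.2) (by linarith)]
    exact abs_le.2 ⟨by linarith, by linarith⟩

lemma cone_strip_aux {x y a b : ℝ} (hx : 31 / 200 ≤ x) (hx' : x ≤ 7 / 5)
    (hy1 : -(1 / 100000) ≤ y) (hy2 : y ≤ 1 / 100000)
    (hb : 0 ≤ b) (h1 : a ≤ 3 * b) (h2 : -(3 * b) ≤ a) :
    7 / 10 * b ≤ 5 * y * a + 5 * (x - 2 * y) * b ∧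
    (99 / 100 * (2 * x - 1) - y) * a - x * b ≤ 3 * (5 * y * a + 5 * (x - 2 * y) * b) ∧
    -(3 * (5 * y * a + 5 * (x - 2 * y) * b)) ≤ (99 / 100 * (2 * x - 1) - y) * a - x * b := by
  have e1 := mul_nonneg (sub_nonneg.2 h1) (sub_nonneg.2 hx)
  have e2 := mul_nonneg (sub_nonneg.2 h1) (sub_nonneg.2 hy1)
  have e3 := mul_nonneg (sub_nonneg.2 h1) (sub_nonneg.2 hy2)
  have e4 := mul_nonneg (sub_nonneg.2 h2) (sub_nonneg.2 hx)
  have e5 := mul_nonneg (sub_nonneg.2 h2) (sub_nonneg.2 hy1)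
  have e6 := mul_nonneg (sub_nonneg.2 h2) (sub_nonneg.2 hy2)
  have e7 := mul_nonneg (sub_nonneg.2 h1) (sub_nonneg.2 hx')
  have e8 := mul_nonneg (sub_nonneg.2 h2) (sub_nonneg.2 hx')
  refine ⟨?_, ?_, ?_⟩ <;> linarith

/-- The first step preserves the cone, on both sides of the fold. Heights may shrink slightly, since
the factor `5 * m.1` is below `1` at the left end of the strip. -/
lemma cone_strip {m v : ℝ × ℝ} (hm : m ∈ strip) (hv : Cone 3 v) :
    Cone 3 (phiLin m v) ∧ 7 / 10 * v.2 ^ 2 ≤ v.2 * (phiLin m v).2 := by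
  obtain ⟨hx, hx', hy⟩ := hm
  rw [abs_le] at hy
  unfold Cone at *
  simp only [phiLin]
  rcases le_total 0 v.2 with hb | hb
  · rw [abs_of_nonneg hb, abs_le] at hv
    obtain ⟨k1, k2, k3⟩ := cone_strip_aux hx hx' hy.1 hy.2 hb hv.2 hv.1
    refine ⟨?_, by nlinarith⟩
    rw [abs_of_nonneg (a := 5 * m.2 * v.1 + 5 * (m.1 - 2 * m.2) * v.2) (by linarith)]
    exact abs_le.2 ⟨k3, k2⟩
  · rw [abs_of_nonpos hb, abs_le] at hv
    obtain ⟨k1, k2, k3⟩ := cone_strip_aux (a := -v.1) (b := -v.2) hx hx' hy.1 hy.2 (by linarith)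
      (by linarith) (by linarith)
    refine ⟨?_, by nlinarith⟩
    rw [abs_of_nonpos (a := 5 * m.2 * v.1 + 5 * (m.1 - 2 * m.2) * v.2) (by linarith)]
    exact abs_le.2 ⟨by linarith, by linarith⟩

/-- A chain of tangent vectors, or of differences of two orbits, along the corridor keeps to the
cone and is stretched vertically. -/
lemma chain_corridor {n : ℕ} {m v : ℕ → ℝ × ℝ} (hv : ∀ j < n, v (j + 1) = phiLin (m j) (v j))
    (hm : ∀ j < n, m j ∈ corridor) (h0 : Cone 3 (v 0)) :
    (0 < n → Cone (7 / 5) (v n)) ∧ Cone 3 (v n) ∧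
      (2 : ℝ) ^ n * (v 0).2 ^ 2 ≤ (v 0).2 * (v n).2 := by
  induction n with
  | zero => exact ⟨fun h => absurd h (lt_irrefl _), h0, by rw [pow_zero, one_mul, sq]⟩
  | succ n ih =>
    obtain ⟨-, h3, h4⟩ := ih (fun j hj => hv j (by omega)) (fun j hj => hm j (by omega))
    obtain ⟨k1, k2⟩ := cone_corridor (hm n (by omega)) h3
    rw [← hv n (by omega)] at k1 k2
    refine ⟨fun _ => k1, k1.mono (by norm_num), ?_⟩
    have := sq_le_trans (by positivity) (by norm_num) h4 k2
    rwa [pow_succ]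

/-- A chain with one step in the strip and all others in the corridor. -/
lemma chain_strip {n : ℕ} {m v : ℕ → ℝ × ℝ} (hv : ∀ j < n, v (j + 1) = phiLin (m j) (v j))
    (hn : 2 ≤ n) (hm0 : m 0 ∈ strip) (hm : ∀ j, 1 ≤ j → j < n → m j ∈ corridor)
    (h0 : Cone 3 (v 0)) :
    Cone (7 / 5) (v n) ∧ (7 / 10 * 2 ^ (n - 1) : ℝ) * (v 0).2 ^ 2 ≤ (v 0).2 * (v n).2 := by
  obtain ⟨k1, k2⟩ := cone_strip hm0 h0
  rw [← hv 0 (by omega)] at k1 k2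
  obtain ⟨l1, l2, l3⟩ := chain_corridor (n := n - 1) (m := fun j => m (j + 1))
    (v := fun j => v (j + 1)) (fun j hj => hv _ (by omega))
    (fun j hj => hm _ (by omega) (by omega)) k1
  have e : n - 1 + 1 = n := by omega
  simp only [e] at l1 l2 l3
  exact ⟨l1 (by omega), sq_le_trans (by norm_num) (by positivity) k2 l3⟩

/-! ### The two returns to the strip -/

/-- The window, along the edge `x = 1`, of the points that return to the strip after two steps:
close to the fixed point for `i = 0`, close to the diagonal preimage for `i = 1`. -/
def box (i : Fin 2) : Set (ℝ × ℝ) :=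
  if i = 0 then {p | 93 / 100 ≤ p.1 ∧ p.1 ≤ 201 / 200 ∧ -(1 / 1000) ≤ p.2 ∧ p.2 ≤ 1 / 1000}
  else {p | 93 / 100 ≤ p.1 ∧ p.1 ≤ 509 / 500 ∧ 197 / 1000 ≤ p.2 ∧ p.2 ≤ 209 / 1000}

lemma mem_box_zero {p : ℝ × ℝ} : p ∈ box 0 ↔
    93 / 100 ≤ p.1 ∧ p.1 ≤ 201 / 200 ∧ -(1 / 1000) ≤ p.2 ∧ p.2 ≤ 1 / 1000 := by
  simp [box]

lemma mem_box_one {p : ℝ × ℝ} : p ∈ box 1 ↔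
    93 / 100 ≤ p.1 ∧ p.1 ≤ 509 / 500 ∧ 197 / 1000 ≤ p.2 ∧ p.2 ≤ 209 / 1000 := by
  simp [box]

/-- The orientation (`1` or `-1`) of the vertical direction after the return through `box i`. -/
def sgn (i : Fin 2) : ℝ := if i = 0 then 1 else -1

@[simp] lemma sgn_zero : sgn 0 = 1 := by simp [sgn]
@[simp] lemma sgn_one : sgn 1 = -1 := by simp [sgn]

/-- The region visited one step after `box i` by the points returning to the strip. -/
def box' (i : Fin 2) : Set (ℝ × ℝ) :=
  if i = 0 then {p | 9 / 10 ≤ p.1 ∧ p.1 ≤ 51 / 50 ∧ |p.2| ≤ 1 / 100}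
  else {p | 7 / 10 ≤ p.1 ∧ p.1 ≤ 83 / 100 ∧ |p.1 - p.2| ≤ 1 / 1000}

lemma mid_box {i : Fin 2} {p q : ℝ × ℝ} (hp : p ∈ box i) (hq : q ∈ box i) : mid p q ∈ box i := by
  fin_cases i
  · simp only [Fin.zero_eta, mem_box_zero, mid] at *
    refine ⟨?_, ?_, ?_, ?_⟩ <;> linarith
  · simp only [Fin.mk_one, mem_box_one, mid] at *
    refine ⟨?_, ?_, ?_, ?_⟩ <;> linarith

lemma mid_box' {i : Fin 2} {p q : ℝ × ℝ} (hp : p ∈ box' i) (hq : q ∈ box' i) :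
    mid p q ∈ box' i := by
  fin_cases i
  · simp only [box', Fin.zero_eta, if_true, mem_ofPred_eq, mid, abs_le] at *
    refine ⟨?_, ?_, ?_, ?_⟩ <;> linarith [hp.2.2.1, hp.2.2.2, hq.2.2.1, hq.2.2.2]
  · simp only [box', Fin.mk_one, one_ne_zero, if_false, mem_ofPred_eq, mid, abs_le] at *
    refine ⟨?_, ?_, ?_, ?_⟩ <;> linarith [hp.2.2.1, hp.2.2.2, hq.2.2.1, hq.2.2.2]

lemma phi_mem_box' {i : Fin 2} {p : ℝ × ℝ} (hp : p ∈ box i) (h : phi (phi p) ∈ strip) :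
    phi p ∈ box' i := by
  fin_cases i
  · simp only [Fin.zero_eta, mem_box_zero] at hp
    obtain ⟨h1, h2, h3, h4⟩ := hp
    simp only [box', Fin.zero_eta, if_true, mem_ofPred_eq, abs_le, phi_fst, phi_snd]
    refine ⟨?_, ?_, ?_, ?_⟩ <;> nlinarith
  · simp only [Fin.mk_one, mem_box_one] at hp
    obtain ⟨h1, h2, h3, h4⟩ := hp
    have hx1 : 7 / 10 ≤ (phi p).1 := by rw [phi_fst]; nlinarith
    have hx2 : (phi p).1 ≤ 83 / 100 := by rw [phi_fst]; nlinarith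
    have hy : 13 / 20 ≤ (phi p).2 := by rw [phi_snd]; nlinarith
    have h5 := h.2.2
    rw [phi_snd (phi p), abs_mul, abs_of_nonneg (by linarith)] at h5
    simp only [box', Fin.mk_one, one_ne_zero, if_false, mem_ofPred_eq]
    refine ⟨hx1, hx2, ?_⟩
    nlinarith [abs_nonneg ((phi p).1 - (phi p).2)]

lemma cone_box_one_aux {x y a b : ℝ} (hx : 93 / 100 ≤ x) (hx' : x ≤ 509 / 500)
    (hy1 : 197 / 1000 ≤ y) (hy2 : y ≤ 209 / 1000)
    (hb : 0 ≤ b) (h1 : a ≤ 7 / 5 * b) (h2 : -(7 / 5 * b) ≤ a) :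
    b ≤ 5 * y * a + 5 * (x - 2 * y) * b ∧ 5 * y * a + 5 * (x - 2 * y) * b ≤ 6 * b ∧
    (99 / 100 * (2 * x - 1) - y) * a - x * b - (5 * y * a + 5 * (x - 2 * y) * b) ≤ -(2 * b) ∧
    -(3 * b) ≤ (99 / 100 * (2 * x - 1) - y) * a - x * b ∧
    (99 / 100 * (2 * x - 1) - y) * a - x * b ≤ b := by
  have e1 := mul_nonneg (sub_nonneg.2 h1) (sub_nonneg.2 hx)
  have e2 := mul_nonneg (sub_nonneg.2 h1) (sub_nonneg.2 hy1)
  have e3 := mul_nonneg (sub_nonneg.2 h1) (sub_nonneg.2 hy2)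
  have e4 := mul_nonneg (sub_nonneg.2 h2) (sub_nonneg.2 hx)
  have e5 := mul_nonneg (sub_nonneg.2 h2) (sub_nonneg.2 hy1)
  have e6 := mul_nonneg (sub_nonneg.2 h2) (sub_nonneg.2 hy2)
  have e7 := mul_nonneg (sub_nonneg.2 h1) (sub_nonneg.2 hx')
  have e8 := mul_nonneg (sub_nonneg.2 h2) (sub_nonneg.2 hx')
  refine ⟨?_, ?_, ?_, ?_, ?_⟩ <;> linarith

/-- The second step through `box' 1`: close to the diagonal the new vertical component is about
`5x (a - b)`. -/
lemma cone_box'_one_aux {x y a b c : ℝ} (hx : 7 / 10 ≤ x) (hx' : x ≤ 83 / 100)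
    (hxy : |x - y| ≤ 1 / 1000) (hc : 0 ≤ c) (hb : c ≤ b) (hb' : b ≤ 6 * c)
    (hab : a - b ≤ -(2 * c)) (h1 : -(3 * c) ≤ a) (h2 : a ≤ c) :
    5 * y * a + 5 * (x - 2 * y) * b ≤ -(4 * c) ∧
    |(99 / 100 * (2 * x - 1) - y) * a - x * b| ≤ 3 * -(5 * y * a + 5 * (x - 2 * y) * b) := by
  rw [abs_le] at hxy
  obtain ⟨d, rfl⟩ : ∃ d, y = x - d := ⟨x - y, by ring⟩
  have hd1 : d ≤ 1 / 1000 := by linarith [hxy.2]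
  have hd2 : -(1 / 1000) ≤ d := by linarith [hxy.1]
  have f1 := mul_nonneg (sub_nonneg.2 hx) (sub_nonneg.2 hab)
  have f2 := mul_nonneg (sub_nonneg.2 hx') (sub_nonneg.2 hab)
  have f3 := mul_nonneg (sub_nonneg.2 hd1) (sub_nonneg.2 hb)
  have f4 := mul_nonneg (sub_nonneg.2 hd2) (sub_nonneg.2 hb)
  have f5 := mul_nonneg (sub_nonneg.2 hd1) (sub_nonneg.2 hb')
  have f6 := mul_nonneg (sub_nonneg.2 hd2) (sub_nonneg.2 hb')
  have f7 := mul_nonneg (sub_nonneg.2 hd1) (sub_nonneg.2 h1)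
  have f8 := mul_nonneg (sub_nonneg.2 hd2) (sub_nonneg.2 h1)
  have f9 := mul_nonneg (sub_nonneg.2 hd1) (sub_nonneg.2 h2)
  have f10 := mul_nonneg (sub_nonneg.2 hd2) (sub_nonneg.2 h2)
  have g1 := mul_nonneg (sub_nonneg.2 hx) (sub_nonneg.2 h1)
  have g2 := mul_nonneg (sub_nonneg.2 hx') (sub_nonneg.2 h1)
  have g3 := mul_nonneg (sub_nonneg.2 hx) (sub_nonneg.2 h2)
  have g4 := mul_nonneg (sub_nonneg.2 hx') (sub_nonneg.2 h2)
  have g5 := mul_nonneg (sub_nonneg.2 hx) (sub_nonneg.2 hb)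
  have g6 := mul_nonneg (sub_nonneg.2 hx') (sub_nonneg.2 hb)
  have g7 := mul_nonneg (sub_nonneg.2 hx) (sub_nonneg.2 hb')
  have g8 := mul_nonneg (sub_nonneg.2 hx') (sub_nonneg.2 hb')
  have k := mul_nonneg hc (sub_nonneg.2 hd1)
  have k' := mul_nonneg hc (sub_nonneg.2 hd2)
  refine ⟨by linarith, abs_le.2 ⟨by linarith, by linarith⟩⟩

/-- The two steps through a window return the cone to itself, multiply heights by at least `4`, and
reverse the vertical direction exactly in the upper window. -/
lemma cone_box {i : Fin 2} {m n v : ℝ × ℝ} (hm : m ∈ box i) (hn : n ∈ box' i)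
    (hv : Cone (7 / 5) v) :
    Cone 3 (phiLin n (phiLin m v)) ∧
      4 * v.2 ^ 2 ≤ sgn i * (v.2 * (phiLin n (phiLin m v)).2) := by
  fin_cases i
  · simp only [Fin.zero_eta, mem_box_zero] at hm
    simp only [box', Fin.zero_eta, if_true, mem_ofPred_eq, abs_le] at hn
    obtain ⟨k1, k2⟩ := cone_corridor (m := m)
      ⟨by linarith [hm.1], by linarith [hm.2.2.1], by linarith [hm.2.2.2]⟩
      (hv.mono (by norm_num))
    obtain ⟨l1, l2⟩ := cone_corridor (m := n)
      ⟨by linarith [hn.1], by linarith [hn.2.2.1], by linarith [hn.2.2.2]⟩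
      (k1.mono (by norm_num))
    refine ⟨l1.mono (by norm_num), ?_⟩
    have := sq_le_trans (by norm_num) (by norm_num) k2 l2
    simp only [Fin.zero_eta, sgn_zero]
    linarith
  · simp only [Fin.mk_one, mem_box_one] at hm
    simp only [box', Fin.mk_one, one_ne_zero, if_false, mem_ofPred_eq] at hn
    obtain ⟨m1, m2, m3, m4⟩ := hm
    obtain ⟨n1, n2, n3⟩ := hn
    unfold Cone at *
    simp only [Fin.mk_one, sgn_one]
    rcases le_total 0 v.2 with hb | hb
    · rw [abs_of_nonneg hb, abs_le] at hv
      obtain ⟨k1, k2, k3, k4, k5⟩ := cone_box_one_aux m1 m2 m3 m4 hb hv.2 hv.1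
      obtain ⟨l1, l2⟩ := cone_box'_one_aux n1 n2 n3 hb k1 k2 k3 k4 k5
      simp only [phiLin]
      refine ⟨?_, by nlinarith⟩
      rw [abs_of_nonpos (a := 5 * n.2 * _ + _) (by linarith)]
      exact l2
    · rw [abs_of_nonpos hb, abs_le] at hv
      obtain ⟨k1, k2, k3, k4, k5⟩ := cone_box_one_aux (a := -v.1) (b := -v.2) m1 m2 m3 m4
        (by linarith) (by linarith) (by linarith)
      obtain ⟨l1, l2⟩ := cone_box'_one_aux n1 n2 n3 (by linarith) k1 k2 k3 k4 k5
      have e : phiLin n (phiLin m v) = -phiLin n (phiLin m (-v)) := by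
        ext <;> simp only [phiLin, Prod.fst_neg, Prod.snd_neg] <;> ring
      rw [e]
      simp only [Prod.fst_neg, Prod.snd_neg, abs_neg, phiLin]
      refine ⟨?_, by nlinarith⟩
      rw [abs_of_nonpos (a := 5 * n.2 * _ + _) (by linarith)]
      exact l2

/-! ### Long passages along the axis -/

/-- The orbit of `p` starts in the strip and stays in the corridor up to time `N`. -/
def Passes (N : ℕ) (p : ℝ × ℝ) : Prop :=
  p ∈ strip ∧ ∀ j, 1 ≤ j → j < N → phi^[j] p ∈ corridor

/-- The quantitative meaning of `N` being large. The base `497/500` is the rate at which long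
passages contract horizontally, and is slower than all other geometric rates that occur. -/
def IsLong (N : ℕ) : Prop := 10 ≤ N ∧ (497 / 500 : ℝ) ^ N ≤ 1 / 10 ^ 9

lemma exists_isLong : ∃ N, IsLong N := by
  have h := tendsto_pow_atTop_nhds_zero_of_lt_one (r := (497 / 500 : ℝ)) (by norm_num)
    (by norm_num)
  have h1 : ∀ᶠ n : ℕ in atTop, (497 / 500 : ℝ) ^ n ≤ 1 / 10 ^ 9 :=
    (h.eventually (Iio_mem_nhds (by norm_num : (0 : ℝ) < 1 / 10 ^ 9))).mono fun n hn => hn.le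
  exact ((eventually_ge_atTop 10).and h1).exists

lemma IsLong.two_le {N : ℕ} (hN : IsLong N) : 2 ≤ N := by have := hN.1; omega

/-- The difference of two orbits evolves by the derivative at the midpoints. -/
lemma secant_succ (p q : ℝ × ℝ) (j : ℕ) : phi^[j + 1] q - phi^[j + 1] p =
    phiLin (mid (phi^[j] p) (phi^[j] q)) (phi^[j] q - phi^[j] p) := by
  rw [Function.iterate_succ_apply', Function.iterate_succ_apply', phi_sub]

/-- Passing points whose difference is nearly vertical keep that property, and their heights
separate with their order preserved. -/
lemma Passes.cone_sub {N : ℕ} (hN : 2 ≤ N) {p q : ℝ × ℝ} (hp : Passes N p) (hq : Passes N q)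
    (h : Cone 3 (q - p)) : Cone (7 / 5) (phi^[N] q - phi^[N] p) ∧
      (7 / 10 * 2 ^ (N - 1) : ℝ) * (q - p).2 ^ 2 ≤
        (q - p).2 * (phi^[N] q - phi^[N] p).2 :=
  chain_strip (m := fun j => mid (phi^[j] p) (phi^[j] q))
    (v := fun j => phi^[j] q - phi^[j] p) (fun j _ => secant_succ p q j) hN
    (mid_strip hp.1 hq.1) (fun j h1 h2 => mid_corridor (hp.2 j h1 h2) (hq.2 j h1 h2)) h

/-- The infinitesimal version of `Passes.cone_sub`. -/
lemma Passes.cone_tang {N : ℕ} (hN : 2 ≤ N) {p v : ℝ × ℝ} (hp : Passes N p) (h : Cone 3 v) :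
    Cone (7 / 5) (tang N p v) ∧
      (7 / 10 * 2 ^ (N - 1) : ℝ) * v.2 ^ 2 ≤ v.2 * (tang N p v).2 := by
  have := chain_strip (m := fun j => phi^[j] p) (v := fun j => tang j p v)
    (fun j _ => tang_succ j p v) hN hp.1 hp.2 (by simpa only [tang_zero] using h)
  simpa only [tang_zero] using this

lemma one_le_growth {N : ℕ} (hN : 2 ≤ N) : (1 : ℝ) ≤ 7 / 10 * 2 ^ (N - 1) := by
  have : (2 : ℝ) ^ 1 ≤ 2 ^ (N - 1) := pow_le_pow_right₀ (by norm_num) (by omega)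
  linarith

lemma Passes.snd_le {N : ℕ} (hN : 2 ≤ N) {p q : ℝ × ℝ} (hp : Passes N p) (hq : Passes N q)
    (h : Cone 3 (q - p)) : |q.2 - p.2| ≤ |(phi^[N] q).2 - (phi^[N] p).2| := by
  have h1 := abs_le_of_sq_le (hp.cone_sub hN hq h).2
  simp only [Prod.snd_sub] at h1
  nlinarith [one_le_growth hN, abs_nonneg (q.2 - p.2)]

lemma Passes.eq_of_cone {N : ℕ} (hN : 2 ≤ N) {p q : ℝ × ℝ} (hp : Passes N p) (hq : Passes N q)
    (h : Cone 3 (q - p)) (he : (phi^[N] q).2 = (phi^[N] p).2) : q = p := by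
  have h1 := hp.snd_le hN hq h
  rw [he, sub_self, abs_zero] at h1
  exact sub_eq_zero.1 (h.eq_zero (abs_eq_zero.1 (le_antisymm h1 (abs_nonneg _))))

/-- Two passing points on the same vertical line that end at the same height coincide. -/
lemma Passes.eq_of_fst_eq {N : ℕ} (hN : 2 ≤ N) {p q : ℝ × ℝ} (hp : Passes N p)
    (hq : Passes N q) (h : q.1 = p.1) (he : (phi^[N] q).2 = (phi^[N] p).2) : q = p :=
  hp.eq_of_cone hN hq (cone_vertical (by norm_num) (by simp [h])) he

/-! ### Existence of passing points -/

/-- Truncation of the second coordinate to the corridor. -/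
noncomputable def clip (t : ℝ) : ℝ := max (-(1 / 100)) (min (7 / 100) t)

lemma clip_le (t : ℝ) : clip t ≤ 7 / 100 := max_le (by norm_num) (min_le_left _ _)

lemma clip_eq {t : ℝ} (h1 : -(1 / 100) ≤ t) (h2 : t ≤ 7 / 100) : clip t = t := by
  unfold clip; rw [min_eq_right h2, max_eq_right h1]

lemma le_clip {s t : ℝ} (hs : s ≤ 7 / 100) (h : s ≤ t) : s ≤ clip t :=
  le_max_of_le_right (le_min hs h)

lemma clip_le' {s t : ℝ} (hs : -(1 / 100) ≤ s) (h : t ≤ s) : clip t ≤ s :=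
  max_le hs (min_le_of_right_le h)

/-- The map `phi` precomposed with the truncation. Its orbits never leave the region to the right of
the fold, so that end heights can be estimated for every starting point in the strip. -/
noncomputable def phiClip (p : ℝ × ℝ) : ℝ × ℝ := phi (p.1, clip p.2)

lemma continuous_phiClip : Continuous phiClip := by
  unfold phiClip clip
  exact continuous_phi.comp (by fun_prop)

lemma phi_fst_ge {x y : ℝ} (hx : 3 / 4 ≤ x) (hy : y ≤ 7 / 100) : 3 / 4 ≤ (phi (x, y)).1 := by
  rw [phi_fst]; simp only; nlinarith

lemma phi_fst_ge_of_strip {p : ℝ × ℝ} (hp : p ∈ strip) : 3 / 4 ≤ (phi p).1 := by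
  obtain ⟨h1, h2, h3⟩ := hp
  rw [abs_le] at h3
  rw [phi_fst]
  nlinarith [sq_nonneg (p.1 - 1 / 2)]

lemma mem_strip_of_abs {x y : ℝ} (hx : 31 / 200 ≤ x) (hx' : x ≤ 7 / 5) (hy : |y| ≤ 1 / 100000) :
    (x, y) ∈ strip := ⟨hx, hx', hy⟩

lemma phiClip_eq {p : ℝ × ℝ} (h1 : -(1 / 100) ≤ p.2) (h2 : p.2 ≤ 7 / 100) :
    phiClip p = phi p := by
  unfold phiClip; rw [clip_eq h1 h2]

lemma phiClip_iterate_fst {p : ℝ × ℝ} (hp : p ∈ strip) (j : ℕ) :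
    3 / 4 ≤ (phiClip^[j + 1] p).1 := by
  induction j with
  | zero =>
    have h3 := abs_le.1 hp.2.2
    rw [zero_add, Function.iterate_one, phiClip_eq (by linarith [h3.1]) (by linarith [h3.2])]
    exact phi_fst_ge_of_strip hp
  | succ j ih =>
    rw [Function.iterate_succ_apply']
    exact phi_fst_ge ih (clip_le _)

lemma phiClip_snd_ge {p : ℝ × ℝ} {t : ℝ} (hp : 3 / 4 ≤ p.1) (ht : 0 ≤ t) (ht' : t ≤ 7 / 100)
    (h : t ≤ p.2) : 17 / 5 * t ≤ (phiClip p).2 := by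
  have h1 := le_clip ht' h
  have h2 := clip_le p.2
  unfold phiClip
  rw [phi_snd]; simp only
  nlinarith

lemma phiClip_snd_le {p : ℝ × ℝ} {t : ℝ} (hp : 3 / 4 ≤ p.1) (ht : 0 ≤ t) (ht' : t ≤ 1 / 100)
    (h : p.2 ≤ -t) : (phiClip p).2 ≤ -(17 / 5 * t) := by
  have h1 := clip_le' (by linarith) h
  unfold phiClip
  rw [phi_snd]; simp only
  nlinarith

lemma growth_long {N : ℕ} (hN : IsLong N) : (10000 : ℝ) ≤ 7 / 1000000 * (17 / 5) ^ (N - 2) * 100 := by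
  obtain ⟨h1, h2⟩ := hN
  have h3 : (497 / 500 : ℝ) ^ N * (17 / 5) ^ N ≥ 1 := by
    rw [← mul_pow]; exact one_le_pow₀ (by norm_num)
  have h4 : (10 : ℝ) ^ 9 ≤ (17 / 5) ^ N := by
    have h5 : 0 < (17 / 5 : ℝ) ^ N := by positivity
    have := mul_le_mul_of_nonneg_right h2 h5.le
    rw [div_mul_eq_mul_div, one_mul] at this
    have h6 := h3.le.trans this
    rwa [le_div_iff₀ (by positivity), one_mul] at h6
  have h5 : (17 / 5 : ℝ) ^ N = (17 / 5) ^ (N - 2) * (17 / 5) ^ 2 := by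
    rw [← pow_add]; congr 1; omega
  rw [h5] at h4
  norm_num at h4 ⊢
  linarith

lemma phiClip_end_ge {N : ℕ} (hN : IsLong N) {x : ℝ} (hx : 31 / 200 ≤ x) (hx' : x ≤ 7 / 5) :
    22 / 100 ≤ (phiClip^[N] (x, 1 / 100000)).2 := by
  have hp : ((x, 1 / 100000) : ℝ × ℝ) ∈ strip :=
    mem_strip_of_abs hx hx' (by norm_num [abs_of_pos])
  have key : ∀ j : ℕ, min (7 / 100) (7 / 1000000 * (17 / 5 : ℝ) ^ j) ≤
      (phiClip^[j + 1] (x, 1 / 100000)).2 := by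
    intro j
    induction j with
    | zero =>
      apply min_le_of_right_le
      rw [zero_add, Function.iterate_one, phiClip_eq (by norm_num) (by norm_num), phi_snd]
      simp only; linarith
    | succ j ih =>
      rw [Function.iterate_succ_apply']
      refine le_trans ?_ (phiClip_snd_ge (phiClip_iterate_fst hp j)
        (le_min (by norm_num) (by positivity)) (min_le_left _ _) ih)
      rcases min_cases (7 / 100 : ℝ) (7 / 1000000 * (17 / 5 : ℝ) ^ j) with h | h
      · rw [h.1]; exact min_le_of_left_le (by norm_num)
      · rw [h.1]; apply min_le_of_right_le; rw [pow_succ]; linarith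
  have h10 := hN.1
  have h2 := key (N - 2)
  have e : N = (N - 2 + 1) + 1 := by omega
  rw [min_eq_left (by linarith [growth_long hN])] at h2
  rw [e, Function.iterate_succ_apply']
  have := phiClip_snd_ge (phiClip_iterate_fst hp (N - 2)) (by norm_num) le_rfl h2
  linarith

lemma phiClip_end_le {N : ℕ} (hN : IsLong N) {x : ℝ} (hx : 31 / 200 ≤ x) (hx' : x ≤ 7 / 5) :
    (phiClip^[N] (x, -(1 / 100000))).2 ≤ -(1 / 1000) := by
  have hp : ((x, -(1 / 100000)) : ℝ × ℝ) ∈ strip :=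
    mem_strip_of_abs hx hx' (by norm_num [abs_of_pos])
  have key : ∀ j : ℕ, (phiClip^[j + 1] (x, -(1 / 100000))).2 ≤
      -min (1 / 100) (7 / 1000000 * (17 / 5 : ℝ) ^ j) := by
    intro j
    induction j with
    | zero =>
      rw [le_neg]
      apply min_le_of_right_le
      rw [zero_add, Function.iterate_one, phiClip_eq (by norm_num) (by norm_num), phi_snd]
      simp only; linarith
    | succ j ih =>
      rw [Function.iterate_succ_apply']
      refine (phiClip_snd_le (phiClip_iterate_fst hp j)
        (le_min (by norm_num) (by positivity)) (min_le_left _ _) ih).trans (neg_le_neg ?_)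
      rcases min_cases (1 / 100 : ℝ) (7 / 1000000 * (17 / 5 : ℝ) ^ j) with h | h
      · rw [h.1]; exact min_le_of_left_le (by norm_num)
      · rw [h.1]; apply min_le_of_right_le; rw [pow_succ]; linarith
  have h10 := hN.1
  have h2 := key (N - 2)
  have e : N = (N - 2 + 1) + 1 := by omega
  rw [min_eq_left (by linarith [growth_long hN])] at h2
  rw [e, Function.iterate_succ_apply']
  have := phiClip_snd_le (phiClip_iterate_fst hp (N - 2)) (by norm_num) le_rfl h2
  linarith

/-- Every vertical line through the strip carries a passing point that ends at a given height.
It is found by the intermediate value theorem for the truncated map; an orbit on which the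
truncation acts ends too high or too low. -/
lemma exists_passes {N : ℕ} (hN : IsLong N) {x h : ℝ} (hx : 31 / 200 ≤ x) (hx' : x ≤ 7 / 5)
    (hh : -(1 / 1000) ≤ h) (hh' : h ≤ 22 / 100) :
    ∃ y, Passes N (x, y) ∧ (phi^[N] (x, y)).2 = h := by
  have hc : ContinuousOn (fun y => (phiClip^[N] (x, y)).2) (Icc (-(1 / 100000)) (1 / 100000)) :=
    (continuous_snd.comp ((continuous_phiClip.iterate N).comp (by fun_prop))).continuousOn
  obtain ⟨y, hy, hyh⟩ := intermediate_value_Icc (by norm_num) hc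
    ⟨(phiClip_end_le hN hx hx').trans hh, hh'.trans (phiClip_end_ge hN hx hx')⟩
  simp only at hyh
  have hp : (x, y) ∈ strip := mem_strip_of_abs hx hx' (abs_le.2 hy)
  -- An orbit on which the truncation acts from above ends above `22/100`, and one on which it acts
  -- from below ends below `-(1/1000)`.
  have up : ∀ j, 7 / 100 < (phiClip^[j + 1] (x, y)).2 → j + 1 < N → False := by
    intro j hj hjN
    have : ∀ k, 7 / 100 ≤ (phiClip^[j + 1 + k] (x, y)).2 ∧
        (1 ≤ k → 23 / 100 ≤ (phiClip^[j + 1 + k] (x, y)).2) := by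
      intro k
      induction k with
      | zero => exact ⟨hj.le, fun h => by omega⟩
      | succ k ih =>
        have := phiClip_snd_ge (p := phiClip^[j + 1 + k] (x, y))
          (by have := phiClip_iterate_fst hp (j + k)
              rwa [show j + k + 1 = j + 1 + k by ring] at this) (by norm_num) le_rfl ih.1
        rw [← add_assoc, Function.iterate_succ_apply']
        exact ⟨by linarith, fun _ => by linarith⟩
    have h2 := (this (N - (j + 1))).2 (by omega)
    rw [show j + 1 + (N - (j + 1)) = N by omega, hyh] at h2
    linarith
  have down : ∀ j, (phiClip^[j + 1] (x, y)).2 < -(1 / 100) → j + 1 < N → False := by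
    intro j hj hjN
    have : ∀ k, (phiClip^[j + 1 + k] (x, y)).2 ≤ -(1 / 100) := by
      intro k
      induction k with
      | zero => exact hj.le
      | succ k ih =>
        have := phiClip_snd_le (p := phiClip^[j + 1 + k] (x, y))
          (by have := phiClip_iterate_fst hp (j + k)
              rwa [show j + k + 1 = j + 1 + k by ring] at this) (by norm_num) le_rfl ih
        rw [← add_assoc, Function.iterate_succ_apply']
        linarith
    have h2 := this (N - (j + 1))
    rw [show j + 1 + (N - (j + 1)) = N by omega, hyh] at h2
    linarith
  have bd : ∀ j < N, -(1 / 100) ≤ (phiClip^[j] (x, y)).2 ∧ (phiClip^[j] (x, y)).2 ≤ 7 / 100 := by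
    intro j hj
    rcases j with _ | j
    · exact ⟨by simp only [Function.iterate_zero, id]; linarith [hy.1],
        by simp only [Function.iterate_zero, id]; linarith [hy.2]⟩
    · exact ⟨not_lt.1 fun h => down j h hj, not_lt.1 fun h => up j h hj⟩
  have eq : ∀ j ≤ N, phiClip^[j] (x, y) = phi^[j] (x, y) := by
    intro j
    induction j with
    | zero => intro _; rfl
    | succ j ih =>
      intro hj
      rw [Function.iterate_succ_apply', Function.iterate_succ_apply', ← ih (by omega),
        phiClip_eq (bd j (by omega)).1 (bd j (by omega)).2]
  refine ⟨y, ⟨hp, fun j h1 h2 => ?_⟩, by rw [← eq N le_rfl, hyh]⟩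
  rw [← eq j h2.le]
  refine ⟨?_, bd j h2⟩
  have := phiClip_iterate_fst hp (j - 1)
  rwa [show j - 1 + 1 = j by omega] at this

/-! ### Order along the axis -/

/-- If the last vector of a chain along the corridor is not a nonzero vector of the cone, then no
vector of the chain is, and the sign of the first coordinate is preserved. -/
lemma chain_order {n : ℕ} {m v : ℕ → ℝ × ℝ} (hv : ∀ j < n, v (j + 1) = phiLin (m j) (v j))
    (hm : ∀ j < n, m j ∈ corridor) (hend : Cone (7 / 5) (v n) → (v n).2 = 0)
    (h0 : 0 < (v 0).1) : 0 < (v n).1 := by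
  have not_cone : ∀ j < n, 0 < (v j).1 → ¬ Cone 3 (v j) := by
    intro j hj hpos hc
    obtain ⟨k1, -, k3⟩ := chain_corridor (n := n - j) (m := fun k => m (j + k))
      (v := fun k => v (j + k)) (fun k hk => hv (j + k) (by omega))
      (fun k hk => hm (j + k) (by omega)) hc
    simp only [add_zero, show j + (n - j) = n by omega] at k1 k3
    rw [hend (k1 (by omega)), mul_zero] at k3
    have h4 : (0 : ℝ) < 2 ^ (n - j) := by positivity
    have h5 : (v j).2 = 0 := by
      by_contra h6
      have : 0 < (v j).2 ^ 2 := by positivity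
      nlinarith
    rw [hc.eq_zero h5] at hpos
    simp at hpos
  have : ∀ j ≤ n, 0 < (v j).1 := by
    intro j
    induction j with
    | zero => intro _; exact h0
    | succ j ih =>
      intro hj
      have h1 := ih (by omega)
      have h2 := not_cone j (by omega) h1
      obtain ⟨m1, m2, m3⟩ := hm j (by omega)
      unfold Cone at h2
      push Not at h2
      rw [abs_of_pos h1] at h2
      rw [hv j (by omega)]
      simp only [phiLin]
      have h3 := le_abs_self (v j).2
      nlinarith [mul_nonneg (sub_nonneg.2 m1) h1.le, mul_nonneg (sub_nonneg.2 m3) h1.le,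
        mul_le_mul_of_nonneg_left h3 (by linarith : 0 ≤ (m j).1)]
  exact this n le_rfl

/-- The order of the abscissas after the first step persists, provided that the final difference is
not a nonzero vector of the cone. -/
lemma Passes.order_of_phi {N : ℕ} (hN : 2 ≤ N) {p q : ℝ × ℝ} (hp : Passes N p) (hq : Passes N q)
    (hend : Cone (7 / 5) (phi^[N] q - phi^[N] p) → (phi^[N] q).2 = (phi^[N] p).2)
    (h : (phi p).1 < (phi q).1) : (phi^[N] p).1 < (phi^[N] q).1 := by
  have := chain_order (n := N - 1) (m := fun j => mid (phi^[j + 1] p) (phi^[j + 1] q))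
    (v := fun j => phi^[j + 1] q - phi^[j + 1] p) (fun j _ => secant_succ p q (j + 1))
    (fun j hj => mid_corridor (hp.2 _ (by omega) (by omega)) (hq.2 _ (by omega) (by omega)))
    (by
      simp only [show N - 1 + 1 = N by omega]
      intro hc
      simp [hend hc])
    (by simpa using h)
  simp only [show N - 1 + 1 = N by omega, Prod.fst_sub] at this
  linarith

/-- To the right of the fold, passing points that end in a horizontal direction keep their
order. -/
lemma Passes.order {N : ℕ} (hN : 2 ≤ N) {p q : ℝ × ℝ} (hp : Passes N p) (hq : Passes N q)
    (hend : Cone (7 / 5) (phi^[N] q - phi^[N] p) → (phi^[N] q).2 = (phi^[N] p).2)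
    (h9 : 9 / 10 ≤ p.1) (h : p.1 < q.1) : (phi^[N] p).1 < (phi^[N] q).1 := by
  apply hp.order_of_phi hN hq hend
  have hc : ¬ Cone 3 (q - p) := by
    intro hc
    obtain ⟨k1, k2⟩ := hp.cone_sub hN hq hc
    rw [hp.eq_of_cone hN hq hc (hend k1)] at h
    exact lt_irrefl _ h
  unfold Cone at hc
  push Not at hc
  simp only [Prod.fst_sub, Prod.snd_sub] at hc
  rw [abs_of_pos (a := q.1 - p.1) (by linarith)] at hc
  have e := congrArg Prod.fst (phi_sub p q)
  simp only [Prod.fst_sub, phiLin, mid, Prod.snd_sub] at e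
  have b1 := abs_le.1 hp.1.2.2
  have b2 := abs_le.1 hq.1.2.2
  have h3 := le_abs_self (q.2 - p.2)
  have h4 : 0 < q.1 - p.1 := by linarith
  have h5 : 0 ≤ (p.1 + q.1) / 2 := by linarith
  nlinarith [mul_le_mul_of_nonneg_left h3 h5,
    mul_nonneg h4.le (by linarith [b1.2, b2.2] : 0 ≤ 1 / 100000 - (p.2 + q.2) / 2),
    mul_nonneg h4.le (by linarith : 0 ≤ (p.1 + q.1) / 2 - 9 / 10),
    mul_le_mul_of_nonneg_left hc.le h5]

/-! ### Estimates for passing points -/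

lemma snd_step_nonneg {p : ℝ × ℝ} (hp : p ∈ corridor) (h : 0 ≤ p.2) :
    17 / 5 * p.2 ≤ (phi p).2 := by
  obtain ⟨h1, -, h3⟩ := hp
  rw [phi_snd]; nlinarith

lemma snd_step_nonpos {p : ℝ × ℝ} (hp : p ∈ corridor) (h : p.2 ≤ 0) :
    (phi p).2 ≤ 17 / 5 * p.2 := by
  obtain ⟨h1, -, h3⟩ := hp
  rw [phi_snd]; nlinarith

lemma Passes.snd_nonneg {N : ℕ} {p : ℝ × ℝ} (hp : Passes N p) {j : ℕ} (h1 : 1 ≤ j) (k : ℕ)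
    (hk : j + k ≤ N) (h : 0 ≤ (phi^[j] p).2) :
    (17 / 5 : ℝ) ^ k * (phi^[j] p).2 ≤ (phi^[j + k] p).2 := by
  induction k with
  | zero => simp
  | succ k ih =>
    have h2 := ih (by omega)
    have h3 := snd_step_nonneg (hp.2 (j + k) (by omega) (by omega))
      (le_trans (by positivity) h2)
    rw [← add_assoc, Function.iterate_succ_apply', pow_succ]
    linarith

lemma Passes.snd_nonpos {N : ℕ} {p : ℝ × ℝ} (hp : Passes N p) {j : ℕ} (h1 : 1 ≤ j) (k : ℕ)
    (hk : j + k ≤ N) (h : (phi^[j] p).2 ≤ 0) :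
    (phi^[j + k] p).2 ≤ (17 / 5 : ℝ) ^ k * (phi^[j] p).2 := by
  induction k with
  | zero => simp
  | succ k ih =>
    have h2 := ih (by omega)
    have h3 := snd_step_nonpos (hp.2 (j + k) (by omega) (by omega))
      (h2.trans (mul_nonpos_of_nonneg_of_nonpos (by positivity) h))
    rw [← add_assoc, Function.iterate_succ_apply', pow_succ]
    linarith

/-- Going back in time the height decreases geometrically. -/
lemma Passes.abs_snd_le {N : ℕ} {p : ℝ × ℝ} (hp : Passes N p) {j : ℕ} (h1 : 1 ≤ j) (hj : j ≤ N) :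
    (17 / 5 : ℝ) ^ (N - j) * |(phi^[j] p).2| ≤ |(phi^[N] p).2| := by
  rcases le_total 0 (phi^[j] p).2 with h | h
  · have := hp.snd_nonneg h1 (N - j) (by omega) h
    rw [show j + (N - j) = N by omega] at this
    rw [abs_of_nonneg h]
    exact this.trans (le_abs_self _)
  · have := hp.snd_nonpos h1 (N - j) (by omega) h
    rw [show j + (N - j) = N by omega] at this
    rw [abs_of_nonpos h]
    have h2 := neg_le_abs (phi^[N] p).2
    linarith

lemma Passes.neg_snd_le {N : ℕ} {p : ℝ × ℝ} (hp : Passes N p)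
    (hh : -(1 / 1000) ≤ (phi^[N] p).2) {j : ℕ} (h1 : 1 ≤ j) (hj : j ≤ N) :
    -(1 / 1000) ≤ (phi^[j] p).2 := by
  by_contra h
  push Not at h
  have := hp.snd_nonpos h1 (N - j) (by omega) (by linarith)
  rw [show j + (N - j) = N by omega] at this
  have h2 : (1 : ℝ) ≤ (17 / 5) ^ (N - j) := one_le_pow₀ (by norm_num)
  nlinarith

/-- A height that ends nonnegative was nonnegative before. -/
lemma Passes.snd_nonneg_of_end {N : ℕ} {p : ℝ × ℝ} (hp : Passes N p)
    (hh : 0 ≤ (phi^[N] p).2) {j : ℕ} (h1 : 1 ≤ j) (hj : j ≤ N) : 0 ≤ (phi^[j] p).2 := by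
  by_contra h
  push Not at h
  have := hp.snd_nonpos h1 (N - j) (by omega) h.le
  rw [show j + (N - j) = N by omega] at this
  have h2 : (0 : ℝ) < (17 / 5) ^ (N - j) := by positivity
  nlinarith

/-- One step of the bound on the excess of the abscissa over `1`. Negative heights push to the
right; the term `3/5 * max 0 (-p.2)` pays for this, because the depth below the axis more than
triples at each step, while the rest `a` of the excess contracts. -/
lemma fst_lower_step {p : ℝ × ℝ} {a : ℝ} (hx : 3 / 4 ≤ p.1) (hy : -(1 / 1000) ≤ p.2)
    (hy' : p.2 ≤ 7 / 100) (ha : 0 ≤ a) (ha' : a ≤ 1 / 1000)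
    (h : p.1 ≤ 1 + (a + 3 / 5 * max 0 (-p.2))) :
    (phi p).1 ≤ 1 + (124 / 125 * a + 3 / 5 * max 0 (-(phi p).2)) := by
  rw [phi_fst, phi_snd]
  rcases le_total 0 p.2 with h0 | h0
  · rw [max_eq_left (by linarith)] at h
    have := le_max_left 0 (-(5 * p.2 * (p.1 - p.2)))
    have e : -(124 / 125 * a) ≤ p.1 * (99 / 100 * (1 - p.1) + p.2) := by
      rcases le_total p.1 1 with h5 | h5
      · have : 0 ≤ p.1 * (99 / 100 * (1 - p.1) + p.2) := by
          apply mul_nonneg <;> linarith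
        linarith
      · nlinarith [mul_nonneg (by linarith : 0 ≤ p.1) h0]
    linarith
  · rw [max_eq_right (by linarith)] at h
    have h1 := le_max_right 0 (-(5 * p.2 * (p.1 - p.2)))
    obtain ⟨t, ht⟩ : ∃ t, t = -p.2 := ⟨_, rfl⟩
    have ht' : p.2 = -t := by linarith
    rw [← ht] at h
    have h2 : 15 / 4 * t ≤ -(5 * p.2 * (p.1 - p.2)) := by rw [ht']; nlinarith
    have h3 : -(p.1 * (99 / 100 * (1 - p.1) + p.2)) ≤ 124 / 125 * a + 3 / 5 * (15 / 4 * t) := by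
      rw [ht']
      rcases le_total p.1 1 with h5 | h5
      · nlinarith [mul_nonneg (by linarith : 0 ≤ p.1) (sub_nonneg.2 h5),
          mul_nonneg (by linarith : 0 ≤ t) (sub_nonneg.2 h5)]
      · obtain ⟨s, hs⟩ : ∃ s, s = p.1 - 1 := ⟨_, rfl⟩
        have hs' : p.1 = 1 + s := by linarith
        rw [hs'] at h h5 ⊢
        have : s ≤ 2 / 1000 := by linarith
        nlinarith
    linarith

/-- An orbit that starts at most slightly to the right of the fixed point stays so, apart from a
multiple of its depth below the axis. -/
lemma Passes.fst_le {N : ℕ} {p : ℝ × ℝ} (hp : Passes N p)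
    (hh : -(1 / 1000) ≤ (phi^[N] p).2) (h0 : p.1 ≤ 1 + 1 / 1000) {j : ℕ} (h1 : 1 ≤ j)
    (hj : j ≤ N) : (phi^[j] p).1 ≤
      1 + (1 / 1000 * (124 / 125) ^ j + 3 / 5 * max 0 (-(phi^[j] p).2)) := by
  induction j with
  | zero => omega
  | succ j ih =>
    rcases Nat.eq_zero_or_pos j with rfl | hj0
    · have hy := abs_le.1 hp.1.2.2
      rw [zero_add, Function.iterate_one, pow_one]
      rcases le_total (3 / 4) p.1 with h | h
      · have := fst_lower_step (p := p) (a := 1 / 1000) h (by linarith [hy.1])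
          (by linarith [hy.2]) (by norm_num) le_rfl
          (by linarith [le_max_left 0 (-p.2)])
        linarith
      · have e1 := le_max_left 0 (-(phi p).2)
        have e2 := hp.1.1
        have : 0 ≤ p.1 * (99 / 100 * (1 - p.1) + p.2) := by
          apply mul_nonneg <;> linarith [hy.1]
        rw [phi_fst] at *
        linarith
    · have hc := hp.2 j hj0 (by omega)
      have e := fst_lower_step hc.1 (hp.neg_snd_le hh hj0 (by omega)) hc.2.2
        (by positivity : (0 : ℝ) ≤ 1 / 1000 * (124 / 125) ^ j)
        (by have : (124 / 125 : ℝ) ^ j ≤ 1 := pow_le_one₀ (by norm_num) (by norm_num)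
            linarith) (ih hj0 (by omega))
      rw [Function.iterate_succ_apply', pow_succ]
      linarith

lemma pow_le_tiny {N : ℕ} (hN : IsLong N) {r : ℝ} (h0 : 0 ≤ r) (h1 : r ≤ 497 / 500) :
    r ^ N ≤ 1 / 10 ^ 9 :=
  (pow_le_pow_left₀ h0 h1 N).trans hN.2

/-- Passing points that start to the left of `1 + 1/1000` end strictly to the left of it. -/
lemma Passes.end_fst_lt {N : ℕ} (hN : IsLong N) {p : ℝ × ℝ} (hp : Passes N p)
    (hh : -(1 / 1000) ≤ (phi^[N] p).2) (h0 : p.1 ≤ 1 + 1 / 1000) :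
    (phi^[N] p).1 < 1001 / 1000 := by
  have h10 := hN.1
  have h1 := hp.fst_le hh h0 (j := N) (by omega) le_rfl
  have h2 := pow_le_tiny hN (r := 124 / 125) (by norm_num) (by norm_num)
  have h3 : max 0 (-(phi^[N] p).2) ≤ 1 / 1000 := max_le (by norm_num) (by linarith)
  norm_num at h2 ⊢
  linarith

lemma Passes.fst_le_of_start {N : ℕ} {p : ℝ × ℝ} (hp : Passes N p)
    (hh : -(1 / 1000) ≤ (phi^[N] p).2) (h0 : p.1 ≤ 1 + 1 / 1000) {j : ℕ}
    (hj : j ≤ N) : (phi^[j] p).1 ≤ 1 + 2 / 1000 := by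
  rcases Nat.eq_zero_or_pos j with rfl | h1
  · rw [Function.iterate_zero, id]; linarith
  have e := hp.fst_le hh h0 h1 hj
  have h3 : max 0 (-(phi^[j] p).2) ≤ 1 / 1000 :=
    max_le (by norm_num) (by linarith [hp.neg_snd_le hh h1 hj])
  have : (124 / 125 : ℝ) ^ j ≤ 1 := pow_le_one₀ (by norm_num) (by norm_num)
  linarith

/-- The distance by which an orbit stays to the left of the fixed point decays geometrically, up to
a multiple of the current height, which dominates the sum of all earlier heights. -/
lemma Passes.fst_ge {N : ℕ} {p : ℝ × ℝ} (hp : Passes N p) {j : ℕ} (h1 : 1 ≤ j) (hj : j ≤ N) :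
    1 - (1 / 4 * (99 / 100) ^ (j - 1) + 21 / 50 * max 0 (phi^[j] p).2) ≤ (phi^[j] p).1 := by
  induction j with
  | zero => omega
  | succ j ih =>
    rcases Nat.eq_zero_or_pos j with rfl | hj0
    · rw [zero_add, Function.iterate_one, Nat.sub_self, pow_zero]
      linarith [phi_fst_ge_of_strip hp.1, le_max_left 0 (phi p).2]
    · have hc := hp.2 j hj0 (by omega)
      have e := ih hj0 (by omega)
      rw [Function.iterate_succ_apply', show j + 1 - 1 = j - 1 + 1 by omega, pow_succ]
      set q := phi^[j] p
      have hpos : (0 : ℝ) ≤ 1 / 4 * (99 / 100) ^ (j - 1) := by positivity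
      set t : ℝ := 1 / 4 * (99 / 100) ^ (j - 1) with ht
      have h5 : max 0 q.2 * (17 / 5) ≤ max 0 (phi q).2 := by
        rcases le_total 0 q.2 with h | h
        · rw [max_eq_right h]
          exact le_max_of_le_right (by linarith [snd_step_nonneg hc h])
        · rw [max_eq_left h, zero_mul]; exact le_max_left _ _
      have h6 := le_max_left 0 q.2
      have h7 := le_max_right 0 q.2
      have h8 : q.1 * (99 / 100 * (1 - q.1) + q.2) ≤ 99 / 100 * (t + 21 / 50 * max 0 q.2)
          + max 0 q.2 := by
        have hc1 := hc.1
        rcases le_total q.1 1 with hq | hq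
        · have g1 : q.1 * (1 - q.1) ≤ 1 - q.1 := by nlinarith
          have g2 : q.1 * q.2 ≤ max 0 q.2 := by
            rcases le_total 0 q.2 with h | h
            · nlinarith
            · nlinarith
          linarith
        · have g1 : q.1 * (1 - q.1) ≤ 1 - q.1 := by nlinarith
          have g2 : q.1 * q.2 - q.2 ≤ 7 / 100 * (q.1 - 1) := by nlinarith [hc.2.2]
          linarith
      rw [phi_fst]
      have e2 : 1 / 4 * ((99 / 100 : ℝ) ^ (j - 1) * (99 / 100)) = 99 / 100 * t := by
        rw [ht]; ring
      rw [e2]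
      linarith

/-- The horizontal spread at the end of a long passage. -/
lemma Passes.end_fst_ge {N : ℕ} (hN : IsLong N) {p : ℝ × ℝ} (hp : Passes N p)
    (hh : (phi^[N] p).2 ≤ 22 / 100) : 93 / 100 ≤ (phi^[N] p).1 := by
  have h10 := hN.1
  -- The last step is estimated separately: its end point may lie as high as `22/100`, above the
  -- corridor.
  have e := hp.fst_ge (j := N - 1) (by omega) (by omega)
  obtain ⟨c1, c2, c3⟩ := hp.2 (N - 1) (by omega) (by omega)
  have hN1 : phi^[N] p = phi (phi^[N - 1] p) := by
    rw [← Function.iterate_succ_apply' phi]; congr 1; omega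
  rw [hN1] at hh ⊢
  have t1 := pow_le_tiny hN (r := 99 / 100) (by norm_num) (by norm_num)
  have t2 : (99 / 100 : ℝ) ^ N = (99 / 100) ^ (N - 1 - 1) * (99 / 100) ^ 2 := by
    rw [← pow_add]; congr 1; omega
  rw [t2] at t1
  have t3 : 1 / 4 * (99 / 100 : ℝ) ^ (N - 1 - 1) ≤ 1 / 10 ^ 6 := by
    norm_num at t1 ⊢; linarith
  set q := phi^[N - 1] p
  rw [phi_snd] at hh
  rw [phi_fst]
  rcases le_total 0 q.2 with h | h
  · rw [max_eq_right h] at e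
    have e1 : 97 / 100 ≤ q.1 := by norm_num at t3; linarith
    have e2 : q.2 ≤ 489 / 10000 := by nlinarith
    have e3 : 979 / 1000 ≤ q.1 := by norm_num at t3; linarith
    nlinarith
  · rw [max_eq_left h] at e
    have e1 : 99 / 100 ≤ q.1 := by norm_num at t3; linarith
    nlinarith

/-- Passing points that start far to the right end far to the right. -/
lemma Passes.end_fst_gt {N : ℕ} {p : ℝ × ℝ} (hp : Passes N p) (h0 : p.1 = 7 / 5) {j : ℕ}
    (hj : j ≤ N) : 7 / 5 ≤ (phi^[j] p).1 := by
  induction j with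
  | zero => simp [h0]
  | succ j ih =>
    have e := ih (by omega)
    rw [Function.iterate_succ_apply', phi_fst]
    have : (phi^[j] p).2 ≤ 7 / 100 := by
      rcases Nat.eq_zero_or_pos j with rfl | hj0
      · have := (abs_le.1 hp.1.2.2).2
        simp only [Function.iterate_zero, id]; linarith
      · exact (hp.2 j hj0 (by omega)).2.2
    nlinarith

/-! ### Curvilinear rectangles from coordinates -/

/-- A map into a compact set is continuous if its composition with a map that is continuous and
injective on that set is. -/
lemma continuousOn_of_comp_compact {X Y Z : Type*} [TopologicalSpace X] [TopologicalSpace Y]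
    [TopologicalSpace Z] [T2Space Y] {S : X → Z} {A : Set X} {K : Set Z} {G : Z → Y}
    (hK : IsCompact K)
    (hG : ContinuousOn G K) (hi : InjOn G K) (hS : MapsTo S A K)
    (hc : ContinuousOn (fun x => G (S x)) A) : ContinuousOn S A := by
  have : CompactSpace K := isCompact_iff_compactSpace.1 hK
  have he : IsClosedEmbedding (K.domRestrict G) :=
    hG.domRestrict.isClosedEmbedding (injOn_iff_injective.1 hi)
  have h1 : Continuous (hS.restrict S A K) := by
    rw [he.isInducing.continuous_iff]
    exact hc.domRestrict
  exact continuousOn_iff_continuous_domRestrict.2 (continuous_subtype_val.comp h1)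

/-- A continuous curve is `C¹` if its image under a `C¹` map with injective derivative is. -/
lemma contDiffOn_of_comp {S : ℝ → ℝ × ℝ} {G : ℝ × ℝ → ℝ × ℝ} {A : Set ℝ}
    (hS : ContinuousOn S A) (hG : ContDiff ℝ 1 G)
    (hd : ∀ t ∈ A, ∀ v, fderiv ℝ G (S t) v = 0 → v = 0)
    (hc : ContDiffOn ℝ 1 (fun t => G (S t)) A) : ContDiffOn ℝ 1 S A := by
  intro t ht
  have hinj : Function.Injective (fderiv ℝ G (S t)).toLinearMap := by
    rw [injective_iff_map_eq_zero]; exact hd t ht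
  let e : (ℝ × ℝ) ≃L[ℝ] (ℝ × ℝ) :=
    (LinearEquiv.ofInjectiveEndo _ hinj).toContinuousLinearEquiv
  have hf' : HasFDerivAt G (e : ℝ × ℝ →L[ℝ] ℝ × ℝ) (S t) := by
    have : (e : ℝ × ℝ →L[ℝ] ℝ × ℝ) = fderiv ℝ G (S t) := by ext <;> rfl
    rw [this]
    exact (hG.differentiable (by simp) _).hasFDerivAt
  have h1 := hG.contDiffAt.to_localInverse hf' (by simp)
  have h2 := (hG.contDiffAt.hasStrictFDerivAt' hf' (by simp)).eventually_left_inverse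
  have h3 : ContDiffWithinAt ℝ 1
      (fun s => hG.contDiffAt.localInverse hf' (by simp) (G (S s))) A t :=
    h1.comp_contDiffWithinAt t (hc t ht)
  refine h3.congr_of_eventuallyEq ?_ ?_
  · filter_upwards [(hS t ht).eventually h2] with s hs using hs.symm
  · exact h2.self_of_nhds.symm

/-- A curve in a compact set is `C¹` if its image under a `C¹` map that is injective and immersive
on this set is; its continuity need not be known beforehand. -/
lemma contDiffOn_of_compact {S : ℝ → ℝ × ℝ} {G : ℝ × ℝ → ℝ × ℝ} {A : Set ℝ}
    {K : Set (ℝ × ℝ)} (hK : IsCompact K) (hG : ContDiff ℝ 1 G) (hi : InjOn G K)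
    (hS : MapsTo S A K) (hd : ∀ p ∈ K, ∀ v, fderiv ℝ G p v = 0 → v = 0)
    (hc : ContDiffOn ℝ 1 (fun t => G (S t)) A) : ContDiffOn ℝ 1 S A :=
  contDiffOn_of_comp (continuousOn_of_comp_compact hK hG.continuous.continuousOn hi hS
    hc.continuousOn) hG (fun _ ht => hd _ (hS ht)) hc

lemma fderiv_derivWithin {E : Type*} [NormedAddCommGroup E] [NormedSpace ℝ E]
    {γ : ℝ → ℝ × ℝ} {g : ℝ × ℝ → E} (hγ : ContDiffOn ℝ 1 γ (Icc 0 1))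
    (hg : ContDiff ℝ 1 g) {t : ℝ} (ht : t ∈ Icc (0 : ℝ) 1) :
    HasDerivWithinAt (fun s => g (γ s)) (fderiv ℝ g (γ t) (derivWithin γ (Icc 0 1) t))
      (Icc 0 1) t := by
  have h1 : HasDerivWithinAt γ (derivWithin γ (Icc 0 1) t) (Icc 0 1) t :=
    ((hγ.differentiableOn (by simp)) t ht).hasDerivWithinAt
  have h2 : HasFDerivAt g (fderiv ℝ g (γ t)) (γ t) :=
    (hg.differentiable (by simp) _).hasFDerivAt
  exact h2.comp_hasDerivWithinAt t h1

/-- The speed at which a curve crosses the levels of `g`, when `g` is affine along it. -/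
lemma fderiv_of_affine {γ : ℝ → ℝ × ℝ} {g : ℝ × ℝ → ℝ} {α β : ℝ}
    (hγ : ContDiffOn ℝ 1 γ (Icc 0 1)) (hg : ContDiff ℝ 1 g)
    (h : ∀ t ∈ Icc (0 : ℝ) 1, g (γ t) = α + t * β) {t : ℝ} (ht : t ∈ Icc (0 : ℝ) 1) :
    fderiv ℝ g (γ t) (derivWithin γ (Icc 0 1) t) = β := by
  have h1 := fderiv_derivWithin hγ hg ht
  have h2 : HasDerivWithinAt (fun s : ℝ => g (γ s)) β (Icc 0 1) t := by
    have : HasDerivWithinAt (fun s : ℝ => α + s * β) β (Icc 0 1) t := by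
      simpa using ((hasDerivAt_id t).mul_const β).const_add α |>.hasDerivWithinAt
    exact this.congr (fun s hs => h s hs) (h t ht)
  exact (uniqueDiffOn_Icc zero_lt_one t ht).eq_deriv _ h1 h2

lemma isRegularArc_of_affine {γ : ℝ → ℝ × ℝ} {g : ℝ × ℝ → ℝ} {α β : ℝ}
    (hγ : ContDiffOn ℝ 1 γ (Icc 0 1)) (hg : ContDiff ℝ 1 g) (hβ : β ≠ 0)
    (h : ∀ t ∈ Icc (0 : ℝ) 1, g (γ t) = α + t * β) : IsRegularArc γ := by
  refine ⟨hγ, fun t ht h0 => hβ ?_⟩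
  rw [← fderiv_of_affine hγ hg h ht, h0, map_zero]

/-- A curve that crosses the levels of `g` at nonzero speed is transverse to a regular curve
contained in a level of `g`. -/
lemma arcsTransverse_of_level {γ δ : ℝ → ℝ × ℝ} {g : ℝ × ℝ → ℝ} {α β α' : ℝ}
    (hγ : IsRegularArc γ) (hδ : IsRegularArc δ) (hg : ContDiff ℝ 1 g) (hβ : β ≠ 0)
    (h : ∀ t ∈ Icc (0 : ℝ) 1, g (γ t) = α + t * β)
    (h' : ∀ t ∈ Icc (0 : ℝ) 1, g (δ t) = α') : ArcsTransverse γ δ := by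
  intro s hs t ht e
  have h1 := fderiv_of_affine hγ.1 hg h hs
  have h2 := fderiv_of_affine (α := α') (β := 0) hδ.1 hg (by simpa using h') ht
  rw [← e] at h2
  rw [LinearIndependent.pair_iff]
  intro a b hab
  have h3 := congrArg (fderiv ℝ g (γ s)) hab
  rw [map_add, map_smul, map_smul, h1, h2, map_zero, smul_zero, add_zero, smul_eq_mul] at h3
  have ha : a = 0 := (mul_eq_zero.1 h3).resolve_right hβ
  rw [ha, zero_smul, zero_add] at hab
  exact ⟨ha, (smul_eq_zero.1 hab).resolve_right (hδ.2 t ht)⟩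

lemma IsRegularArc.map {γ : ℝ → ℝ × ℝ} {G : ℝ × ℝ → ℝ × ℝ} (hγ : IsRegularArc γ)
    (hG : ContDiff ℝ 1 G) (hd : ∀ t ∈ Icc (0 : ℝ) 1, ∀ v, fderiv ℝ G (γ t) v = 0 → v = 0) :
    IsRegularArc fun t => G (γ t) := by
  refine ⟨hG.comp_contDiffOn hγ.1, fun t ht h0 => hγ.2 t ht (hd t ht _ ?_)⟩
  rw [← h0]
  exact ((fderiv_derivWithin hγ.1 hG ht).derivWithin (uniqueDiffOn_Icc zero_lt_one t ht)).symm

lemma unitSquare_mem {s t : ℝ} (hs : s ∈ Icc (0 : ℝ) 1) (ht : t ∈ Icc (0 : ℝ) 1) :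
    (s, t) ∈ unitSquare := ⟨hs, ht⟩

lemma isCompact_unitSquare : IsCompact unitSquare := isCompact_Icc.prod isCompact_Icc

lemma nonempty_homeomorph_image {f : ℝ × ℝ → ℝ × ℝ} {K : Set (ℝ × ℝ)} (hK : IsCompact K)
    (hf : ContinuousOn f K) (hi : InjOn f K) : Nonempty ((f '' K : Set (ℝ × ℝ)) ≃ₜ K) := by
  have : CompactSpace K := isCompact_iff_compactSpace.1 hK
  have hc : Continuous (Equiv.Set.imageOfInjOn f K hi) :=
    Continuous.subtype_mk hf.domRestrict _
  exact ⟨(Continuous.homeoOfEquivCompactToT2 hc).symm⟩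

namespace CurvRect

lemma param_mem (K : CurvRect) {s t : ℝ} (hs : s ∈ Icc (0 : ℝ) 1) (ht : t ∈ Icc (0 : ℝ) 1) :
    K.param (s, t) ∈ K.region := mem_image_of_mem _ (unitSquare_mem hs ht)

lemma nonempty_homeomorph (K : CurvRect) : Nonempty (K.region ≃ₜ unitSquare) :=
  nonempty_homeomorph_image isCompact_unitSquare K.continuousOn_param K.injOn_param

/-- The image of a curvilinear rectangle under a `C¹` map that is injective and immersive on
it. -/
def map (K : CurvRect) (G : ℝ × ℝ → ℝ × ℝ) (hG : ContDiff ℝ 1 G) (hi : InjOn G K.region)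
    (hd : ∀ p ∈ K.region, ∀ v, fderiv ℝ G p v = 0 → v = 0) : CurvRect where
  param p := G (K.param p)
  continuousOn_param := hG.continuous.comp_continuousOn K.continuousOn_param
  injOn_param := hi.comp K.injOn_param fun _ hp => mem_image_of_mem _ hp
  regular_bottom := K.regular_bottom.map hG fun _ ht =>
    hd _ (K.param_mem ht ⟨le_rfl, zero_le_one⟩)
  regular_top := K.regular_top.map hG fun _ ht =>
    hd _ (K.param_mem ht ⟨zero_le_one, le_rfl⟩)
  regular_left := K.regular_left.map hG fun _ ht =>
    hd _ (K.param_mem ⟨le_rfl, zero_le_one⟩ ht)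
  regular_right := K.regular_right.map hG fun _ ht =>
    hd _ (K.param_mem ⟨zero_le_one, le_rfl⟩ ht)

/-- `g` is a height function of the rectangle `K`: it increases affinely from `a` to `b` with the
second parameter. -/
def IsHeight (K : CurvRect) (g : ℝ × ℝ → ℝ) (a b : ℝ) : Prop :=
  ∀ s ∈ Icc (0 : ℝ) 1, ∀ t ∈ Icc (0 : ℝ) 1, g (K.param (s, t)) = a + t * (b - a)

lemma IsHeight.bottom_eq {K : CurvRect} {g : ℝ × ℝ → ℝ} {a b : ℝ} (h : K.IsHeight g a b)
    (hab : a ≠ b) : K.bottom = {p ∈ K.region | g p = a} := by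
  ext p
  constructor
  · rintro ⟨s, hs, rfl⟩
    refine ⟨K.param_mem hs ⟨le_rfl, zero_le_one⟩, ?_⟩
    simpa [bottomArc] using h s hs 0 ⟨le_rfl, zero_le_one⟩
  · rintro ⟨⟨⟨s, t⟩, ⟨hs, ht⟩, rfl⟩, hp⟩
    rw [h s hs t ht] at hp
    have : t = 0 := by
      have : t * (b - a) = 0 := by linarith
      exact (mul_eq_zero.1 this).resolve_right (sub_ne_zero.2 hab.symm)
    subst this
    exact ⟨s, hs, rfl⟩

lemma IsHeight.top_eq {K : CurvRect} {g : ℝ × ℝ → ℝ} {a b : ℝ} (h : K.IsHeight g a b)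
    (hab : a ≠ b) : K.top = {p ∈ K.region | g p = b} := by
  ext p
  constructor
  · rintro ⟨s, hs, rfl⟩
    refine ⟨K.param_mem hs ⟨zero_le_one, le_rfl⟩, ?_⟩
    simpa [topArc] using h s hs 1 ⟨zero_le_one, le_rfl⟩
  · rintro ⟨⟨⟨s, t⟩, ⟨hs, ht⟩, rfl⟩, hp⟩
    rw [h s hs t ht] at hp
    have : t = 1 := by
      have : (t - 1) * (b - a) = 0 := by linarith
      exact sub_eq_zero.1 ((mul_eq_zero.1 this).resolve_right (sub_ne_zero.2 hab.symm))
    subst this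
    exact ⟨s, hs, rfl⟩

end CurvRect

/-- Data presenting a compact region as a curvilinear rectangle in the coordinates `p.1` and
`f p`: each level `f = c` with `c ∈ [a, b]` is a graph over the interval between the first
coordinates of its end points `L c` and `R c`, which describe `C¹` curves. By `vert` and `inj`
the levels are nowhere vertical and meet each vertical line at most once. -/
structure Coords (Rg : Set (ℝ × ℝ)) (f : ℝ × ℝ → ℝ) (a b : ℝ) (L R : ℝ → ℝ × ℝ) : Prop where
  lt : a < b
  compact : IsCompact Rg
  smooth : ContDiff ℝ 1 f
  vert : ∀ p ∈ Rg, ∀ v : ℝ × ℝ, v.1 = 0 → fderiv ℝ f p v = 0 → v = 0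
  inj : ∀ p ∈ Rg, ∀ q ∈ Rg, p.1 = q.1 → f p = f q → p = q
  level : ∀ p ∈ Rg, f p ∈ Icc a b
  left_mem : ∀ c ∈ Icc a b, L c ∈ Rg
  left_level : ∀ c ∈ Icc a b, f (L c) = c
  left_smooth : ContDiffOn ℝ 1 L (Icc a b)
  right_mem : ∀ c ∈ Icc a b, R c ∈ Rg
  right_level : ∀ c ∈ Icc a b, f (R c) = c
  right_smooth : ContDiffOn ℝ 1 R (Icc a b)
  left_lt_right : ∀ c ∈ Icc a b, (L c).1 < (R c).1
  left_le : ∀ p ∈ Rg, (L (f p)).1 ≤ p.1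
  le_right : ∀ p ∈ Rg, p.1 ≤ (R (f p)).1
  fill : ∀ c ∈ Icc a b, ∀ x ∈ Icc (L c).1 (R c).1, ∃ p ∈ Rg, p.1 = x ∧ f p = c

lemma affine_mem_Icc {a b t : ℝ} (hab : a ≤ b) (ht : t ∈ Icc (0 : ℝ) 1) :
    a + t * (b - a) ∈ Icc a b := by
  obtain ⟨h1, h2⟩ := ht
  constructor <;> nlinarith

/-- The region is parametrized by the relative height of the level and the relative position on
it. -/
theorem Coords.exists_rect {Rg : Set (ℝ × ℝ)} {f : ℝ × ℝ → ℝ} {a b : ℝ} {L R : ℝ → ℝ × ℝ}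
    (h : Coords Rg f a b L R) : ∃ K : CurvRect, K.region = Rg ∧ K.IsHeight f a b ∧
      K.left = {p ∈ Rg | p.1 = (L (f p)).1} ∧ K.right = {p ∈ Rg | p.1 = (R (f p)).1} := by
  classical
  have hab := h.lt
  set lev : ℝ → ℝ := fun t => a + t * (b - a) with hlev
  have lev_mem : ∀ t ∈ Icc (0 : ℝ) 1, lev t ∈ Icc a b := fun t ht => affine_mem_Icc hab.le ht
  set hor : ℝ × ℝ → ℝ := fun q => (L (lev q.2)).1 + q.1 * ((R (lev q.2)).1 - (L (lev q.2)).1)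
    with hhor
  have hor_mem : ∀ q ∈ unitSquare, hor q ∈ Icc (L (lev q.2)).1 (R (lev q.2)).1 := fun q hq =>
    affine_mem_Icc (h.left_lt_right _ (lev_mem _ hq.2)).le hq.1
  have ex : ∀ q : ℝ × ℝ, ∃ p : ℝ × ℝ, q ∈ unitSquare → p ∈ Rg ∧ p.1 = hor q ∧ f p = lev q.2 := by
    intro q
    by_cases hq : q ∈ unitSquare
    · obtain ⟨p, hp⟩ := h.fill _ (lev_mem _ hq.2) _ (hor_mem q hq)
      exact ⟨p, fun _ => hp⟩
    · exact ⟨0, fun h => absurd h hq⟩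
  -- Outside the unit square the parametrization takes arbitrary values.
  choose par hpar using ex
  have G_cont : ContDiff ℝ 1 fun p : ℝ × ℝ => (p.1, f p) := contDiff_fst.prodMk h.smooth
  have G_inj : InjOn (fun p : ℝ × ℝ => (p.1, f p)) Rg := fun p hp q hq e =>
    h.inj p hp q hq (Prod.mk.inj e).1 (Prod.mk.inj e).2
  have G_der : ∀ p ∈ Rg, ∀ v, fderiv ℝ (fun p : ℝ × ℝ => (p.1, f p)) p v = 0 → v = 0 := by
    intro p hp v hv
    have e1 : HasFDerivAt (fun p : ℝ × ℝ => (p.1, f p))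
        ((ContinuousLinearMap.fst ℝ ℝ ℝ).prod (fderiv ℝ f p)) p :=
      hasFDerivAt_fst.prodMk (h.smooth.differentiable (by simp) p).hasFDerivAt
    rw [e1.fderiv] at hv
    exact h.vert p hp v (congrArg Prod.fst hv) (congrArg Prod.snd hv)
  have lev_smooth : ContDiff ℝ 1 lev := by rw [hlev]; fun_prop
  have L_smooth : ContDiffOn ℝ 1 (fun t => L (lev t)) (Icc 0 1) :=
    h.left_smooth.comp lev_smooth.contDiffOn fun t ht => lev_mem t ht
  have R_smooth : ContDiffOn ℝ 1 (fun t => R (lev t)) (Icc 0 1) :=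
    h.right_smooth.comp lev_smooth.contDiffOn fun t ht => lev_mem t ht
  have hor_cont : ContinuousOn hor unitSquare := by
    have m : MapsTo (fun q : ℝ × ℝ => q.2) unitSquare (Icc 0 1) := fun q hq => hq.2
    have l1 := continuous_fst.comp_continuousOn
      (L_smooth.continuousOn.comp continuous_snd.continuousOn m)
    have l2 := continuous_fst.comp_continuousOn
      (R_smooth.continuousOn.comp continuous_snd.continuousOn m)
    exact l1.add (continuous_fst.continuousOn.mul (l2.sub l1))
  have par_cont : ContinuousOn par unitSquare := by
    refine continuousOn_of_comp_compact h.compact G_cont.continuous.continuousOn G_inj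
      (fun q hq => (hpar q hq).1) ?_
    have : ContinuousOn (fun q : ℝ × ℝ => (hor q, lev q.2)) unitSquare :=
      hor_cont.prodMk (lev_smooth.continuous.comp continuous_snd).continuousOn
    exact this.congr fun q hq => by simp only [(hpar q hq).2.1, (hpar q hq).2.2]
  have par_left : ∀ t ∈ Icc (0 : ℝ) 1, par (0, t) = L (lev t) := by
    intro t ht
    obtain ⟨h1, h2, h3⟩ := hpar (0, t) (unitSquare_mem ⟨le_rfl, zero_le_one⟩ ht)
    exact h.inj _ h1 _ (h.left_mem _ (lev_mem t ht)) (by rw [h2]; simp [hhor])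
      (by rw [h3, h.left_level _ (lev_mem t ht)])
  have par_right : ∀ t ∈ Icc (0 : ℝ) 1, par (1, t) = R (lev t) := by
    intro t ht
    obtain ⟨h1, h2, h3⟩ := hpar (1, t) (unitSquare_mem ⟨zero_le_one, le_rfl⟩ ht)
    exact h.inj _ h1 _ (h.right_mem _ (lev_mem t ht)) (by rw [h2]; simp [hhor])
      (by rw [h3, h.right_level _ (lev_mem t ht)])
  have hhor_reg : ∀ t ∈ Icc (0 : ℝ) 1, IsRegularArc fun s => par (s, t) := by
    intro t ht
    have hm := fun s (hs : s ∈ Icc (0 : ℝ) 1) => hpar (s, t) (unitSquare_mem hs ht)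
    refine isRegularArc_of_affine (g := Prod.fst) (α := (L (lev t)).1)
      (β := (R (lev t)).1 - (L (lev t)).1) ?_ contDiff_fst
      (sub_ne_zero.2 (h.left_lt_right _ (lev_mem t ht)).ne') fun s hs => (hm s hs).2.1
    refine contDiffOn_of_compact h.compact G_cont G_inj (fun s hs => (hm s hs).1) G_der ?_
    have : ContDiff ℝ 1 fun s : ℝ =>
      ((L (lev t)).1 + s * ((R (lev t)).1 - (L (lev t)).1), lev t) := by fun_prop
    exact this.contDiffOn.congr fun s hs => by simp only [(hm s hs).2.1, (hm s hs).2.2, hhor]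
  have hver_reg : ∀ s ∈ Icc (0 : ℝ) 1, ContDiffOn ℝ 1 (fun t => par (s, t)) (Icc 0 1) →
      IsRegularArc fun t => par (s, t) := fun s hs hc =>
    isRegularArc_of_affine (g := f) (α := a) (β := b - a) hc h.smooth (sub_ne_zero.2 hab.ne')
      fun t ht => (hpar (s, t) (unitSquare_mem hs ht)).2.2
  have par_inj : InjOn par unitSquare := by
    rintro ⟨s, t⟩ hq ⟨s', t'⟩ hq' e
    obtain ⟨h1, h2, h3⟩ := hpar _ hq
    obtain ⟨k1, k2, k3⟩ := hpar _ hq'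
    rw [e, k3] at h3
    have ht : t' = t := by
      have : (t' - t) * (b - a) = 0 := by simp only [hlev] at h3; linarith
      exact sub_eq_zero.1 ((mul_eq_zero.1 this).resolve_right (sub_ne_zero.2 hab.ne'))
    subst ht
    rw [e, k2] at h2
    have hl := h.left_lt_right _ (lev_mem t' hq.2)
    have hs : s' = s := by
      have : (s' - s) * ((R (lev t')).1 - (L (lev t')).1) = 0 := by
        simp only [hhor] at h2; linarith
      exact sub_eq_zero.1 ((mul_eq_zero.1 this).resolve_right (sub_ne_zero.2 hl.ne'))
    rw [hs]
  let K : CurvRect :=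
    { param := par
      continuousOn_param := par_cont
      injOn_param := par_inj
      regular_bottom := hhor_reg 0 ⟨le_rfl, zero_le_one⟩
      regular_top := hhor_reg 1 ⟨zero_le_one, le_rfl⟩
      regular_left := hver_reg 0 ⟨le_rfl, zero_le_one⟩ (L_smooth.congr par_left)
      regular_right := hver_reg 1 ⟨zero_le_one, le_rfl⟩ (R_smooth.congr par_right) }
  have lev_surj : ∀ p ∈ Rg, ∃ t ∈ Icc (0 : ℝ) 1, lev t = f p := by
    intro p hp
    obtain ⟨h1, h2⟩ := h.level p hp
    have hba : 0 < b - a := sub_pos.2 hab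
    refine ⟨(f p - a) / (b - a), ⟨div_nonneg (by linarith) hba.le,
      (div_le_one hba).2 (by linarith)⟩, ?_⟩
    simp only [hlev]
    rw [div_mul_cancel₀ _ hba.ne']; ring
  refine ⟨K, ?_, fun s hs t ht => (hpar _ (unitSquare_mem hs ht)).2.2, ?_, ?_⟩
  · apply Subset.antisymm
    · rintro _ ⟨q, hq, rfl⟩
      exact (hpar q hq).1
    · intro p hp
      obtain ⟨t, ht, htp⟩ := lev_surj p hp
      have hl := sub_pos.2 (h.left_lt_right _ (lev_mem t ht))
      have e1 := h.left_le p hp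
      have e2 := h.le_right p hp
      rw [← htp] at e1 e2
      have hs : (p.1 - (L (lev t)).1) / ((R (lev t)).1 - (L (lev t)).1) ∈ Icc (0 : ℝ) 1 :=
        ⟨div_nonneg (by linarith) hl.le, (div_le_one hl).2 (by linarith)⟩
      obtain ⟨h1, h2, h3⟩ := hpar (_, t) (unitSquare_mem hs ht)
      refine ⟨_, unitSquare_mem hs ht, h.inj _ h1 _ hp ?_ (by rw [h3, htp])⟩
      rw [h2]
      simp only [hhor]
      rw [div_mul_cancel₀ _ hl.ne']; ring
  · ext p
    constructor
    · rintro ⟨t, ht, rfl⟩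
      change par (0, t) ∈ Rg ∧ _ = (L (f (par (0, t)))).1
      rw [par_left t ht, h.left_level _ (lev_mem t ht)]
      refine ⟨h.left_mem _ (lev_mem t ht), ?_⟩
      exact congrArg Prod.fst (par_left t ht)
    · rintro ⟨hp, hp1⟩
      obtain ⟨t, ht, htp⟩ := lev_surj p hp
      refine ⟨t, ht, ?_⟩
      change par (0, t) = p
      rw [par_left t ht, htp]
      exact h.inj _ (h.left_mem _ (h.level p hp)) _ hp hp1.symm (h.left_level _ (h.level p hp))
  · ext p
    constructor
    · rintro ⟨t, ht, rfl⟩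
      change par (1, t) ∈ Rg ∧ _ = (R (f (par (1, t)))).1
      rw [par_right t ht, h.right_level _ (lev_mem t ht)]
      refine ⟨h.right_mem _ (lev_mem t ht), ?_⟩
      exact congrArg Prod.fst (par_right t ht)
    · rintro ⟨hp, hp1⟩
      obtain ⟨t, ht, htp⟩ := lev_surj p hp
      refine ⟨t, ht, ?_⟩
      change par (1, t) = p
      rw [par_right t ht, htp]
      exact h.inj _ (h.right_mem _ (h.level p hp)) _ hp hp1.symm (h.right_level _ (h.level p hp))

/-! ### Passing through a window -/

/-- Differences of points that return through the same window. -/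
lemma ret_sub {i : Fin 2} {p q : ℝ × ℝ} (hp : p ∈ box i) (hq : q ∈ box i)
    (hp' : phi (phi p) ∈ strip) (hq' : phi (phi q) ∈ strip) (h : Cone (7 / 5) (q - p)) :
    Cone 3 (phi (phi q) - phi (phi p)) ∧
      4 * (q - p).2 ^ 2 ≤ (q - p).2 * (sgn i * (phi (phi q) - phi (phi p)).2) := by
  have := cone_box (mid_box hp hq) (mid_box' (phi_mem_box' hp hp') (phi_mem_box' hq hq')) h
  rw [phi_sub, phi_sub p q]
  exact ⟨this.1, this.2.trans_eq (by ring)⟩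

lemma ret_tang {i : Fin 2} {p v : ℝ × ℝ} (hp : p ∈ box i) (hp' : phi (phi p) ∈ strip)
    (h : Cone (7 / 5) v) :
    Cone 3 (tang 2 p v) ∧ 4 * v.2 ^ 2 ≤ v.2 * (sgn i * (tang 2 p v).2) := by
  have := cone_box hp (phi_mem_box' hp hp') h
  rw [tang_succ, tang_one, Function.iterate_one]
  exact ⟨this.1, this.2.trans_eq (by ring)⟩

lemma iterate_add_two (N : ℕ) (p : ℝ × ℝ) : phi^[N + 2] p = phi (phi (phi^[N] p)) := by
  rw [Function.iterate_succ_apply', Function.iterate_succ_apply']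

/-- `p` passes along the axis, ends in the window `box i` and comes back to the strip. -/
def Block (N : ℕ) (i : Fin 2) (p : ℝ × ℝ) : Prop :=
  Passes N p ∧ phi^[N] p ∈ box i ∧ phi^[N + 2] p ∈ strip

/-- A full turn multiplies the heights of nearly vertical differences by at least `4`. -/
lemma Block.sub {N : ℕ} (hN : 2 ≤ N) {i : Fin 2} {p q : ℝ × ℝ} (hp : Block N i p)
    (hq : Block N i q) (h : Cone 3 (q - p)) :
    Cone 3 (phi^[N + 2] q - phi^[N + 2] p) ∧
      4 * (q - p).2 ^ 2 ≤ (q - p).2 * (sgn i * (phi^[N + 2] q - phi^[N + 2] p).2) := by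
  obtain ⟨k1, k2⟩ := hp.1.cone_sub hN hq.1 h
  obtain ⟨p1, p2, p3⟩ := hp
  obtain ⟨q1, q2, q3⟩ := hq
  rw [iterate_add_two] at p3 q3
  obtain ⟨l1, l2⟩ := ret_sub p2 q2 p3 q3 k1
  rw [iterate_add_two, iterate_add_two]
  refine ⟨l1, ?_⟩
  have h1 := sq_le_trans (c := 1) one_pos (by norm_num)
    (le_trans (mul_le_mul_of_nonneg_right (one_le_growth hN) (sq_nonneg _)) k2) l2
  linarith

lemma Block.abs_le {N : ℕ} (hN : 2 ≤ N) {i : Fin 2} {p q : ℝ × ℝ} (hp : Block N i p)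
    (hq : Block N i q) (h : Cone 3 (q - p)) :
    4 * |(q - p).2| ≤ |(phi^[N + 2] q - phi^[N + 2] p).2| := by
  have h1 := abs_le_of_sq_le (hp.sub hN hq h).2
  rw [abs_mul] at h1
  have : |sgn i| = 1 := by fin_cases i <;> simp
  rwa [this, one_mul] at h1

/-- The infinitesimal version of `Block.sub`. -/
lemma Block.tang {N : ℕ} (hN : 2 ≤ N) {i : Fin 2} {p v : ℝ × ℝ} (hp : Block N i p)
    (h : Cone 3 v) : Cone 3 (tang (N + 2) p v) ∧
      4 * v.2 ^ 2 ≤ v.2 * (sgn i * (tang (N + 2) p v).2) := by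
  obtain ⟨k1, k2⟩ := hp.1.cone_tang hN h
  obtain ⟨p1, p2, p3⟩ := hp
  rw [iterate_add_two] at p3
  obtain ⟨l1, l2⟩ := ret_tang p2 p3 k1
  rw [add_comm N 2, tang_add]
  refine ⟨l1, ?_⟩
  have h1 := sq_le_trans (c := 1) one_pos (by norm_num)
    (le_trans (mul_le_mul_of_nonneg_right (one_le_growth hN) (sq_nonneg _)) k2) l2
  linarith

/-- Points near the edge `x = 1` that come back to the strip lie in one of the two windows. -/
lemma box_of_return {q : ℝ × ℝ} (h1 : 93 / 100 ≤ q.1) (h2 : q.1 ≤ 1001 / 1000)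
    (h3 : -(1 / 1000) ≤ q.2) (h4 : q.2 ≤ 22 / 100) (h : phi (phi q) ∈ strip) :
    q ∈ box 0 ∨ q ∈ box 1 := by
  have h5 := abs_le.1 h.2.2
  rw [phi_snd (phi q)] at h5
  have hx : 7 / 10 ≤ (phi q).1 := by rw [phi_fst]; nlinarith
  rcases le_total q.2 (1 / 1000) with h6 | h6
  · exact Or.inl (mem_box_zero.2 ⟨h1, by linarith, h3, h6⟩)
  right
  rw [mem_box_one]
  have hy : 1 / 300 ≤ (phi q).2 := by rw [phi_snd]; nlinarith
  have e : (phi q).1 - (phi q).2 = 1 - 99 / 100 * q.1 + 99 / 100 * q.1 ^ 2 - 6 * q.1 * q.2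
      + 5 * q.2 ^ 2 := by rw [phi_fst, phi_snd]; ring
  -- Outside the upper window the first image is too far from the diagonal, so that the height of
  -- the second image is too large.
  refine ⟨h1, by linarith, ?_, ?_⟩
  · by_contra h7
    push Not at h7
    have : 1 / 200 ≤ (phi q).1 - (phi q).2 := by rw [e]; nlinarith
    nlinarith
  · by_contra h7
    push Not at h7
    have : (phi q).1 - (phi q).2 ≤ -(1 / 200) := by rw [e]; nlinarith
    nlinarith

lemma abs_snd_le_of_return {q : ℝ × ℝ} (hq : q ∈ box 0) (h : phi (phi q) ∈ strip) :
    |(phi q).2| ≤ 1 / 200000 ∧ |q.2| ≤ 1 / 500000 := by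
  obtain ⟨h1, -, h3, h4⟩ := mem_box_zero.1 hq
  obtain ⟨b1, b2, b3⟩ := phi_mem_box' hq h
  have h5 := h.2.2
  rw [phi_snd (phi q), abs_mul, abs_mul] at h5
  have b4 := abs_le.1 b3
  have e1 : |(phi q).2| ≤ 1 / 200000 := by
    rw [abs_of_pos (by norm_num : (0 : ℝ) < 5),
      abs_of_nonneg (by linarith : 0 ≤ (phi q).1 - (phi q).2)] at h5
    nlinarith [abs_nonneg (phi q).2]
  refine ⟨e1, ?_⟩
  rw [phi_snd, abs_mul, abs_mul, abs_of_pos (by norm_num : (0 : ℝ) < 5),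
    abs_of_nonneg (by linarith : 0 ≤ q.1 - q.2)] at e1
  nlinarith [abs_nonneg q.2]

/-- Points that return through the lower window land near the fixed point. -/
lemma return_zero {q : ℝ × ℝ} (hq : q ∈ box 0) (hX : q.1 ≤ 1001 / 1000)
    (h : phi (phi q) ∈ strip) : 9 / 10 ≤ (phi (phi q)).1 ∧ (phi (phi q)).1 ≤ 1 + 1 / 1000 := by
  obtain ⟨h1, -, h3, h4⟩ := mem_box_zero.1 hq
  obtain ⟨e1, e2⟩ := abs_snd_le_of_return hq h
  have e3 := abs_le.1 e1
  have e4 := abs_le.1 e2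
  have e5 : (phi q).1 ≤ 1 + 995 / 1000000 := by rw [phi_fst]; nlinarith
  have e6 : 92 / 100 ≤ (phi q).1 := by rw [phi_fst]; nlinarith
  rw [phi_fst (phi q)]
  constructor <;> nlinarith

/-- Points that return through the upper window land in a short interval to the left of the fold. -/
lemma return_one {q : ℝ × ℝ} (hq : q ∈ box 1) (hX : q.1 ≤ 1001 / 1000)
    (h : phi (phi q) ∈ strip) :
    193 / 1000 ≤ (phi (phi q)).1 ∧ (phi (phi q)).1 ≤ 262 / 1000 := by
  obtain ⟨h1, -, h3, h4⟩ := mem_box_one.1 hq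
  have hy : 13 / 20 ≤ (phi q).2 := by rw [phi_snd]; nlinarith
  have h5 := h.2.2
  rw [phi_snd (phi q), abs_mul, abs_of_nonneg (by linarith)] at h5
  have e0 : |(phi q).1 - (phi q).2| ≤ 1 / 100000 := by
    nlinarith [abs_nonneg ((phi q).1 - (phi q).2)]
  have e1 := abs_le.1 e0
  have e : (phi q).1 - (phi q).2 = 1 - 99 / 100 * q.1 + 99 / 100 * q.1 ^ 2 - 6 * q.1 * q.2
      + 5 * q.2 ^ 2 := by rw [phi_fst, phi_snd]; ring
  have f1 : 741 / 1000 ≤ (phi q).1 := by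
    rw [e] at e1
    rw [phi_fst]
    nlinarith
  have f2 : (phi q).1 ≤ 807 / 1000 := by
    rw [e] at e1
    rw [phi_fst]
    nlinarith
  rw [phi_fst (phi q)]
  constructor <;> nlinarith

/-! ### Passing points as functions of abscissa and final height -/

lemma isCompact_strip : IsCompact strip := by
  have : strip = Icc (31 / 200 : ℝ) (7 / 5) ×ˢ Icc (-(1 / 100000) : ℝ) (1 / 100000) := by
    ext p
    simp only [strip, mem_ofPred_eq, abs_le, mem_prod, mem_Icc]
    tauto
  rw [this]
  exact isCompact_Icc.prod isCompact_Icc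

lemma isClosed_corridor : IsClosed corridor :=
  (isClosed_le continuous_const continuous_fst).inter
    ((isClosed_le continuous_const continuous_snd).inter
      (isClosed_le continuous_snd continuous_const))

lemma isCompact_passes (N : ℕ) : IsCompact {p | Passes N p} := by
  have : {p | Passes N p} =
      strip ∩ ⋂ j, ⋂ (_ : 1 ≤ j), ⋂ (_ : j < N), phi^[j] ⁻¹' corridor := by
    ext p; simp only [Passes, mem_ofPred_eq, mem_inter_iff, mem_iInter, mem_preimage]
  rw [this]
  exact isCompact_strip.inter_right (isClosed_iInter fun j => isClosed_iInter fun _ =>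
    isClosed_iInter fun _ => isClosed_corridor.preimage (continuous_iterate j))

/-- The interval of admissible final heights. -/
def heights : Set ℝ := Icc (-(1 / 1000)) (22 / 100)

/-- Abscissa together with final height: coordinates on the set of passing points. -/
noncomputable def absHeight (N : ℕ) (p : ℝ × ℝ) : ℝ × ℝ := (p.1, (phi^[N] p).2)

lemma contDiff_absHeight (N : ℕ) : ContDiff ℝ 1 (absHeight N) :=
  contDiff_fst.prodMk (contDiff_snd.comp (contDiff_phi_iterate N))

lemma fderiv_prod_snd_iterate (k : ℕ) (p v : ℝ × ℝ) :
    fderiv ℝ (fun p => (phi^[k] p).2) p v = (tang k p v).2 := by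
  have h : HasFDerivAt (fun p => (phi^[k] p).2)
      ((ContinuousLinearMap.snd ℝ ℝ ℝ).comp (fderiv ℝ phi^[k] p)) p :=
    hasFDerivAt_snd.comp p (((contDiff_phi_iterate (n := 1) k).differentiable (by simp) p).hasFDerivAt)
  rw [h.fderiv]; rfl

lemma fderiv_prod_fst_iterate (k : ℕ) (p v : ℝ × ℝ) :
    fderiv ℝ (fun p => (phi^[k] p).1) p v = (tang k p v).1 := by
  have h : HasFDerivAt (fun p => (phi^[k] p).1)
      ((ContinuousLinearMap.fst ℝ ℝ ℝ).comp (fderiv ℝ phi^[k] p)) p :=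
    hasFDerivAt_fst.comp p (((contDiff_phi_iterate (n := 1) k).differentiable (by simp) p).hasFDerivAt)
  rw [h.fderiv]; rfl

lemma fderiv_pair {f g : ℝ × ℝ → ℝ} (hf : ContDiff ℝ 1 f) (hg : ContDiff ℝ 1 g)
    (p v : ℝ × ℝ) : fderiv ℝ (fun p => (f p, g p)) p v = (fderiv ℝ f p v, fderiv ℝ g p v) := by
  have e1 : HasFDerivAt (fun p : ℝ × ℝ => (f p, g p)) ((fderiv ℝ f p).prod (fderiv ℝ g p)) p :=
    (hf.differentiable (by simp) p).hasFDerivAt.prodMk (hg.differentiable (by simp) p).hasFDerivAt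
  rw [e1.fderiv]; rfl

lemma contDiff_snd_iterate (k : ℕ) : ContDiff ℝ 1 fun p => (phi^[k] p).2 :=
  contDiff_snd.comp (contDiff_phi_iterate k)

lemma contDiff_fst_iterate (k : ℕ) : ContDiff ℝ 1 fun p => (phi^[k] p).1 :=
  contDiff_fst.comp (contDiff_phi_iterate k)

lemma fderiv_absHeight (N : ℕ) (p v : ℝ × ℝ) :
    fderiv ℝ (absHeight N) p v = (v.1, (tang N p v).2) := by
  unfold absHeight
  rw [fderiv_pair contDiff_fst (contDiff_snd_iterate N), fderiv_prod_snd_iterate, fderiv_fst]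
  rfl

lemma injOn_absHeight {N : ℕ} (hN : 2 ≤ N) : InjOn (absHeight N) {p | Passes N p} :=
  fun _ hp _ hq e => hq.eq_of_fst_eq hN hp (Prod.mk.inj e).1 (Prod.mk.inj e).2

/-- A vector of the cone with vanishing final vertical component vanishes. -/
lemma Passes.tang_cone_eq_zero {N : ℕ} (hN : 2 ≤ N) {p v : ℝ × ℝ} (hp : Passes N p)
    (h : Cone 3 v) (h0 : (tang N p v).2 = 0) : v = 0 := by
  have h1 := (hp.cone_tang hN h).2
  rw [h0, mul_zero] at h1
  have h2 := one_le_growth hN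
  refine h.eq_zero ?_
  by_contra h3
  have : 0 < v.2 ^ 2 := by positivity
  nlinarith

lemma absHeight_immersive {N : ℕ} (hN : 2 ≤ N) {p : ℝ × ℝ} (hp : Passes N p) (v : ℝ × ℝ)
    (hv : fderiv ℝ (absHeight N) p v = 0) : v = 0 := by
  rw [fderiv_absHeight] at hv
  exact hp.tang_cone_eq_zero hN (cone_vertical (by norm_num) (Prod.mk.inj hv).1)
    (Prod.mk.inj hv).2

open Classical in
/-- The passing point with abscissa `x` and final height `h`; the value is `0` if there is none. -/
noncomputable def passPt (N : ℕ) (x h : ℝ) : ℝ × ℝ :=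
  if H : ∃ y, Passes N (x, y) ∧ (phi^[N] (x, y)).2 = h then (x, H.choose) else 0

lemma passPt_spec {N : ℕ} (hN : IsLong N) {x h : ℝ} (hx : x ∈ Icc (31 / 200 : ℝ) (7 / 5))
    (hh : h ∈ heights) :
    Passes N (passPt N x h) ∧ (passPt N x h).1 = x ∧ (phi^[N] (passPt N x h)).2 = h := by
  have H := exists_passes hN hx.1 hx.2 hh.1 hh.2
  have := H.choose_spec
  unfold passPt
  rw [dif_pos H]
  exact ⟨this.1, rfl, this.2⟩

lemma Passes.eq_passPt {N : ℕ} (hN : IsLong N) {p : ℝ × ℝ} (hp : Passes N p)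
    (hh : (phi^[N] p).2 ∈ heights) : p = passPt N p.1 (phi^[N] p).2 := by
  obtain ⟨h1, h2, h3⟩ := passPt_spec hN ⟨hp.1.1, hp.1.2.1⟩ hh
  exact h1.eq_of_fst_eq hN.two_le hp h2.symm h3.symm

lemma continuousOn_passPt {N : ℕ} (hN : IsLong N) :
    ContinuousOn (fun q : ℝ × ℝ => passPt N q.1 q.2) (Icc (31 / 200 : ℝ) (7 / 5) ×ˢ heights) := by
  refine continuousOn_of_comp_compact (isCompact_passes N)
    (contDiff_absHeight N).continuous.continuousOn (injOn_absHeight hN.two_le)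
    (fun q hq => (passPt_spec hN hq.1 hq.2).1) ?_
  refine continuousOn_id.congr fun q hq => ?_
  obtain ⟨-, h2, h3⟩ := passPt_spec hN hq.1 hq.2
  simp only [absHeight, h2, h3]; rfl

lemma contDiffOn_passPt {N : ℕ} (hN : IsLong N) {h : ℝ} (hh : h ∈ heights) :
    ContDiffOn ℝ 1 (fun x => passPt N x h) (Icc (31 / 200 : ℝ) (7 / 5)) := by
  refine contDiffOn_of_compact (isCompact_passes N) (contDiff_absHeight N)
    (injOn_absHeight hN.two_le) (fun x hx => (passPt_spec hN hx hh).1)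
    (fun p hp => absHeight_immersive hN.two_le hp) ?_
  have : ContDiff ℝ 1 fun x : ℝ => (x, h) := by fun_prop
  refine this.contDiffOn.congr fun x hx => ?_
  obtain ⟨-, h2, h3⟩ := passPt_spec hN hx hh
  simp only [absHeight, h2, h3]

/-! ### Curves crossing a window -/

/-- The vertical extent of `box i`. -/
noncomputable def bracket (i : Fin 2) : Set ℝ :=
  if i = 0 then Icc (-(1 / 1000)) (1 / 1000) else Icc (197 / 1000) (209 / 1000)

lemma bracket_subset (i : Fin 2) : bracket i ⊆ heights := by
  intro h hh
  fin_cases i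
  · simp only [bracket, Fin.zero_eta, if_true, heights, mem_Icc] at *
    constructor <;> linarith [hh.1, hh.2]
  · simp only [bracket, Fin.mk_one, one_ne_zero, if_false, heights, mem_Icc] at *
    constructor <;> linarith [hh.1, hh.2]

lemma snd_mem_bracket {i : Fin 2} {q : ℝ × ℝ} (hq : q ∈ box i) : q.2 ∈ bracket i := by
  fin_cases i
  · exact ⟨(mem_box_zero.1 hq).2.2.1, (mem_box_zero.1 hq).2.2.2⟩
  · exact ⟨(mem_box_one.1 hq).2.2.1, (mem_box_one.1 hq).2.2.2⟩

lemma return_fst_mem {i : Fin 2} {q : ℝ × ℝ} (hq : q ∈ box i) :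
    (phi (phi q)).1 ∈ Icc (31 / 200 : ℝ) (7 / 5) := by
  rw [phi_fst (phi q)]
  fin_cases i
  · simp only [Fin.zero_eta, mem_box_zero] at hq
    obtain ⟨h1, h2, h3, h4⟩ := hq
    have a1 : (phi q).1 ≤ 51 / 50 := by rw [phi_fst]; nlinarith
    have a2 : 9 / 10 ≤ (phi q).1 := by rw [phi_fst]; nlinarith
    have a3 : (phi q).2 ≤ 1 / 100 := by rw [phi_snd]; nlinarith
    have a4 : -(1 / 100) ≤ (phi q).2 := by rw [phi_snd]; nlinarith
    constructor <;> nlinarith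
  · simp only [Fin.mk_one, mem_box_one] at hq
    obtain ⟨h1, h2, h3, h4⟩ := hq
    have a1 : (phi q).1 ≤ 8177 / 10000 := by rw [phi_fst]; nlinarith
    have a2 : 74 / 100 ≤ (phi q).1 := by rw [phi_fst]; nlinarith
    have a3 : (phi q).2 ≤ 846 / 1000 := by rw [phi_snd]; nlinarith
    have a4 : 0 ≤ (phi q).2 := by rw [phi_snd]; nlinarith
    constructor <;> nlinarith

/-- A curve over the vertical extent of the window `box i` crosses the strip when it comes back,
upwards for `i = 0` and downwards for `i = 1`, and hits there a passing point of each final height.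
-/
lemma exists_crossing {N : ℕ} (hN : IsLong N) {i : Fin 2} {X : ℝ → ℝ}
    (hX : ContinuousOn X (bracket i)) (hb : ∀ h ∈ bracket i, (X h, h) ∈ box i) {c : ℝ}
    (hc : c ∈ heights) : ∃ h ∈ bracket i, Passes N (phi (phi (X h, h))) ∧
      (phi^[N] (phi (phi (X h, h)))).2 = c := by
  set z : ℝ → ℝ × ℝ := fun h => phi (phi (X h, h)) with hz
  have hzc : ContinuousOn z (bracket i) :=
    (continuous_phi.comp continuous_phi).comp_continuousOn (hX.prodMk continuousOn_id)
  have hz1 : ∀ h ∈ bracket i, (z h).1 ∈ Icc (31 / 200 : ℝ) (7 / 5) := fun h hh =>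
    return_fst_mem (hb h hh)
  -- `w` is the height of the returning curve above the level of passing points with final height
  -- `c`; it has different signs at the two ends of the window.
  set w : ℝ → ℝ := fun h => (z h).2 - (passPt N (z h).1 c).2 with hw
  have hwc : ContinuousOn w (bracket i) := by
    refine (continuous_snd.comp_continuousOn hzc).sub (continuous_snd.comp_continuousOn ?_)
    exact (continuousOn_passPt hN).comp
      ((continuous_fst.comp_continuousOn hzc).prodMk continuousOn_const)
      fun h hh => ⟨hz1 h hh, hc⟩
  have small : ∀ h ∈ bracket i, |(passPt N (z h).1 c).2| ≤ 1 / 100000 := fun h hh =>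
    (passPt_spec hN (hz1 h hh) hc).1.1.2.2
  suffices ∃ h ∈ bracket i, w h = 0 by
    obtain ⟨h, hh, h0⟩ := this
    obtain ⟨k1, k2, k3⟩ := passPt_spec hN (hz1 h hh) hc
    have e : passPt N (z h).1 c = z h := Prod.ext k2 (by simp only [hw] at h0; linarith)
    rw [e] at k1 k3
    exact ⟨h, hh, k1, k3⟩
  fin_cases i
  · have e : bracket ⟨0, by norm_num⟩ = Icc (-(1 / 1000) : ℝ) (1 / 1000) := by simp [bracket]
    rw [e] at hwc small hb ⊢
    have m1 : (-(1 / 1000) : ℝ) ∈ Icc (-(1 / 1000) : ℝ) (1 / 1000) := by constructor <;> norm_num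
    have m2 : (1 / 1000 : ℝ) ∈ Icc (-(1 / 1000) : ℝ) (1 / 1000) := by constructor <;> norm_num
    have s1 := abs_le.1 (small _ m1)
    have s2 := abs_le.1 (small _ m2)
    have lo : w (-(1 / 1000)) ≤ 0 := by
      obtain ⟨b1, b2, -⟩ := mem_box_zero.1 (hb _ m1)
      simp only at b1 b2
      have : (z (-(1 / 1000))).2 ≤ -(1 / 10000) := by
        have c1 : (phi (X (-(1 / 1000)), -(1 / 1000))).2 ≤ -(4 / 1000) := by
          rw [phi_snd]; simp only; linarith
        have c2 : 8 / 10 ≤ (phi (X (-(1 / 1000)), -(1 / 1000))).1 := by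
          rw [phi_fst]; simp only; nlinarith
        simp only [hz]
        rw [phi_snd (phi _)]
        nlinarith
      simp only [hw]; linarith
    have hi : 0 ≤ w (1 / 1000) := by
      obtain ⟨b1, b2, -⟩ := mem_box_zero.1 (hb _ m2)
      simp only at b1 b2
      have : 1 / 10000 ≤ (z (1 / 1000)).2 := by
        have c1 : 4 / 1000 ≤ (phi (X (1 / 1000), 1 / 1000)).2 := by
          rw [phi_snd]; simp only; linarith
        have c3 : (phi (X (1 / 1000), 1 / 1000)).2 ≤ 6 / 1000 := by
          rw [phi_snd]; simp only; linarith
        have c2 : 8 / 10 ≤ (phi (X (1 / 1000), 1 / 1000)).1 := by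
          rw [phi_fst]; simp only; nlinarith
        simp only [hz]
        rw [phi_snd (phi _)]
        nlinarith
      simp only [hw]; linarith
    exact intermediate_value_Icc (by norm_num) hwc ⟨lo, hi⟩
  · have e : bracket ⟨1, by norm_num⟩ = Icc (197 / 1000 : ℝ) (209 / 1000) := by simp [bracket]
    rw [e] at hwc small hb ⊢
    have m1 : (197 / 1000 : ℝ) ∈ Icc (197 / 1000 : ℝ) (209 / 1000) := by constructor <;> norm_num
    have m2 : (209 / 1000 : ℝ) ∈ Icc (197 / 1000 : ℝ) (209 / 1000) := by constructor <;> norm_num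
    have s1 := abs_le.1 (small _ m1)
    have s2 := abs_le.1 (small _ m2)
    have dg : ∀ q : ℝ × ℝ, (phi q).1 - (phi q).2 = 1 - 99 / 100 * q.1 + 99 / 100 * q.1 ^ 2
        - 6 * q.1 * q.2 + 5 * q.2 ^ 2 := fun q => by rw [phi_fst, phi_snd]; ring
    have lo : 0 ≤ w (197 / 1000) := by
      obtain ⟨b1, b2, -⟩ := mem_box_one.1 (hb _ m1)
      simp only at b1 b2
      have : 1 / 10000 ≤ (z (197 / 1000)).2 := by
        simp only [hz]
        rw [phi_snd (phi _), dg, phi_snd]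
        simp only
        have c1 : 1 / 1000 ≤ 1 - 99 / 100 * X (197 / 1000) + 99 / 100 * X (197 / 1000) ^ 2
          - 6 * X (197 / 1000) * (197 / 1000) + 5 * (197 / 1000) ^ 2 := by nlinarith
        nlinarith
      simp only [hw]; linarith
    have hi : w (209 / 1000) ≤ 0 := by
      obtain ⟨b1, b2, -⟩ := mem_box_one.1 (hb _ m2)
      simp only at b1 b2
      have : (z (209 / 1000)).2 ≤ -(1 / 10000) := by
        simp only [hz]
        rw [phi_snd (phi _), dg, phi_snd]
        simp only
        have c1 : 1 - 99 / 100 * X (209 / 1000) + 99 / 100 * X (209 / 1000) ^ 2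
          - 6 * X (209 / 1000) * (209 / 1000) + 5 * (209 / 1000) ^ 2 ≤ -(1 / 1000) := by nlinarith
        nlinarith
      simp only [hw]; linarith
    exact intermediate_value_Icc' (by norm_num) hwc ⟨hi, lo⟩

/-! ### The fold -/

/-- The Jacobian determinant of `phi`, up to the factor `5`. -/
noncomputable def jac (m : ℝ × ℝ) : ℝ :=
  (99 / 100 * (2 * m.1 - 1) - m.2) * (m.1 - 2 * m.2) + m.1 * m.2

lemma contDiff_jac : ContDiff ℝ 1 jac := by unfold jac; fun_prop

/-- The only degeneracy of the derivative of `phi^[N]` at passing points comes from the first step.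
-/
lemma Passes.tang_eq_zero {N : ℕ} {p v : ℝ × ℝ} (hp : Passes N p) (hj : jac p ≠ 0) {j : ℕ}
    (hjN : j ≤ N) (h : tang j p v = 0) : v = 0 := by
  induction j with
  | zero => rwa [tang_zero] at h
  | succ j ih =>
    rw [tang_succ] at h
    refine ih (by omega) (phiLin_eq_zero ?_ h)
    rcases Nat.eq_zero_or_pos j with rfl | hj0
    · exact hj
    · exact (phiLin_det _ (by linarith [(hp.2 j hj0 (by omega)).1])).ne'

/-- Where the fold curve `jac = 0` crosses the strip. -/
def foldSet : Set (ℝ × ℝ) := {p | jac p = 0 ∧ 9 / 20 ≤ p.1 ∧ p.1 ≤ 11 / 20 ∧ |p.2| ≤ 1 / 100000}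

lemma isClosed_foldSet : IsClosed foldSet :=
  (isClosed_eq contDiff_jac.continuous continuous_const).inter
    ((isClosed_le continuous_const continuous_fst).inter
      ((isClosed_le continuous_fst continuous_const).inter
        (isClosed_le (continuous_abs.comp continuous_snd) continuous_const)))

/-- The fold curve is nearly vertical. -/
lemma cone_foldSet {p q : ℝ × ℝ} (hp : p ∈ foldSet) (hq : q ∈ foldSet) : Cone 3 (q - p) := by
  obtain ⟨p1, p2, p3, p4⟩ := hp
  obtain ⟨q1, q2, q3, q4⟩ := hq
  unfold jac at p1 q1
  unfold Cone
  simp only [Prod.fst_sub, Prod.snd_sub]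
  have e : (198 / 100 * (p.1 + q.1) - 99 / 100 - 198 / 100 * (p.2 + q.2)) * (q.1 - p.1) =
      (198 / 100 * (p.1 + q.1) - 198 / 100 - 2 * (p.2 + q.2)) * (q.2 - p.2) := by
    linear_combination q1 - p1
  have b1 := abs_le.1 p4
  have b2 := abs_le.1 q4
  have f1 : 7 / 10 * |q.1 - p.1| ≤
      |(198 / 100 * (p.1 + q.1) - 99 / 100 - 198 / 100 * (p.2 + q.2)) * (q.1 - p.1)| := by
    rw [abs_mul]
    refine mul_le_mul_of_nonneg_right ?_ (abs_nonneg _)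
    exact le_abs.2 (Or.inl (by linarith [b1.2, b2.2]))
  have f2 : |(198 / 100 * (p.1 + q.1) - 198 / 100 - 2 * (p.2 + q.2)) * (q.2 - p.2)| ≤
      1 * |q.2 - p.2| := by
    rw [abs_mul]
    refine mul_le_mul_of_nonneg_right ?_ (abs_nonneg _)
    exact abs_le.2 ⟨by linarith [b1.2, b2.2], by linarith [b1.1, b2.1]⟩
  rw [e] at f1
  linarith [abs_nonneg (q.2 - p.2)]

lemma fderiv_jac (p v : ℝ × ℝ) : fderiv ℝ jac p v =
    (396 / 100 * p.1 - 99 / 100 - 396 / 100 * p.2) * v.1 -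
      (396 / 100 * p.1 - 198 / 100 - 4 * p.2) * v.2 := by
  have h1 : HasFDerivAt (fun p : ℝ × ℝ => p.1) (ContinuousLinearMap.fst ℝ ℝ ℝ) p :=
    hasFDerivAt_fst
  have h2 : HasFDerivAt (fun p : ℝ × ℝ => p.2) (ContinuousLinearMap.snd ℝ ℝ ℝ) p :=
    hasFDerivAt_snd
  have h := ((((h1.const_mul 2).sub_const 1).const_mul (99 / 100)).sub h2).mul
    (h1.sub (h2.const_mul 2)) |>.add (h1.mul h2)
  have h' := (h.congr_of_eventuallyEq (f₁ := jac) (by unfold jac; rfl)).fderiv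
  rw [h']
  simp
  ring

lemma cone_fderiv_jac {p v : ℝ × ℝ} (hp : p ∈ foldSet) (h : fderiv ℝ jac p v = 0) : Cone 3 v := by
  obtain ⟨-, p2, p3, p4⟩ := hp
  rw [fderiv_jac] at h
  have b1 := abs_le.1 p4
  unfold Cone
  have f1 : 7 / 10 * |v.1| ≤ |(396 / 100 * p.1 - 99 / 100 - 396 / 100 * p.2) * v.1| := by
    rw [abs_mul]
    refine mul_le_mul_of_nonneg_right ?_ (abs_nonneg _)
    exact le_abs.2 (Or.inl (by linarith [b1.2]))
  have f2 : |(396 / 100 * p.1 - 198 / 100 - 4 * p.2) * v.2| ≤ 1 * |v.2| := by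
    rw [abs_mul]
    refine mul_le_mul_of_nonneg_right ?_ (abs_nonneg _)
    exact abs_le.2 ⟨by linarith [b1.2], by linarith [b1.1]⟩
  rw [sub_eq_zero.1 h] at f1
  linarith [abs_nonneg v.2]

/-- Among the passing points of a given final height, one on the fold curve ends leftmost. -/
lemma exists_foldPt {N : ℕ} (hN : IsLong N) {h : ℝ} (hh : h ∈ heights) :
    ∃ p, Passes N p ∧ p ∈ foldSet ∧ (phi^[N] p).2 = h ∧
      ∀ q, Passes N q → (phi^[N] q).2 = h → (phi^[N] p).1 ≤ (phi^[N] q).1 := by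
  set S : ℝ → ℝ × ℝ := fun x => passPt N x h with hS
  have hSs : ∀ x ∈ Icc (31 / 200 : ℝ) (7 / 5),
      Passes N (S x) ∧ (S x).1 = x ∧ (phi^[N] (S x)).2 = h := fun x hx => passPt_spec hN hx hh
  have hSd : ContDiffOn ℝ 1 S (Icc (31 / 200) (7 / 5)) := contDiffOn_passPt hN hh
  have hξ : ContinuousOn (fun x => (phi^[N] (S x)).1) (Icc (31 / 200) (7 / 5)) :=
    (continuous_fst.comp (continuous_iterate N)).comp_continuousOn hSd.continuousOn
  obtain ⟨x, hx, hmin⟩ := isCompact_Icc.exists_isMinOn (nonempty_Icc.2 (by norm_num)) hξ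
  have hhalf : (1 / 2 : ℝ) ∈ Icc (31 / 200 : ℝ) (7 / 5) := by constructor <;> norm_num
  -- After one step, points over `x = 1/2` are strictly to the left of those far from it, and this
  -- order persists to the end.
  have near : 9 / 20 < x ∧ x < 11 / 20 := by
    by_contra hcon
    obtain ⟨p1, p2, p3⟩ := hSs x hx
    obtain ⟨q1, q2, q3⟩ := hSs (1 / 2) hhalf
    have b1 := abs_le.1 p1.1.2.2
    have b2 := abs_le.1 q1.1.2.2
    have hsq : 1 / 400 ≤ (x - 1 / 2) ^ 2 := by
      rcases not_and_or.1 hcon with h | h <;> nlinarith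
    have hlt : (phi (S (1 / 2))).1 < (phi (S x)).1 := by
      rw [phi_fst, phi_fst, p2, q2]
      nlinarith [hx.1, hx.2]
    exact absurd (q1.order_of_phi hN.two_le p1 (fun _ => by rw [p3, q3]) hlt)
      (not_lt.2 (hmin hhalf))
  obtain ⟨p1, p2, p3⟩ := hSs x hx
  refine ⟨S x, p1, ⟨?_, by rw [p2]; exact near.1.le, by rw [p2]; exact near.2.le, p1.1.2.2⟩, p3,
    fun q hq hqh => ?_⟩
  · by_contra hj
    -- The end point moves along a level with stationary abscissa, so that its velocity vanishes,
    -- whereas the starting point moves with horizontal speed `1`.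
    have hnhds : Icc (31 / 200 : ℝ) (7 / 5) ∈ 𝓝 x :=
      Icc_mem_nhds (by linarith [near.1]) (by linarith [near.2])
    have hSx : HasDerivAt S (deriv S x) x :=
      ((hSd.contDiffAt hnhds).differentiableAt (by simp)).hasDerivAt
    have d0 : (deriv S x).1 = 1 := by
      have e1 : HasDerivAt (fun y => (S y).1) (deriv S x).1 x := 
          (hasFDerivAt_fst (𝕜 := ℝ) (p := S x)).comp_hasDerivAt x hSx
      have e2 : HasDerivAt (fun y => (S y).1) 1 x :=
        (hasDerivAt_id x).congr_of_eventuallyEq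
          (by filter_upwards [hnhds] with y hy using (hSs y hy).2.1)
      exact e1.unique e2
    have hF : HasDerivAt (fun y => phi^[N] (S y)) (tang N (S x) (deriv S x)) x :=
      ((contDiff_phi_iterate (n := 1) N).differentiable (by simp) (S x)).hasFDerivAt.comp_hasDerivAt
        x hSx
    have d1 : (tang N (S x) (deriv S x)).1 = 0 := by
      have e1 : HasDerivAt (fun y => (phi^[N] (S y)).1) (tang N (S x) (deriv S x)).1 x := 
          (ContinuousLinearMap.fst ℝ ℝ ℝ).hasFDerivAt.comp_hasDerivAt x hF
      exact (hmin.isLocalMin hnhds).hasDerivAt_eq_zero e1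
    have d2 : (tang N (S x) (deriv S x)).2 = 0 := by
      have e1 : HasDerivAt (fun y => (phi^[N] (S y)).2) (tang N (S x) (deriv S x)).2 x := 
          (ContinuousLinearMap.snd ℝ ℝ ℝ).hasFDerivAt.comp_hasDerivAt x hF
      have e2 : HasDerivAt (fun y => (phi^[N] (S y)).2) 0 x :=
        (hasDerivAt_const x h).congr_of_eventuallyEq
          (by filter_upwards [hnhds] with y hy using (hSs y hy).2.2)
      exact e1.unique e2
    rw [p1.tang_eq_zero hj le_rfl (Prod.ext d1 d2)] at d0
    simp at d0
  · have hqx : q.1 ∈ Icc (31 / 200 : ℝ) (7 / 5) := ⟨hq.1.1, hq.1.2.1⟩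
    have e := hq.eq_passPt hN (by rw [hqh]; exact hh)
    rw [hqh] at e
    rw [e]
    exact hmin hqx

/-! ### The image of the fold and the region `Q` -/

open Classical in
/-- The passing point of final height `h` on the fold curve that ends leftmost; the value is `0` if
there is none. -/
noncomputable def foldPt (N : ℕ) (h : ℝ) : ℝ × ℝ :=
  if H : ∃ p, Passes N p ∧ p ∈ foldSet ∧ (phi^[N] p).2 = h ∧
      ∀ q, Passes N q → (phi^[N] q).2 = h → (phi^[N] p).1 ≤ (phi^[N] q).1 then H.choose else 0

lemma foldPt_spec {N : ℕ} (hN : IsLong N) {h : ℝ} (hh : h ∈ heights) :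
    Passes N (foldPt N h) ∧ foldPt N h ∈ foldSet ∧ (phi^[N] (foldPt N h)).2 = h ∧
      ∀ q, Passes N q → (phi^[N] q).2 = h → (phi^[N] (foldPt N h)).1 ≤ (phi^[N] q).1 := by
  have H := exists_foldPt hN hh
  unfold foldPt
  rw [dif_pos H]
  exact H.choose_spec

/-- The left boundary of the image of the passing points under `phi^[N]`. -/
noncomputable def kap (N : ℕ) (h : ℝ) : ℝ := (phi^[N] (foldPt N h)).1

lemma iterate_foldPt {N : ℕ} (hN : IsLong N) {h : ℝ} (hh : h ∈ heights) :
    phi^[N] (foldPt N h) = (kap N h, h) :=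
  Prod.ext rfl (foldPt_spec hN hh).2.2.1

lemma Passes.kap_le {N : ℕ} (hN : IsLong N) {p : ℝ × ℝ} (hp : Passes N p)
    (hh : (phi^[N] p).2 ∈ heights) : kap N (phi^[N] p).2 ≤ (phi^[N] p).1 :=
  (foldPt_spec hN hh).2.2.2 p hp rfl

/-- The left boundary is nearly vertical: it is the image of a stretch of the fold curve, whose
differences lie in the cone. -/
lemma kap_lipschitz {N : ℕ} (hN : IsLong N) {h h' : ℝ} (hh : h ∈ heights) (hh' : h' ∈ heights) :
    |kap N h' - kap N h| ≤ 7 / 5 * |h' - h| := by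
  obtain ⟨p1, p2, p3, -⟩ := foldPt_spec hN hh
  obtain ⟨q1, q2, q3, -⟩ := foldPt_spec hN hh'
  have := (p1.cone_sub hN.two_le q1 (cone_foldSet p2 q2)).1
  unfold kap
  simpa only [Cone, Prod.fst_sub, Prod.snd_sub, p3, q3] using this

lemma continuousOn_kap {N : ℕ} (hN : IsLong N) : ContinuousOn (kap N) heights := by
  have : LipschitzOnWith (7 / 5) (kap N) heights :=
    LipschitzOnWith.of_dist_le_mul fun x hx y hy => by
      rw [Real.dist_eq, Real.dist_eq]
      simpa using kap_lipschitz hN hy hx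
  exact this.continuousOn

lemma kap_ge {N : ℕ} (hN : IsLong N) {h : ℝ} (hh : h ∈ heights) : 93 / 100 ≤ kap N h :=
  (foldPt_spec hN hh).1.end_fst_ge hN (by rw [(foldPt_spec hN hh).2.2.1]; exact hh.2)

lemma kap_lt {N : ℕ} (hN : IsLong N) {h : ℝ} (hh : h ∈ heights) : kap N h < 1001 / 1000 := by
  obtain ⟨p1, p2, p3, -⟩ := foldPt_spec hN hh
  exact p1.end_fst_lt hN (by rw [p3]; exact hh.1) (by linarith [p2.2.2.1])

/-- The passing points over `x = 1/2` with nonnegative height stay to the left of `1`. -/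
lemma kap_lt_one {N : ℕ} (hN : IsLong N) {h : ℝ} (h0 : 0 ≤ h) (h1 : h ≤ 22 / 100) :
    kap N h < 1 := by
  have hh : h ∈ heights := ⟨by linarith, h1⟩
  obtain ⟨p1, p2, p3⟩ := passPt_spec hN (x := 1 / 2) (by constructor <;> norm_num) hh
  set p := passPt N (1 / 2) h
  have hN2 := hN.two_le
  have key : ∀ j, j ≤ N → (phi^[j] p).1 < 1 := by
    intro j
    induction j with
    | zero => intro _; rw [Function.iterate_zero, id, p2]; norm_num
    | succ j ih =>
      intro hj
      rw [Function.iterate_succ_apply', phi_fst]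
      rcases Nat.eq_zero_or_pos j with rfl | hj0
      · rw [Function.iterate_zero, id, p2]
        linarith [(abs_le.1 p1.1.2.2).1]
      · have e1 := ih (by omega)
        have e2 := p1.snd_nonneg_of_end (p3 ▸ h0) hj0 (by omega : j ≤ N)
        have e3 := (p1.2 j hj0 (by omega)).1
        nlinarith
  have e := p1.kap_le hN (by rw [p3]; exact hh)
  rw [p3] at e
  exact e.trans_lt (key N le_rfl)

lemma Passes.three_quarters_le {N : ℕ} (hN : 2 ≤ N) {p : ℝ × ℝ} (hp : Passes N p) {j : ℕ}
    (h1 : 1 ≤ j) (hj : j ≤ N) : 3 / 4 ≤ (phi^[j] p).1 := by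
  rcases hj.lt_or_eq with h | rfl
  · exact (hp.2 j h1 h).1
  · obtain ⟨k, rfl⟩ : ∃ k, j = k + 1 := ⟨j - 1, by omega⟩
    obtain ⟨c1, -, c3⟩ := hp.2 k (by omega) (by omega)
    rw [Function.iterate_succ_apply']
    exact phi_fst_ge c1 c3

/-- The only non-invertibility of `phi^[N]` on passing points comes from the first step. -/
lemma Passes.phi_eq_of_iterate_eq {N : ℕ} (hN : 2 ≤ N) {p q : ℝ × ℝ} (hp : Passes N p)
    (hq : Passes N q) (h : phi^[N] p = phi^[N] q) : phi p = phi q := by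
  have key : ∀ k, k + 1 ≤ N → phi^[N - k] p = phi^[N - k] q := by
    intro k
    induction k with
    | zero => intro _; exact h
    | succ k ih =>
      intro hk
      have e := ih (by omega)
      rw [show N - k = N - (k + 1) + 1 by omega, Function.iterate_succ_apply',
        Function.iterate_succ_apply'] at e
      refine phi_injOn ?_ ?_ e
      · have := hp.three_quarters_le hN (j := N - (k + 1)) (by omega) (by omega)
        simp only [mem_ofPred_eq]; linarith
      · have := hq.three_quarters_le hN (j := N - (k + 1)) (by omega) (by omega)
        simp only [mem_ofPred_eq]; linarith
  have := key (N - 1) (by omega)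
  rwa [show N - (N - 1) = 1 by omega, Function.iterate_one] at this

lemma Passes.eq_of_iterate_eq {N : ℕ} (hN : 2 ≤ N) {p q : ℝ × ℝ} (hp : Passes N p)
    (hq : Passes N q) (hp2 : 1 / 2 < p.1) (hq2 : 1 / 2 < q.1) (h : phi^[N] p = phi^[N] q) :
    p = q :=
  phi_injOn hp2 hq2 (hp.phi_eq_of_iterate_eq hN hq h)

/-- The intermediate value theorem along a level, from the abscissa `a` to `7/5`, where the orbit
ends to the right of `7/5`. -/
lemma exists_passes_iterate_eq {N : ℕ} (hN : IsLong N) {h a X : ℝ} (hh : h ∈ heights)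
    (ha : a ∈ Icc (31 / 200 : ℝ) (7 / 5)) (h1 : (phi^[N] (passPt N a h)).1 ≤ X)
    (h2 : X ≤ 7 / 5) : ∃ p, Passes N p ∧ a ≤ p.1 ∧ phi^[N] p = (X, h) := by
  have hs : Icc a (7 / 5) ⊆ Icc (31 / 200 : ℝ) (7 / 5) := Icc_subset_Icc_left ha.1
  have hc : ContinuousOn (fun x => (phi^[N] (passPt N x h)).1) (Icc a (7 / 5)) :=
    (continuous_fst.comp (continuous_iterate N)).comp_continuousOn
      ((contDiffOn_passPt hN hh).continuousOn.mono hs)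
  obtain ⟨k1, k2, k3⟩ := passPt_spec hN (x := 7 / 5) (by constructor <;> norm_num) hh
  obtain ⟨x, hx, hxX⟩ := intermediate_value_Icc ha.2 hc
    ⟨h1, h2.trans (k1.end_fst_gt k2 le_rfl)⟩
  obtain ⟨l1, l2, l3⟩ := passPt_spec hN (hs hx) hh
  exact ⟨_, l1, by rw [l2]; exact hx.1, Prod.ext hxX l3⟩

open Classical in
/-- The passing point to the right of the fold that ends at `(1001/1000, h)`; the value is `0` if
there is none. -/
noncomputable def rightPt (N : ℕ) (h : ℝ) : ℝ × ℝ :=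
  if H : ∃ p, Passes N p ∧ 9 / 10 ≤ p.1 ∧ phi^[N] p = (1001 / 1000, h) then H.choose else 0

lemma rightPt_spec {N : ℕ} (hN : IsLong N) {h : ℝ} (hh : h ∈ heights) :
    Passes N (rightPt N h) ∧ 9 / 10 ≤ (rightPt N h).1 ∧
      phi^[N] (rightPt N h) = (1001 / 1000, h) := by
  have ha : (9 / 10 : ℝ) ∈ Icc (31 / 200 : ℝ) (7 / 5) := by constructor <;> norm_num
  obtain ⟨k1, k2, k3⟩ := passPt_spec hN ha hh
  have H := exists_passes_iterate_eq hN (X := 1001 / 1000) hh ha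
    (k1.end_fst_lt hN (by rw [k3]; exact hh.1) (by rw [k2]; norm_num)).le (by norm_num)
  unfold rightPt
  rw [dif_pos H]
  exact H.choose_spec

lemma Passes.eq_rightPt {N : ℕ} (hN : IsLong N) {p : ℝ × ℝ} (hp : Passes N p)
    (hh : (phi^[N] p).2 ∈ heights) (h9 : 9 / 10 ≤ p.1) (h : (phi^[N] p).1 = 1001 / 1000) :
    p = rightPt N (phi^[N] p).2 := by
  obtain ⟨k1, k2, k3⟩ := rightPt_spec hN hh
  exact hp.eq_of_iterate_eq hN.two_le k1 (by linarith) (by linarith) (by rw [k3, ← h])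

/-- The condition of ending to the left of `1001/1000`, read off at the start. -/
lemma Passes.end_fst_le_iff {N : ℕ} (hN : IsLong N) {p : ℝ × ℝ} (hp : Passes N p)
    (hh : (phi^[N] p).2 ∈ heights) :
    (phi^[N] p).1 ≤ 1001 / 1000 ↔ p.1 ≤ (rightPt N (phi^[N] p).2).1 := by
  obtain ⟨k1, k2, k3⟩ := rightPt_spec hN hh
  have k4 := congrArg Prod.snd k3
  have k5 := congrArg Prod.fst k3
  simp only at k4 k5
  constructor
  · intro h
    by_contra hlt
    push Not at hlt
    have := k1.order hN.two_le hp (fun _ => k4.symm) k2 hlt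
    linarith
  · intro h
    rcases le_or_gt p.1 (9 / 10) with h9 | h9
    · exact (hp.end_fst_lt hN hh.1 (by linarith)).le
    · rcases h.lt_or_eq with hlt | heq
      · have := hp.order hN.two_le k1 (fun _ => k4) h9.le hlt
        linarith
      · rw [← hp.eq_of_fst_eq hN.two_le k1 heq.symm k4, k5]

/-- The region `Q`: passing points with abscissa at least `18/100`, a value to the left of the fold,
that end in the range of heights and not too far to the right. -/
def Qset (N : ℕ) : Set (ℝ × ℝ) :=
  {p | Passes N p ∧ 18 / 100 ≤ p.1 ∧ (phi^[N] p).1 ≤ 1001 / 1000 ∧ (phi^[N] p).2 ∈ heights}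

lemma isCompact_Qset (N : ℕ) : IsCompact (Qset N) := by
  have h1 : IsClosed {p : ℝ × ℝ | 18 / 100 ≤ p.1} := isClosed_le continuous_const continuous_fst
  have h2 : IsClosed {p | (phi^[N] p).1 ≤ 1001 / 1000} :=
    isClosed_le (continuous_fst.comp (continuous_iterate N)) continuous_const
  have h3 : IsClosed {p | (phi^[N] p).2 ∈ heights} :=
    isClosed_Icc.preimage (continuous_snd.comp (continuous_iterate N))
  exact (isCompact_passes N).inter_right (h1.inter (h2.inter h3))

lemma mem_Qset_of_start {N : ℕ} (hN : IsLong N) {p : ℝ × ℝ} (hp : Passes N p)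
    (h1 : 18 / 100 ≤ p.1) (h2 : p.1 ≤ 1 + 1 / 1000) (hh : (phi^[N] p).2 ∈ heights) :
    p ∈ Qset N := ⟨hp, h1, (hp.end_fst_lt hN hh.1 h2).le, hh⟩

lemma rightPt_mem {N : ℕ} (hN : IsLong N) {h : ℝ} (hh : h ∈ heights) : rightPt N h ∈ Qset N := by
  obtain ⟨k1, k2, k3⟩ := rightPt_spec hN hh
  refine ⟨k1, by linarith, ?_, ?_⟩ <;> rw [k3]
  exact hh

lemma foldPt_mem {N : ℕ} (hN : IsLong N) {h : ℝ} (hh : h ∈ heights) : foldPt N h ∈ Qset N := by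
  obtain ⟨p1, p2, p3, -⟩ := foldPt_spec hN hh
  exact mem_Qset_of_start hN p1 (by linarith [p2.2.1]) (by linarith [p2.2.2.1])
    (by rw [p3]; exact hh)

/-- `phi^[N]` maps `Q` onto the region between the graph of `kap` and a vertical line. -/
lemma image_Qset {N : ℕ} (hN : IsLong N) :
    phi^[N] '' Qset N = {q | q.2 ∈ heights ∧ kap N q.2 ≤ q.1 ∧ q.1 ≤ 1001 / 1000} := by
  ext q
  constructor
  · rintro ⟨p, ⟨h1, -, h3, h4⟩, rfl⟩
    exact ⟨h4, h1.kap_le hN h4, h3⟩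
  · rintro ⟨h1, h2, h3⟩
    obtain ⟨k1, k2, k3, -⟩ := foldPt_spec hN h1
    have ha : (foldPt N q.2).1 ∈ Icc (31 / 200 : ℝ) (7 / 5) := ⟨k1.1.1, k1.1.2.1⟩
    have e := k1.eq_passPt hN (by rw [k3]; exact h1)
    rw [k3] at e
    obtain ⟨p, p1, p2, p3⟩ := exists_passes_iterate_eq hN (X := q.1) h1 ha
      (by rw [← e]; exact h2) (by linarith)
    refine ⟨p, ⟨p1, by linarith [k2.2.1], ?_, ?_⟩, p3⟩ <;> rw [p3]
    exacts [h3, h1]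

lemma Passes.tang_eq_zero_of_half_lt {N : ℕ} {p v : ℝ × ℝ} (hp : Passes N p) (h2 : 1 / 2 < p.1)
    (h : tang N p v = 0) : v = 0 :=
  hp.tang_eq_zero (phiLin_det _ h2).ne' le_rfl h

lemma left_mem_Icc : (18 / 100 : ℝ) ∈ Icc (31 / 200 : ℝ) (7 / 5) := by constructor <;> norm_num

/-- The left edge is the vertical segment over `18/100`, the right edge the part of the preimage of
the line `x = 1001/1000` to the right of the fold, where `phi^[N]` is a diffeomorphism. -/
lemma coords_Qset {N : ℕ} (hN : IsLong N) :
    Coords (Qset N) (fun p => (phi^[N] p).2) (-(1 / 1000)) (22 / 100)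
      (passPt N (18 / 100)) (rightPt N) where
  lt := by norm_num
  compact := isCompact_Qset N
  smooth := contDiff_snd_iterate N
  vert p hp v hv h := by
    rw [fderiv_prod_snd_iterate] at h
    exact hp.1.tang_cone_eq_zero hN.two_le (cone_vertical (by norm_num) hv) h
  inj p hp q hq h1 h2 := hq.1.eq_of_fst_eq hN.two_le hp.1 h1 h2
  level p hp := hp.2.2.2
  left_mem c hc := by
    obtain ⟨k1, k2, k3⟩ := passPt_spec hN left_mem_Icc hc
    exact mem_Qset_of_start hN k1 k2.ge (by rw [k2]; norm_num) (by rw [k3]; exact hc)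
  left_level c hc := (passPt_spec hN left_mem_Icc hc).2.2
  left_smooth := by
    refine contDiffOn_of_compact (isCompact_passes N) (contDiff_absHeight N)
      (injOn_absHeight hN.two_le) (fun c hc => (passPt_spec hN left_mem_Icc hc).1)
      (fun p hp => absHeight_immersive hN.two_le hp) ?_
    have : ContDiff ℝ 1 fun c : ℝ => ((18 / 100 : ℝ), c) := by fun_prop
    refine this.contDiffOn.congr fun c hc => ?_
    obtain ⟨-, h2, h3⟩ := passPt_spec hN left_mem_Icc hc
    simp only [absHeight, h2, h3]
  right_mem c hc := rightPt_mem hN hc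
  right_level c hc := by rw [(rightPt_spec hN hc).2.2]
  right_smooth := by
    refine contDiffOn_of_compact (K := {p | Passes N p} ∩ {p : ℝ × ℝ | 9 / 10 ≤ p.1})
      ((isCompact_passes N).inter_right (isClosed_le continuous_const continuous_fst))
      (contDiff_phi_iterate N) ?_ (fun c hc => ?_) ?_ ?_
    · rintro p ⟨hp, hp9⟩ q ⟨hq, hq9⟩ e
      simp only [mem_ofPred_eq] at hp9 hq9
      exact Passes.eq_of_iterate_eq hN.two_le hp hq (by linarith) (by linarith) e
    · exact ⟨(rightPt_spec hN hc).1, (rightPt_spec hN hc).2.1⟩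
    · rintro p ⟨hp, hp9⟩ v hv
      simp only [mem_ofPred_eq] at hp9
      exact Passes.tang_eq_zero_of_half_lt hp (by linarith) hv
    · have : ContDiff ℝ 1 fun c : ℝ => ((1001 / 1000 : ℝ), c) := by fun_prop
      exact this.contDiffOn.congr fun c hc => (rightPt_spec hN hc).2.2
  left_lt_right c hc := by
    rw [(passPt_spec hN left_mem_Icc hc).2.1]
    linarith [(rightPt_spec hN hc).2.1]
  left_le p hp := by
    rw [(passPt_spec hN left_mem_Icc hp.2.2.2).2.1]
    exact hp.2.1
  le_right p hp := (hp.1.end_fst_le_iff hN hp.2.2.2).1 hp.2.2.1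
  fill c hc x hx := by
    rw [(passPt_spec hN left_mem_Icc hc).2.1] at hx
    have hR := (rightPt_spec hN hc).1.1
    obtain ⟨k1, k2, k3⟩ := passPt_spec hN (x := x) ⟨by linarith [hx.1], hx.2.trans hR.2.1⟩ hc
    refine ⟨_, ⟨k1, by rw [k2]; exact hx.1, ?_, ?_⟩, k2, k3⟩
    · rw [k1.end_fst_le_iff hN (by rw [k3]; exact hc), k2, k3]
      exact hx.2
    · rw [k3]; exact hc

/-! ### Returning points -/

/-- `q` lies in the window `box i` and its second image passes along the axis. -/
def Returns (N : ℕ) (i : Fin 2) (q : ℝ × ℝ) : Prop := q ∈ box i ∧ Passes N (phi (phi q))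

lemma iterate_add_two' (N : ℕ) (q : ℝ × ℝ) : phi^[N + 2] q = phi^[N] (phi (phi q)) := rfl

/-- A level of the height at the end of the next passage contains no two points with nearly vertical
difference. -/
lemma Returns.eq_of_cone {N : ℕ} (hN : 2 ≤ N) {i : Fin 2} {p q : ℝ × ℝ} (hp : Returns N i p)
    (hq : Returns N i q) (h : Cone (7 / 5) (q - p))
    (he : (phi^[N + 2] q).2 = (phi^[N + 2] p).2) : q = p := by
  obtain ⟨k1, k2⟩ := ret_sub hp.1 hq.1 hp.2.1 hq.2.1 h
  have e := hp.2.eq_of_cone hN hq.2 k1 he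
  rw [e, sub_self, Prod.snd_zero, mul_zero, mul_zero] at k2
  refine sub_eq_zero.1 (h.eq_zero ?_)
  nlinarith [sq_nonneg (q - p).2]

lemma Returns.tang_eq_zero {N : ℕ} (hN : 2 ≤ N) {i : Fin 2} {p v : ℝ × ℝ} (hp : Returns N i p)
    (h : Cone (7 / 5) v) (he : (tang (N + 2) p v).2 = 0) : v = 0 := by
  obtain ⟨k1, k2⟩ := ret_tang hp.1 hp.2.1 h
  rw [tang_add] at he
  have e := hp.2.tang_cone_eq_zero hN k1 he
  rw [e, Prod.snd_zero, mul_zero, mul_zero] at k2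
  refine h.eq_zero ?_
  nlinarith [sq_nonneg v.2]

/-- `Returns.eq_of_cone`, read off at the beginning of the preceding passage. -/
lemma Returns.eq_of_start {N : ℕ} (hN : 2 ≤ N) {i : Fin 2} {p q : ℝ × ℝ} (hp : Passes N p)
    (hq : Passes N q) (hp' : Returns N i (phi^[N] p)) (hq' : Returns N i (phi^[N] q))
    (h : Cone 3 (q - p))
    (he : (phi^[N + 2] (phi^[N] q)).2 = (phi^[N + 2] (phi^[N] p)).2) : q = p := by
  have e := hp'.eq_of_cone hN hq' (hp.cone_sub hN hq h).1 he
  exact hp.eq_of_cone hN hq h (by rw [e])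

lemma Returns.tang_start_eq_zero {N : ℕ} (hN : 2 ≤ N) {i : Fin 2} {p v : ℝ × ℝ} (hp : Passes N p)
    (hp' : Returns N i (phi^[N] p)) (h : Cone 3 v) (he : (tang (N + 2 + N) p v).2 = 0) :
    v = 0 := by
  rw [tang_add] at he
  have e := hp'.tang_eq_zero hN (hp.cone_tang hN h).1 he
  exact hp.tang_cone_eq_zero hN h (by rw [e]; rfl)

/-- Returning points land strictly to the right of the left edge `x = 18/100` of `Q`, and at most
slightly to the right of the fixed point. -/
lemma return_fst_bounds {N : ℕ} {i : Fin 2} {q : ℝ × ℝ} (hq : Returns N i q)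
    (hX : q.1 ≤ 1001 / 1000) :
    193 / 1000 ≤ (phi (phi q)).1 ∧ (phi (phi q)).1 ≤ 1 + 1 / 1000 := by
  obtain ⟨h1, h2⟩ := hq
  fin_cases i
  · have := return_zero h1 hX h2.1
    constructor <;> linarith [this.1, this.2]
  · have := return_one h1 hX h2.1
    constructor <;> linarith [this.1, this.2]

/-- Returning points come back to `Q`, provided that the range of heights is respected. -/
lemma Returns.mem_Qset {N : ℕ} (hN : IsLong N) {i : Fin 2} {q : ℝ × ℝ} (hq : Returns N i q)
    (hX : q.1 ≤ 1001 / 1000) (hh : (phi^[N + 2] q).2 ∈ heights) : phi (phi q) ∈ Qset N := by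
  obtain ⟨h1, h2⟩ := return_fst_bounds hq hX
  exact mem_Qset_of_start hN hq.2 (by linarith) h2 hh

/-- The points of `Q` that return to `Q` through the window `box i`. -/
def Rset (N : ℕ) (i : Fin 2) : Set (ℝ × ℝ) :=
  {p | p ∈ Qset N ∧ phi^[N] p ∈ box i ∧ phi^[N + 2] p ∈ Qset N}

/-- The points of `phi^[N] '' Q` in `box i` whose second image lies in `Q`. -/
def Pset (N : ℕ) (i : Fin 2) : Set (ℝ × ℝ) := phi^[N] '' Rset N i

lemma isClosed_box (i : Fin 2) : IsClosed (box i) := by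
  fin_cases i
  · have : box 0 = Icc (93 / 100 : ℝ) (201 / 200) ×ˢ Icc (-(1 / 1000) : ℝ) (1 / 1000) := by
      ext p; rw [mem_box_zero]; simp only [mem_prod, mem_Icc]; tauto
    exact this ▸ isClosed_Icc.prod isClosed_Icc
  · have : box 1 = Icc (93 / 100 : ℝ) (509 / 500) ×ˢ Icc (197 / 1000 : ℝ) (209 / 1000) := by
      ext p; rw [mem_box_one]; simp only [mem_prod, mem_Icc]; tauto
    exact this ▸ isClosed_Icc.prod isClosed_Icc

lemma isCompact_Rset (N : ℕ) (i : Fin 2) : IsCompact (Rset N i) :=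
  (isCompact_Qset N).inter_right (((isClosed_box i).preimage (continuous_iterate N)).inter
    ((isCompact_Qset N).isClosed.preimage (continuous_iterate (N + 2))))

lemma Rset.returns {N : ℕ} {i : Fin 2} {p : ℝ × ℝ} (hp : p ∈ Rset N i) :
    Returns N i (phi^[N] p) := by
  refine ⟨hp.2.1, ?_⟩
  rw [← iterate_add_two]
  exact hp.2.2.1

lemma mem_Rset {N : ℕ} (hN : IsLong N) {i : Fin 2} {p : ℝ × ℝ} (hp : p ∈ Qset N)
    (h : Returns N i (phi^[N] p)) (hh : (phi^[N + 2] (phi^[N] p)).2 ∈ heights) :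
    p ∈ Rset N i := by
  refine ⟨hp, h.1, ?_⟩
  rw [iterate_add_two]
  exact h.mem_Qset hN hp.2.2.1 hh

lemma Rset.height_mem {N : ℕ} {i : Fin 2} {p : ℝ × ℝ} (hp : p ∈ Rset N i) :
    (phi^[N + 2] (phi^[N] p)).2 ∈ heights := by
  have := hp.2.2.2.2.2
  rwa [iterate_add_two] at this

/-- Within a window, nearly vertical curves deviate by at most `7/5` times its height; this is why
the boxes extend a little beyond `x = 1001/1000`. -/
lemma bracket_diff {i : Fin 2} {h h' : ℝ} (hh : h ∈ bracket i) (hh' : h' ∈ bracket i) :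
    ∀ x, x ≤ 1001 / 1000 + 7 / 5 * |h - h'| → 93 / 100 ≤ x → (x, h) ∈ box i := by
  intro x hx hx'
  fin_cases i
  · simp only [bracket, Fin.zero_eta, if_true] at hh hh'
    have : |h - h'| ≤ 2 / 1000 := abs_le.2 ⟨by linarith [hh.1, hh'.2], by linarith [hh.2, hh'.1]⟩
    simp only [Fin.zero_eta, mem_box_zero]
    exact ⟨hx', by linarith, hh⟩
  · simp only [bracket, Fin.mk_one, one_ne_zero, if_false] at hh hh'
    have : |h - h'| ≤ 12 / 1000 := abs_le.2 ⟨by linarith [hh.1, hh'.2], by linarith [hh.2, hh'.1]⟩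
    simp only [Fin.mk_one, mem_box_one]
    exact ⟨hx', by linarith, hh⟩

lemma mem_box_of_le {i : Fin 2} {h x : ℝ} (hh : h ∈ bracket i) (hx : x ≤ 1001 / 1000)
    (hx' : 93 / 100 ≤ x) : (x, h) ∈ box i :=
  bracket_diff hh hh x (by simpa using hx) hx'

/-- On each vertical line through the strip there is a passing point that returns through `box i`
and reaches a given height `c` at the end of the next passage. It is found where the image of
the vertical line crosses the window; `hle` makes sure that this image stays in the window, by
requiring it for a single height `h₀`. -/
lemma exists_start {N : ℕ} (hN : IsLong N) {i : Fin 2} {x c h₀ : ℝ}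
    (hx : x ∈ Icc (31 / 200 : ℝ) (7 / 5)) (h₀m : h₀ ∈ bracket i)
    (hle : (phi^[N] (passPt N x h₀)).1 ≤ 1001 / 1000) (hc : c ∈ heights) :
    ∃ p, Passes N p ∧ p.1 = x ∧ (phi^[N] p).2 ∈ heights ∧ Returns N i (phi^[N] p) ∧
      (phi^[N + 2] (phi^[N] p)).2 = c := by
  have hX : ContinuousOn (fun h => (phi^[N] (passPt N x h)).1) (bracket i) := by
    refine (continuous_fst.comp (continuous_iterate N)).comp_continuousOn ?_
    exact (continuousOn_passPt hN).comp (by fun_prop : ContinuousOn (fun h : ℝ => (x, h)) _)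
      fun h hh => ⟨hx, bracket_subset i hh⟩
  obtain ⟨h, hh, k1, k2⟩ := exists_crossing hN hX (fun h hh => by
    obtain ⟨p1, p2, p3⟩ := passPt_spec hN hx (bracket_subset i hh)
    obtain ⟨q1, q2, q3⟩ := passPt_spec hN hx (bracket_subset i h₀m)
    have e := (q1.cone_sub hN.two_le p1 (cone_vertical (by norm_num) (by simp [p2, q2]))).1
    unfold Cone at e
    rw [Prod.fst_sub, Prod.snd_sub, p3, q3] at e
    exact bracket_diff hh h₀m _ (by linarith [(abs_le.1 e).2])
      (p1.end_fst_ge hN (by rw [p3]; exact (bracket_subset i hh).2))) hc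
  obtain ⟨p1, p2, p3⟩ := passPt_spec hN hx (bracket_subset i hh)
  have e : phi^[N] (passPt N x h) = ((phi^[N] (passPt N x h)).1, h) := Prod.ext rfl p3
  rw [← e] at k1 k2
  refine ⟨_, p1, p2, by rw [p3]; exact bracket_subset i hh, ⟨?_, k1⟩, k2⟩
  obtain ⟨q1, q2, q3⟩ := passPt_spec hN hx (bracket_subset i h₀m)
  have e' := (q1.cone_sub hN.two_le p1 (cone_vertical (by norm_num) (by simp [p2, q2]))).1
  unfold Cone at e'
  rw [Prod.fst_sub, Prod.snd_sub, p3, q3] at e'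
  rw [e]
  exact bracket_diff hh h₀m _ (by linarith [(abs_le.1 e').2])
    (p1.end_fst_ge hN (by rw [p3]; exact (bracket_subset i hh).2))

lemma bracket_nonempty (i : Fin 2) : (bracket i).Nonempty := by
  fin_cases i
  · exact ⟨0, by simp [bracket]⟩
  · exact ⟨1 / 5, by simp only [bracket, Fin.mk_one, one_ne_zero, if_false]; constructor <;> norm_num⟩

/-- The left end of a level of `Rset`. -/
lemma exists_Rset_left {N : ℕ} (hN : IsLong N) (i : Fin 2) {c : ℝ} (hc : c ∈ heights) :
    ∃ p ∈ Rset N i, p.1 = 18 / 100 ∧ (phi^[N + 2] (phi^[N] p)).2 = c := by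
  obtain ⟨h₀, h₀m⟩ := bracket_nonempty i
  obtain ⟨k1, k2, k3⟩ := passPt_spec hN left_mem_Icc (bracket_subset i h₀m)
  obtain ⟨p, p1, p2, p3, p4, p5⟩ := exists_start hN left_mem_Icc h₀m
    (k1.end_fst_lt hN (by rw [k3]; exact (bracket_subset i h₀m).1)
      (by rw [k2]; norm_num)).le hc
  exact ⟨p, mem_Rset hN (mem_Qset_of_start hN p1 p2.ge (by rw [p2]; norm_num) p3) p4
    (by rw [p5]; exact hc), p2, p5⟩

/-- The right end of a level of `Rset`: the line `x = 1001/1000` crosses the window. -/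
lemma exists_Rset_right {N : ℕ} (hN : IsLong N) (i : Fin 2) {c : ℝ} (hc : c ∈ heights) :
    ∃ p ∈ Rset N i, 9 / 10 ≤ p.1 ∧ (phi^[N] p).1 = 1001 / 1000 ∧
      (phi^[N + 2] (phi^[N] p)).2 = c := by
  obtain ⟨h, hh, k1, k2⟩ := exists_crossing hN (i := i) (X := fun _ => 1001 / 1000)
    continuousOn_const (fun h hh => mem_box_of_le hh le_rfl (by norm_num)) hc
  obtain ⟨l1, l2, l3⟩ := rightPt_spec hN (bracket_subset i hh)
  simp only [← l3] at k1 k2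
  refine ⟨_, mem_Rset hN (rightPt_mem hN (bracket_subset i hh)) ⟨?_, k1⟩ ?_, l2, ?_, k2⟩
  · rw [l3]; exact mem_box_of_le hh le_rfl (by norm_num)
  · rw [iterate_add_two', k2]; exact hc
  · rw [l3]

/-- The fold point on a level of `Rset`: the graph of `kap` crosses the window. -/
lemma exists_Rset_fold {N : ℕ} (hN : IsLong N) (i : Fin 2) {c : ℝ} (hc : c ∈ heights) :
    ∃ p ∈ Rset N i, p ∈ foldSet ∧ phi^[N] p = (kap N (phi^[N] p).2, (phi^[N] p).2) ∧
      (phi^[N + 2] (phi^[N] p)).2 = c := by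
  have hb : ∀ h ∈ bracket i, (kap N h, h) ∈ box i := fun h hh =>
    mem_box_of_le hh (kap_lt hN (bracket_subset i hh)).le (kap_ge hN (bracket_subset i hh))
  obtain ⟨h, hh, k1, k2⟩ := exists_crossing hN ((continuousOn_kap hN).mono (bracket_subset i))
    hb hc
  have l3 := iterate_foldPt hN (bracket_subset i hh)
  have hb' := hb h hh
  rw [← l3] at k1 k2 hb'
  refine ⟨_, mem_Rset hN (foldPt_mem hN (bracket_subset i hh)) ⟨hb', k1⟩ ?_,
    (foldPt_spec hN (bracket_subset i hh)).2.1, ?_, k2⟩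
  · rw [iterate_add_two', k2]; exact hc
  · rw [l3]

lemma contDiff_retHeight (N : ℕ) : ContDiff ℝ 1 fun p => (phi^[N + 2] (phi^[N] p)).2 :=
  (contDiff_snd_iterate (N + 2)).comp (contDiff_phi_iterate N)

lemma fderiv_retHeight (N : ℕ) (p v : ℝ × ℝ) :
    fderiv ℝ (fun p => (phi^[N + 2] (phi^[N] p)).2) p v = (tang (N + 2 + N) p v).2 := by
  have : (fun p => (phi^[N + 2] (phi^[N] p)).2) = fun p => (phi^[N + 2 + N] p).2 := by
    funext p
    exact congrArg Prod.snd (Function.iterate_add_apply phi (N + 2) N p).symm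
  rw [this, fderiv_prod_snd_iterate]

/-- Points of `Rset` ordered along a level keep their order in the image. -/
lemma Rset.order {N : ℕ} (hN : IsLong N) {i : Fin 2} {p q : ℝ × ℝ} (hp : Passes N p)
    (hq : Passes N q) (hp' : Returns N i (phi^[N] p)) (hq' : Returns N i (phi^[N] q))
    (he : (phi^[N + 2] (phi^[N] q)).2 = (phi^[N + 2] (phi^[N] p)).2) (h9 : 9 / 10 ≤ p.1)
    (h : p.1 < q.1) : (phi^[N] p).1 < (phi^[N] q).1 :=
  hp.order hN.two_le hq (fun hc => by rw [hp'.eq_of_cone hN.two_le hq' hc he]) h9 h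

/-- To the right of the fold, `phi^[N]` and the height after the return determine a point of
`Rset`. -/
lemma Rset.eq_of_end {N : ℕ} (hN : IsLong N) {i : Fin 2} {p q : ℝ × ℝ} (hp : p ∈ Rset N i)
    (hq : q ∈ Rset N i) (hp9 : 9 / 10 ≤ p.1) (hq9 : 9 / 10 ≤ q.1)
    (h : (phi^[N] p).1 = (phi^[N] q).1)
    (he : (phi^[N + 2] (phi^[N] p)).2 = (phi^[N + 2] (phi^[N] q)).2) : p = q := by
  refine hp.1.1.eq_of_iterate_eq hN.two_le hq.1.1 (by linarith) (by linarith) ?_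
  exact (Rset.returns hq).eq_of_cone hN.two_le (Rset.returns hp)
    (cone_vertical (by norm_num) (by simp [h])) he

/-- Coordinates on `Rset`: abscissa, and height at the end of the passage after the return. The left
edge lies on the left edge of `Q`, the right edge on the right edge of `Q`. -/
theorem exists_coords_Rset {N : ℕ} (hN : IsLong N) (i : Fin 2) : ∃ L R : ℝ → ℝ × ℝ,
    Coords (Rset N i) (fun p => (phi^[N + 2] (phi^[N] p)).2) (-(1 / 1000)) (22 / 100) L R ∧
    (∀ c ∈ heights, (L c).1 = 18 / 100) ∧
    (∀ c ∈ heights, 9 / 10 ≤ (R c).1 ∧ (phi^[N] (R c)).1 = 1001 / 1000) := by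
  have hN2 := hN.two_le
  have exL : ∀ c, ∃ p, c ∈ heights → p ∈ Rset N i ∧ p.1 = 18 / 100 ∧
      (phi^[N + 2] (phi^[N] p)).2 = c := fun c => by
    by_cases hc : c ∈ heights
    · obtain ⟨p, hp⟩ := exists_Rset_left hN i hc
      exact ⟨p, fun _ => hp⟩
    · exact ⟨0, fun h => absurd h hc⟩
  have exR : ∀ c, ∃ p, c ∈ heights → p ∈ Rset N i ∧ 9 / 10 ≤ p.1 ∧
      (phi^[N] p).1 = 1001 / 1000 ∧ (phi^[N + 2] (phi^[N] p)).2 = c := fun c => by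
    by_cases hc : c ∈ heights
    · obtain ⟨p, hp⟩ := exists_Rset_right hN i hc
      exact ⟨p, fun _ => hp⟩
    · exact ⟨0, fun h => absurd h hc⟩
  choose L hL using exL
  choose R hR using exR
  have vert : ∀ p ∈ Rset N i, ∀ v : ℝ × ℝ, v.1 = 0 →
      fderiv ℝ (fun p => (phi^[N + 2] (phi^[N] p)).2) p v = 0 → v = 0 := by
    intro p hp v hv h
    rw [fderiv_retHeight] at h
    exact (Rset.returns hp).tang_start_eq_zero hN2 hp.1.1 (cone_vertical (by norm_num) hv) h
  have inj : ∀ p ∈ Rset N i, ∀ q ∈ Rset N i, p.1 = q.1 →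
      (phi^[N + 2] (phi^[N] p)).2 = (phi^[N + 2] (phi^[N] q)).2 → p = q := fun p hp q hq h1 h2 =>
    Returns.eq_of_start hN2 hq.1.1 hp.1.1 (Rset.returns hq) (Rset.returns hp)
      (cone_vertical (by norm_num) (by simp [h1])) h2
  have le_right : ∀ p ∈ Rset N i, p.1 ≤ (R (phi^[N + 2] (phi^[N] p)).2).1 := by
    intro p hp
    obtain ⟨r1, r2, r3, r4⟩ := hR _ (Rset.height_mem hp)
    by_contra hlt
    push Not at hlt
    have := Rset.order hN r1.1.1 hp.1.1 (Rset.returns r1) (Rset.returns hp) r4.symm r2 hlt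
    linarith [hp.1.2.2.1]
  refine ⟨L, R, ⟨by norm_num, isCompact_Rset N i, contDiff_retHeight N, vert, inj,
    fun p hp => Rset.height_mem hp, fun c hc => (hL c hc).1, fun c hc => (hL c hc).2.2, ?_,
    fun c hc => (hR c hc).1, fun c hc => (hR c hc).2.2.2, ?_, fun c hc => ?_, fun p hp => ?_,
    le_right, fun c hc x hx => ?_⟩,
    fun c hc => (hL c hc).2.1, fun c hc => ⟨(hR c hc).2.1, (hR c hc).2.2.1⟩⟩
  · refine contDiffOn_of_compact (isCompact_Rset N i)
      (contDiff_fst.prodMk (contDiff_retHeight N))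
      (fun p hp q hq e => inj p hp q hq (Prod.mk.inj e).1 (Prod.mk.inj e).2)
      (fun c hc => (hL c hc).1) (fun p hp v hv => ?_) ?_
    · rw [fderiv_pair contDiff_fst (contDiff_retHeight N), fderiv_fst] at hv
      exact vert p hp v (Prod.mk.inj hv).1 (Prod.mk.inj hv).2
    · have : ContDiff ℝ 1 fun c : ℝ => ((18 / 100 : ℝ), c) := by fun_prop
      exact this.contDiffOn.congr fun c hc => by rw [(hL c hc).2.1, (hL c hc).2.2]
  · refine contDiffOn_of_compact (K := Rset N i ∩ {p : ℝ × ℝ | 9 / 10 ≤ p.1})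
      ((isCompact_Rset N i).inter_right (isClosed_le continuous_const continuous_fst))
      ((contDiff_fst_iterate N).prodMk (contDiff_retHeight N)) ?_
      (fun c hc => ⟨(hR c hc).1, (hR c hc).2.1⟩) ?_ ?_
    · rintro p ⟨hp, hp9⟩ q ⟨hq, hq9⟩ e
      exact Rset.eq_of_end hN hp hq hp9 hq9 (Prod.mk.inj e).1 (Prod.mk.inj e).2
    · rintro p ⟨hp, hp9⟩ v hv
      simp only [mem_ofPred_eq] at hp9
      rw [fderiv_pair (contDiff_fst_iterate N) (contDiff_retHeight N), fderiv_prod_fst_iterate,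
        fderiv_retHeight, tang_add] at hv
      have := (Rset.returns hp).tang_eq_zero hN2 (cone_vertical (by norm_num) (Prod.mk.inj hv).1)
        (Prod.mk.inj hv).2
      exact hp.1.1.tang_eq_zero_of_half_lt (by linarith) this
    · have : ContDiff ℝ 1 fun c : ℝ => ((1001 / 1000 : ℝ), c) := by fun_prop
      exact this.contDiffOn.congr fun c hc => by rw [(hR c hc).2.2.1, (hR c hc).2.2.2]
  · rw [(hL c hc).2.1]
    linarith [(hR c hc).2.1]
  · rw [(hL _ (Rset.height_mem hp)).2.1]
    exact hp.1.2.1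
  · obtain ⟨r1, r2, r3, r4⟩ := hR c hc
    rw [(hL c hc).2.1] at hx
    have hxm : x ∈ Icc (31 / 200 : ℝ) (7 / 5) :=
      ⟨by linarith [hx.1], hx.2.trans r1.1.1.1.2.1⟩
    have h₀m := snd_mem_bracket r1.2.1
    -- The vertical line through `x` meets the level of final height `(phi^[N] (R c)).2` inside `Q`,
    -- because `x` is to the left of the right end `R c` of that level. Hence its image passes
    -- through the window.
    have hle : (phi^[N] (passPt N x (phi^[N] (R c)).2)).1 ≤ 1001 / 1000 := by
      obtain ⟨k1, k2, k3⟩ := passPt_spec hN hxm (bracket_subset i h₀m)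
      rw [k1.end_fst_le_iff hN (by rw [k3]; exact bracket_subset i h₀m), k2, k3,
        ← r1.1.1.eq_rightPt hN r1.1.2.2.2 r2 r3]
      exact hx.2
    obtain ⟨p, p1, p2, p3, p4, p5⟩ := exists_start hN hxm h₀m hle hc
    refine ⟨p, mem_Rset hN ⟨p1, by rw [p2]; exact hx.1, ?_, p3⟩ p4 (by rw [p5]; exact hc), p2, p5⟩
    rcases le_or_gt p.1 (9 / 10) with h9 | h9
    · exact (p1.end_fst_lt hN p3.1 (by linarith)).le
    rw [← p2] at hx
    rcases hx.2.lt_or_eq with hlt | heq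
    · rw [← r3]
      exact (Rset.order hN p1 r1.1.1 p4 (Rset.returns r1) (by rw [r4, p5]) h9.le hlt).le
    · rw [← Returns.eq_of_start hN2 p1 r1.1.1 p4 (Rset.returns r1)
        (cone_vertical (by norm_num) (by simp [heq])) (by rw [r4, p5]), r3]

lemma mem_Pset {N : ℕ} (hN : IsLong N) {i : Fin 2} {q : ℝ × ℝ} : q ∈ Pset N i ↔
    (q.2 ∈ heights ∧ kap N q.2 ≤ q.1 ∧ q.1 ≤ 1001 / 1000) ∧ Returns N i q ∧
      (phi^[N + 2] q).2 ∈ heights := by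
  constructor
  · rintro ⟨p, hp, rfl⟩
    refine ⟨?_, Rset.returns hp, Rset.height_mem hp⟩
    have := mem_image_of_mem phi^[N] hp.1
    rwa [image_Qset hN] at this
  · rintro ⟨h1, h2, h3⟩
    have : q ∈ phi^[N] '' Qset N := by rw [image_Qset hN]; exact h1
    obtain ⟨p, hp, rfl⟩ := this
    exact ⟨p, mem_Rset hN hp h2 h3, rfl⟩

lemma isCompact_Pset (N : ℕ) (i : Fin 2) : IsCompact (Pset N i) :=
  (isCompact_Rset N i).image (continuous_iterate N)

/-- Coordinates on `Pset`: abscissa, and height at the end of the next passage. The left edge lies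
on the graph of `kap`, the image of the fold; it is `C¹` because its preimage on the fold curve
is. -/
theorem exists_coords_Pset {N : ℕ} (hN : IsLong N) (i : Fin 2) : ∃ L R : ℝ → ℝ × ℝ,
    Coords (Pset N i) (fun q => (phi^[N + 2] q).2) (-(1 / 1000)) (22 / 100) L R := by
  have hN2 := hN.two_le
  have exL : ∀ c, ∃ p, c ∈ heights → p ∈ Rset N i ∧ p ∈ foldSet ∧
      phi^[N] p = (kap N (phi^[N] p).2, (phi^[N] p).2) ∧
      (phi^[N + 2] (phi^[N] p)).2 = c := fun c => by
    by_cases hc : c ∈ heights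
    · obtain ⟨p, hp⟩ := exists_Rset_fold hN i hc
      exact ⟨p, fun _ => hp⟩
    · exact ⟨0, fun h => absurd h hc⟩
  choose Z hZ using exL
  obtain ⟨L', R, hR, _, hR'⟩ := exists_coords_Rset hN i
  have inj : ∀ p ∈ Pset N i, ∀ q ∈ Pset N i, p.1 = q.1 →
      (phi^[N + 2] p).2 = (phi^[N + 2] q).2 → p = q := fun p hp q hq h1 h2 =>
    ((mem_Pset hN).1 hq).2.1.eq_of_cone hN2 ((mem_Pset hN).1 hp).2.1
      (cone_vertical (by norm_num) (by simp [h1])) h2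
  have hZP : ∀ c ∈ heights, phi^[N] (Z c) ∈ Pset N i := fun c hc =>
    mem_image_of_mem _ (hZ c hc).1
  -- The graph of `kap` is steeper than the levels, so that it meets each level only once.
  have key : ∀ c ∈ heights, ∀ q, Returns N i q → q.2 ∈ heights → (phi^[N + 2] q).2 = c →
      |q.1 - (phi^[N] (Z c)).1| ≤ |kap N q.2 - (phi^[N] (Z c)).1| → q = phi^[N] (Z c) := by
    intro c hc q hq hqh hqc hle
    obtain ⟨z1, z2, z3, z4⟩ := hZ c hc
    refine (Rset.returns z1).eq_of_cone hN2 hq (hle.trans ?_) (by rw [hqc, z4])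
    have e : (phi^[N] (Z c)).1 = kap N (phi^[N] (Z c)).2 := (Prod.ext_iff.1 z3).1
    rw [e]
    exact kap_lipschitz hN z1.1.2.2.2 hqh
  refine ⟨fun c => phi^[N] (Z c), fun c => phi^[N] (R c),
    ⟨by norm_num, isCompact_Pset N i, contDiff_snd_iterate (N + 2), fun q hq v hv h => ?_, inj,
    fun q hq => ((mem_Pset hN).1 hq).2.2, hZP, fun c hc => (hZ c hc).2.2.2, ?_,
    fun c hc => mem_image_of_mem _ (hR.right_mem c hc), fun c hc => hR.right_level c hc,
    (contDiff_phi_iterate N).comp_contDiffOn hR.right_smooth, fun c hc => ?_, fun q hq => ?_,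
    fun q hq => ?_, fun c hc x hx => ?_⟩⟩
  · rw [fderiv_prod_snd_iterate] at h
    exact ((mem_Pset hN).1 hq).2.1.tang_eq_zero hN2 (cone_vertical (by norm_num) hv) h
  · refine (contDiff_phi_iterate N).comp_contDiffOn ?_
    refine contDiffOn_of_compact (K := Rset N i ∩ foldSet)
      ((isCompact_Rset N i).inter_right isClosed_foldSet)
      (contDiff_jac.prodMk (contDiff_retHeight N)) ?_
      (fun c hc => ⟨(hZ c hc).1, (hZ c hc).2.1⟩) ?_ ?_
    · rintro p ⟨hp, hpf⟩ q ⟨hq, hqf⟩ e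
      exact Returns.eq_of_start hN2 hq.1.1 hp.1.1 (Rset.returns hq) (Rset.returns hp)
        (cone_foldSet hqf hpf) (Prod.mk.inj e).2
    · rintro p ⟨hp, hpf⟩ v hv
      rw [fderiv_pair contDiff_jac (contDiff_retHeight N), fderiv_retHeight] at hv
      exact (Rset.returns hp).tang_start_eq_zero hN2 hp.1.1
        (cone_fderiv_jac hpf (Prod.mk.inj hv).1) (Prod.mk.inj hv).2
    · have : ContDiff ℝ 1 fun c : ℝ => ((0 : ℝ), c) := by fun_prop
      exact this.contDiffOn.congr fun c hc => by rw [(hZ c hc).2.1.1, (hZ c hc).2.2.2]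
  · obtain ⟨z1, z2, z3, z4⟩ := hZ c hc
    rw [(hR' c hc).2, z3]
    exact kap_lt hN z1.1.2.2.2
  · obtain ⟨⟨q1, q2, q3⟩, q4, q5⟩ := (mem_Pset hN).1 hq
    by_contra hlt
    push Not at hlt
    have := key _ q5 q q4 q1 rfl (by
      rw [abs_of_neg (by linarith), abs_of_neg (by linarith)]; linarith)
    rw [← this] at hlt
    exact lt_irrefl _ hlt
  · obtain ⟨⟨q1, q2, q3⟩, q4, q5⟩ := (mem_Pset hN).1 hq
    rw [(hR' _ q5).2]
    exact q3
  · obtain ⟨z1, z2, z3, z4⟩ := hZ c hc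
    have e : (phi^[N] (Z c)).1 = kap N (phi^[N] (Z c)).2 := (Prod.ext_iff.1 z3).1
    have hx2 : x ≤ 1001 / 1000 := by rw [← (hR' c hc).2]; exact hx.2
    have hx1 : 93 / 100 ≤ x := le_trans (by rw [e]; exact kap_ge hN z1.1.2.2.2) hx.1
    obtain ⟨h, hh, k1, k2⟩ := exists_crossing hN (i := i) (X := fun _ => x)
      continuousOn_const (fun h hh => mem_box_of_le hh hx2 hx1) hc
    have hret : Returns N i (x, h) := ⟨mem_box_of_le hh hx2 hx1, k1⟩
    refine ⟨(x, h), (mem_Pset hN).2 ⟨⟨bracket_subset i hh, ?_, hx2⟩, hret, ?_⟩, rfl, k2⟩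
    · by_contra hlt
      push Not at hlt
      simp only at hlt
      have := key c hc (x, h) hret (bracket_subset i hh) k2 (by
        simp only
        rw [abs_of_nonneg (by linarith [hx.1]), abs_of_nonneg (by linarith [hx.1])]; linarith)
      rw [← this] at e
      simp only at e
      linarith
    · rw [iterate_add_two', k2]; exact hc

/-! ### The horseshoe -/

/-- Turning a region upside down. -/
lemma Coords.flip {Rg : Set (ℝ × ℝ)} {f : ℝ × ℝ → ℝ} {a b : ℝ} {L R : ℝ → ℝ × ℝ}
    (h : Coords Rg f a b L R) : Coords Rg (fun p => a + b - f p) a b (fun c => L (a + b - c))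
      (fun c => R (a + b - c)) := by
  have hm : ∀ c ∈ Icc a b, a + b - c ∈ Icc a b := fun c hc =>
    ⟨by linarith [hc.2], by linarith [hc.1]⟩
  have hs : ContDiffOn ℝ 1 (fun c => a + b - c) (Icc a b) := by fun_prop
  refine ⟨h.lt, h.compact, contDiff_const.sub h.smooth, fun p hp v hv h0 => ?_,
    fun p hp q hq h1 h2 => h.inj p hp q hq h1 (by linarith), fun p hp => hm _ (h.level p hp),
    fun c hc => h.left_mem _ (hm c hc), fun c hc => by rw [h.left_level _ (hm c hc)]; ring,
    h.left_smooth.comp hs hm, fun c hc => h.right_mem _ (hm c hc),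
    fun c hc => by rw [h.right_level _ (hm c hc)]; ring, h.right_smooth.comp hs hm,
    fun c hc => h.left_lt_right _ (hm c hc), fun p hp => ?_, fun p hp => ?_,
    fun c hc x hx => ?_⟩
  · refine h.vert p hp v hv ?_
    rw [fderiv_const_sub] at h0
    simpa using h0
  · simpa using h.left_le p hp
  · simpa using h.le_right p hp
  · obtain ⟨p, p1, p2, p3⟩ := h.fill _ (hm c hc) x hx
    exact ⟨p, p1, p2, by rw [p3]; ring⟩

/-- The rectangle `Q`, with the height at the end of the passage as height function. -/
lemma exists_rect_Qset {N : ℕ} (hN : IsLong N) : ∃ Q : CurvRect, Q.region = Qset N ∧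
    Q.IsHeight (fun p => (phi^[N] p).2) (-(1 / 1000)) (22 / 100) ∧
    Q.left = {p ∈ Qset N | p.1 = 18 / 100} ∧
    Q.right = {p ∈ Qset N | 9 / 10 ≤ p.1 ∧ (phi^[N] p).1 = 1001 / 1000} := by
  obtain ⟨Q, h1, h2, h3, h4⟩ := (coords_Qset hN).exists_rect
  refine ⟨Q, h1, h2, ?_, ?_⟩
  · rw [h3]
    ext p
    exact and_congr_right fun hp => by rw [(passPt_spec hN left_mem_Icc hp.2.2.2).2.1]
  · rw [h4]
    ext p
    refine and_congr_right fun hp => ?_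
    obtain ⟨k1, k2, k3⟩ := rightPt_spec hN hp.2.2.2
    constructor
    · intro h
      have e := (coords_Qset hN).inj p hp _ (rightPt_mem hN hp.2.2.2) h (by simp only [k3])
      rw [← e] at k2 k3
      exact ⟨k2, congrArg Prod.fst k3⟩
    · rintro ⟨h5, h6⟩
      exact congrArg Prod.fst (hp.1.eq_rightPt hN hp.2.2.2 h5 h6)

/-- Both orientations of `Rset` are provided: `R'` is upside down. -/
lemma exists_rect_Rset {N : ℕ} (hN : IsLong N) (i : Fin 2) : ∃ R R' : CurvRect,
    R.IsHeight (fun p => (phi^[N + 2] (phi^[N] p)).2) (-(1 / 1000)) (22 / 100) ∧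
    R'.IsHeight (fun p => -(1 / 1000) + 22 / 100 - (phi^[N + 2] (phi^[N] p)).2)
      (-(1 / 1000)) (22 / 100) ∧
    ∀ K ∈ ({R, R'} : Set CurvRect), K.region = Rset N i ∧
      K.left = {p ∈ Rset N i | p.1 = 18 / 100} ∧
      K.right = {p ∈ Rset N i | 9 / 10 ≤ p.1 ∧ (phi^[N] p).1 = 1001 / 1000} := by
  obtain ⟨L, R, hc, hL, hR⟩ := exists_coords_Rset hN i
  obtain ⟨K, h1, h2, h3, h4⟩ := hc.exists_rect
  obtain ⟨K', h1', h2', h3', h4'⟩ := hc.flip.exists_rect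
  have e1 : {p ∈ Rset N i | p.1 = (L (phi^[N + 2] (phi^[N] p)).2).1} =
      {p ∈ Rset N i | p.1 = 18 / 100} := by
    ext p
    exact and_congr_right fun hp => by rw [hL _ (Rset.height_mem hp)]
  have e2 : {p ∈ Rset N i | p.1 = (R (phi^[N + 2] (phi^[N] p)).2).1} =
      {p ∈ Rset N i | 9 / 10 ≤ p.1 ∧ (phi^[N] p).1 = 1001 / 1000} := by
    ext p
    refine and_congr_right fun hp => ?_
    have hm := Rset.height_mem hp
    constructor
    · intro h
      rw [hc.inj p hp _ (hc.right_mem _ hm) h (hc.right_level _ hm).symm]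
      exact hR _ hm
    · rintro ⟨h5, h6⟩
      rw [← Rset.eq_of_end hN hp (hc.right_mem _ hm) h5 (hR _ hm).1
        (by rw [h6, (hR _ hm).2]) (hc.right_level _ hm).symm]
  refine ⟨K, K', h2, h2', ?_⟩
  rintro M (rfl | rfl)
  · exact ⟨h1, h3.trans e1, h4.trans e2⟩
  · simp only [sub_sub_cancel] at h3' h4'
    exact ⟨h1', h3'.trans e1, h4'.trans e2⟩

lemma box_half_lt {i : Fin 2} {q : ℝ × ℝ} (hq : q ∈ box i) : 1 / 2 < q.1 := by
  fin_cases i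
  · have := (mem_box_zero.1 hq).1; linarith
  · have := (mem_box_one.1 hq).1; linarith

lemma box'_half_lt {i : Fin 2} {q : ℝ × ℝ} (hq : q ∈ box' i) : 1 / 2 < q.1 := by
  fin_cases i
  · have : 9 / 10 ≤ q.1 := hq.1
    linarith
  · have : 7 / 10 ≤ q.1 := hq.1
    linarith

/-- The image of `Rset` under the return map as a rectangle. It is obtained from `Pset`, because
`phi^[N]` is not injective on `Rset`. -/
lemma exists_rect_image {N : ℕ} (hN : IsLong N) (i : Fin 2) : ∃ C : CurvRect,
    C.region = phi^[N + 2] '' Rset N i ∧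
    C.IsHeight (fun p => (phi^[N] p).2) (-(1 / 1000)) (22 / 100) := by
  obtain ⟨L, R, hc⟩ := exists_coords_Pset hN i
  obtain ⟨K, h1, h2, -⟩ := hc.exists_rect
  have hP : ∀ q ∈ K.region, 1 / 2 < q.1 ∧ 1 / 2 < (phi q).1 := fun q hq => by
    rw [h1, mem_Pset hN] at hq
    exact ⟨box_half_lt hq.2.1.1, box'_half_lt (phi_mem_box' hq.2.1.1 hq.2.1.2.1)⟩
  refine ⟨K.map phi^[2] (contDiff_phi_iterate 2) (fun p hp q hq e => ?_) (fun p hp v hv => ?_),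
    ?_, fun s hs t ht => h2 s hs t ht⟩
  · exact phi_injOn (hP p hp).1 (hP q hq).1 (phi_injOn (hP p hp).2 (hP q hq).2 e)
  · have : tang 2 p v = 0 := hv
    rw [tang_succ, tang_one, Function.iterate_one] at this
    exact phiLin_eq_zero (phiLin_det _ (hP p hp).1).ne'
      (phiLin_eq_zero (phiLin_det _ (hP p hp).2).ne' this)
  · change (fun p => phi^[2] (K.param p)) '' unitSquare = _
    rw [← image_image phi^[2] K.param]
    change phi^[2] '' K.region = _
    rw [h1, Pset, image_image]
    refine image_congr fun p _ => ?_
    exact (iterate_add_two N p).symm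

/-- Returning points land in `Q` away from its left and right edges. -/
lemma mem_image_Rset {N : ℕ} {i : Fin 2} {z : ℝ × ℝ} (hz : z ∈ phi^[N + 2] '' Rset N i) :
    z ∈ Qset N ∧ 193 / 1000 ≤ z.1 ∧ z.1 ≤ 1 + 1 / 1000 := by
  obtain ⟨p, hp, rfl⟩ := hz
  refine ⟨hp.2.2, ?_⟩
  rw [iterate_add_two]
  exact return_fst_bounds (Rset.returns hp) hp.1.2.2.1

lemma image_Rset_zero {N : ℕ} {z : ℝ × ℝ} (hz : z ∈ phi^[N + 2] '' Rset N 0) : 9 / 10 ≤ z.1 := by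
  obtain ⟨p, hp, rfl⟩ := hz
  rw [iterate_add_two]
  exact (return_zero hp.2.1 hp.1.2.2.1 (Rset.returns hp).2.1).1

lemma image_Rset_one {N : ℕ} {z : ℝ × ℝ} (hz : z ∈ phi^[N + 2] '' Rset N 1) :
    193 / 1000 ≤ z.1 ∧ z.1 ≤ 262 / 1000 := by
  obtain ⟨p, hp, rfl⟩ := hz
  rw [iterate_add_two]
  exact return_one hp.2.1 hp.1.2.2.1 (Rset.returns hp).2.1

lemma disjoint_image_Rset (N : ℕ) :
    Disjoint (phi^[N + 2] '' Rset N 0) (phi^[N + 2] '' Rset N 1) :=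
  disjoint_left.2 fun z h0 h1 => by linarith [image_Rset_zero h0, (image_Rset_one h1).2]

/-- Points of `Q` that return to `Q` do so through one of the two windows. -/
lemma mem_Rset_of_return {N : ℕ} (hN : IsLong N) {p : ℝ × ℝ} (hp : p ∈ Qset N)
    (h : phi^[N + 2] p ∈ Qset N) : p ∈ Rset N 0 ∨ p ∈ Rset N 1 := by
  have hs : phi (phi (phi^[N] p)) ∈ strip := by
    rw [← iterate_add_two]; exact h.1.1
  rcases box_of_return (hp.1.end_fst_ge hN hp.2.2.2.2) hp.2.2.1 hp.2.2.2.1 hp.2.2.2.2 hs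
    with hb | hb
  · exact Or.inl ⟨hp, hb, h⟩
  · exact Or.inr ⟨hp, hb, h⟩

/-- `Rset` does not meet the bottom and top edges of `Q`. -/
lemma Rset_height_ne {N : ℕ} {i : Fin 2} {p : ℝ × ℝ} (hp : p ∈ Rset N i) :
    (phi^[N] p).2 ≠ -(1 / 1000) ∧ (phi^[N] p).2 ≠ 22 / 100 := by
  obtain ⟨h1, h2⟩ := Rset.returns hp
  fin_cases i
  · have := abs_le.1 (abs_snd_le_of_return h1 h2.1).2
    constructor <;> intro e <;> rw [e] at this <;> norm_num at this
  · obtain ⟨-, -, h3, h4⟩ := mem_box_one.1 h1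
    constructor <;> intro e <;> linarith

lemma crossesVertically_image {N : ℕ} (hN : IsLong N) {i : Fin 2} {Q C : CurvRect}
    (hQ : Q.region = Qset N) (hQh : Q.IsHeight (fun p => (phi^[N] p).2) (-(1 / 1000)) (22 / 100))
    (hQl : Q.left = {p ∈ Qset N | p.1 = 18 / 100})
    (hQr : Q.right = {p ∈ Qset N | 9 / 10 ≤ p.1 ∧ (phi^[N] p).1 = 1001 / 1000})
    (hC : C.region = phi^[N + 2] '' Rset N i)
    (hCh : C.IsHeight (fun p => (phi^[N] p).2) (-(1 / 1000)) (22 / 100)) :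
    CrossesVertically C Q := by
  have hsub : C.region ⊆ Q.region := by
    rw [hC, hQ]; exact fun z hz => (mem_image_Rset hz).1
  have hne : (-(1 / 1000) : ℝ) ≠ 22 / 100 := by norm_num
  have h01 : (0 : ℝ) ∈ Icc (0 : ℝ) 1 := ⟨le_rfl, zero_le_one⟩
  have h11 : (1 : ℝ) ∈ Icc (0 : ℝ) 1 := ⟨zero_le_one, le_rfl⟩
  have hβ : (22 / 100 - -(1 / 1000) : ℝ) ≠ 0 := by norm_num
  have tr : ∀ s ∈ Icc (0 : ℝ) 1, ∀ t ∈ Icc (0 : ℝ) 1,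
      IsRegularArc (fun x => C.param (s, x)) → IsRegularArc (fun x => Q.param (x, t)) →
      ArcsTransverse (fun x => C.param (s, x)) (fun x => Q.param (x, t)) := fun s hs t ht r1 r2 =>
    arcsTransverse_of_level r1 r2 (contDiff_snd_iterate N) hβ (fun x hx => hCh s hs x hx)
      (fun x hx => hQh x hx t ht)
  refine ⟨hsub, ?_, ?_, ?_, ?_, tr 0 h01 0 h01 C.regular_left Q.regular_bottom,
    tr 0 h01 1 h11 C.regular_left Q.regular_top, tr 1 h11 0 h01 C.regular_right Q.regular_bottom,
    tr 1 h11 1 h11 C.regular_right Q.regular_top⟩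
  · rw [hCh.bottom_eq hne, hQh.bottom_eq hne]
    ext z
    exact ⟨fun h => ⟨h.1, h.2.2⟩, fun h => ⟨h.1, hsub h.1, h.2⟩⟩
  · rw [hCh.top_eq hne, hQh.top_eq hne]
    ext z
    exact ⟨fun h => ⟨h.1, h.2.2⟩, fun h => ⟨h.1, hsub h.1, h.2⟩⟩
  · rw [hC, hQl]
    refine disjoint_left.2 fun z hz h => ?_
    have := (mem_image_Rset hz).2.1
    rw [h.2] at this
    norm_num at this
  · rw [hC, hQr]
    refine disjoint_left.2 fun z hz h => ?_
    obtain ⟨h1, -, h3⟩ := mem_image_Rset hz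
    exact absurd h.2.2 (h1.1.end_fst_lt hN h1.2.2.2.1 h3).ne

lemma crossesHorizontally_Rset {N : ℕ} {i : Fin 2} {Q R : CurvRect}
    (hQ : Q.region = Qset N) (hQh : Q.IsHeight (fun p => (phi^[N] p).2) (-(1 / 1000)) (22 / 100))
    (hQl : Q.left = {p ∈ Qset N | p.1 = 18 / 100})
    (hQr : Q.right = {p ∈ Qset N | 9 / 10 ≤ p.1 ∧ (phi^[N] p).1 = 1001 / 1000})
    (hR : R.region = Rset N i) (hRl : R.left = {p ∈ Rset N i | p.1 = 18 / 100})
    (hRr : R.right = {p ∈ Rset N i | 9 / 10 ≤ p.1 ∧ (phi^[N] p).1 = 1001 / 1000}) :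
    CrossesHorizontally R Q := by
  have hne : (-(1 / 1000) : ℝ) ≠ 22 / 100 := by norm_num
  refine ⟨?_, ?_, ?_, ?_, ?_⟩
  · rw [hR, hQ]; exact fun p hp => hp.1
  · rw [hR, hQl, hRl]
    ext p
    exact ⟨fun h => ⟨h.1, h.2.2⟩, fun h => ⟨h.1, h.1.1, h.2⟩⟩
  · rw [hR, hQr, hRr]
    ext p
    exact ⟨fun h => ⟨h.1, h.2.2⟩, fun h => ⟨h.1, h.1.1, h.2⟩⟩
  · rw [hR, hQh.bottom_eq hne]
    exact disjoint_left.2 fun p hp h => (Rset_height_ne hp).1 h.2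
  · rw [hR, hQh.top_eq hne]
    exact disjoint_left.2 fun p hp h => (Rset_height_ne hp).2 h.2

/-- Images of level sets under the return map. -/
lemma image_level {N : ℕ} {i : Fin 2} {K C : CurvRect} (hK : K.region = Rset N i)
    (hC : C.region = phi^[N + 2] '' Rset N i) {S T : ℝ → Prop}
    (h : ∀ c, S c ↔ T c) :
    phi^[N + 2] '' {p ∈ K.region | S (phi^[N + 2] (phi^[N] p)).2} =
      {z ∈ C.region | T (phi^[N] z).2} := by
  rw [hK, hC]
  have e : ∀ p, phi^[N] (phi^[N + 2] p) = phi^[N + 2] (phi^[N] p) := fun p => by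
    rw [iterate_add_two]; rfl
  ext z
  constructor
  · rintro ⟨p, ⟨hp, hs⟩, rfl⟩
    exact ⟨mem_image_of_mem _ hp, by rw [e]; exact (h _).1 hs⟩
  · rintro ⟨⟨p, hp, rfl⟩, hs⟩
    rw [e] at hs
    exact ⟨p, ⟨hp, (h _).2 hs⟩, rfl⟩

theorem exists_horseshoe {N : ℕ} (hN : IsLong N) {Q : CurvRect}
    (hQ : Q.region = Qset N) (hQh : Q.IsHeight (fun p => (phi^[N] p).2) (-(1 / 1000)) (22 / 100))
    (hQl : Q.left = {p ∈ Qset N | p.1 = 18 / 100})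
    (hQr : Q.right = {p ∈ Qset N | 9 / 10 ≤ p.1 ∧ (phi^[N] p).1 = 1001 / 1000}) :
    ∃ C₀ C₁ R₀ R₁ : CurvRect, IsHorseshoe phi^[N + 2] Q C₀ C₁ R₀ R₁ := by
  obtain ⟨C₀, c1, c2⟩ := exists_rect_image hN 0
  obtain ⟨C₁, d1, d2⟩ := exists_rect_image hN 1
  obtain ⟨R₀, _, r1, _, r2⟩ := exists_rect_Rset hN 0
  obtain ⟨_, R₁, _, s1, s2⟩ := exists_rect_Rset hN 1
  obtain ⟨r2, r3, r4⟩ := r2 R₀ (by simp)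
  obtain ⟨s2, s3, s4⟩ := s2 R₁ (by simp)
  have hne : (-(1 / 1000) : ℝ) ≠ 22 / 100 := by norm_num
  have hdis := disjoint_left.1 (disjoint_image_Rset N)
  refine ⟨C₀, C₁, R₀, R₁, ?_, ?_, crossesVertically_image hN hQ hQh hQl hQr c1 c2,
    crossesVertically_image hN hQ hQh hQl hQr d1 d2, ?_, ?_,
    crossesHorizontally_Rset hQ hQh hQl hQr r2 r3 r4,
    crossesHorizontally_Rset hQ hQh hQl hQr s2 s3 s4, ?_, ?_, ?_, ?_⟩
  · rw [hQ, c1, d1]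
    ext z
    constructor
    · rintro ⟨⟨p, hp, rfl⟩, hz⟩
      rcases mem_Rset_of_return hN hp hz with h | h
      · exact Or.inl (mem_image_of_mem _ h)
      · exact Or.inr (mem_image_of_mem _ h)
    · rintro (h | h)
      · exact ⟨image_mono (fun p hp => hp.1) h, (mem_image_Rset h).1⟩
      · exact ⟨image_mono (fun p hp => hp.1) h, (mem_image_Rset h).1⟩
  · rw [c1, d1]; exact disjoint_image_Rset N
  · rw [hQ, c1, r2]
    ext p
    constructor
    · rintro ⟨hp, hz⟩
      rcases mem_Rset_of_return hN hp (mem_image_Rset hz).1 with h | h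
      · exact h
      · exact absurd (mem_image_of_mem _ h) (hdis hz)
    · exact fun h => ⟨h.1, mem_image_of_mem _ h⟩
  · rw [hQ, d1, s2]
    ext p
    constructor
    · rintro ⟨hp, hz⟩
      rcases mem_Rset_of_return hN hp (mem_image_Rset hz).1 with h | h
      · exact absurd hz (hdis (mem_image_of_mem _ h))
      · exact h
    · exact fun h => ⟨h.1, mem_image_of_mem _ h⟩
  · rw [r1.bottom_eq hne, c2.bottom_eq hne]
    exact image_level r2 c1 (S := fun c => c = _) (T := fun c => c = _) fun c => Iff.rfl
  · rw [r1.top_eq hne, c2.top_eq hne]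
    exact image_level r2 c1 (S := fun c => c = _) (T := fun c => c = _) fun c => Iff.rfl
  · rw [s1.bottom_eq hne, d2.top_eq hne]
    refine image_level s2 d1 (S := fun c => -(1 / 1000) + 22 / 100 - c = -(1 / 1000))
      (T := fun c => c = 22 / 100) fun c => ?_
    constructor <;> intro h <;> linarith
  · rw [s1.top_eq hne, d2.bottom_eq hne]
    refine image_level s2 d1 (S := fun c => -(1 / 1000) + 22 / 100 - c = 22 / 100)
      (T := fun c => c = -(1 / 1000)) fun c => ?_
    constructor <;> intro h <;> linarith

/-! ### The shapes of the images of `Q` -/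

/-- Since the fold makes `phi^[N]` non-injective on `Q`, its image is parametrized directly, as the
region between two graphs. -/
lemma isTopologicalSquare_image {N : ℕ} (hN : IsLong N) :
    IsTopologicalSquare (phi^[N] '' Qset N) := by
  set f : ℝ × ℝ → ℝ × ℝ := fun q =>
    (kap N (-(1 / 1000) + q.2 * (221 / 1000)) +
      q.1 * (1001 / 1000 - kap N (-(1 / 1000) + q.2 * (221 / 1000))),
      -(1 / 1000) + q.2 * (221 / 1000)) with hf
  have hm : ∀ q ∈ unitSquare, -(1 / 1000) + q.2 * (221 / 1000) ∈ heights := by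
    rintro q ⟨-, h1, h2⟩
    constructor <;> linarith
  have hc : ContinuousOn f unitSquare := by
    have h2 : ContinuousOn (fun q : ℝ × ℝ => -(1 / 1000) + q.2 * (221 / 1000)) unitSquare := by
      fun_prop
    have h1 := (continuousOn_kap hN).comp h2 hm
    exact (h1.add (continuousOn_fst.mul (continuousOn_const.sub h1))).prodMk h2
  have hi : InjOn f unitSquare := by
    rintro ⟨s, t⟩ hq ⟨s', t'⟩ hq' e
    obtain ⟨e1, e2⟩ := Prod.mk.inj e
    simp only at e1 e2
    obtain rfl : t = t' := by linarith
    have := sub_pos.2 (kap_lt hN (hm _ hq))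
    obtain rfl : s = s' := mul_right_cancel₀ this.ne' (by linarith)
    rfl
  have himg : f '' unitSquare = phi^[N] '' Qset N := by
    rw [image_Qset hN]
    ext q
    constructor
    · rintro ⟨p, hp, rfl⟩
      have := sub_pos.2 (kap_lt hN (hm _ hp))
      have hp' := hm p hp
      obtain ⟨⟨h1, h2⟩, -⟩ := hp
      exact ⟨hp', by simp only [hf]; nlinarith, by simp only [hf]; nlinarith⟩
    · rintro ⟨h1, h2, h3⟩
      have hk := sub_pos.2 (kap_lt hN h1)
      have e : -(1 / 1000) + (q.2 + 1 / 1000) / (221 / 1000) * (221 / 1000) = q.2 := by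
        rw [div_mul_cancel₀ _ (by norm_num)]; ring
      refine ⟨((q.1 - kap N q.2) / (1001 / 1000 - kap N q.2), (q.2 + 1 / 1000) / (221 / 1000)),
        ⟨⟨div_nonneg (by linarith) hk.le, (div_le_one hk).2 (by linarith)⟩,
          div_nonneg (by linarith [h1.1]) (by norm_num),
          (div_le_one (by norm_num)).2 (by linarith [h1.2])⟩, ?_⟩
      simp only [hf, e]
      rw [div_mul_cancel₀ _ hk.ne']
      ext <;> simp
  rw [← himg]
  exact nonempty_homeomorph_image isCompact_unitSquare hc hi

lemma image_bounds {N : ℕ} (hN : IsLong N) {q : ℝ × ℝ} (hq : q ∈ phi^[N] '' Qset N) :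
    93 / 100 ≤ q.1 ∧ q.1 ≤ 1001 / 1000 ∧ -(1 / 1000) ≤ q.2 ∧ q.2 ≤ 22 / 100 := by
  rw [image_Qset hN] at hq
  exact ⟨(kap_ge hN hq.1).trans hq.2.1, hq.2.2, hq.1.1, hq.1.2⟩

lemma mem_interior_image {N : ℕ} (hN : IsLong N) {y : ℝ} (hy : y ∈ Icc (0 : ℝ) 0.2) :
    ((1 : ℝ), y) ∈ interior (phi^[N] '' Qset N) := by
  obtain ⟨h0, h1⟩ := hy
  have h1' : y ≤ 2 / 10 := by norm_num at h1 ⊢; linarith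
  have hk := kap_lt_one hN h0 (by linarith)
  rw [mem_interior_iff_mem_nhds, Metric.mem_nhds_iff]
  have hε : 0 < min ((1 - kap N y) / 4) (1 / 2000) := lt_min (by linarith) (by norm_num)
  refine ⟨_, hε, fun q hq => ?_⟩
  rw [Metric.mem_ball, Prod.dist_eq, max_lt_iff, Real.dist_eq, Real.dist_eq] at hq
  obtain ⟨q1, q2⟩ := hq
  obtain ⟨a1, a2⟩ := lt_min_iff.1 q1
  obtain ⟨b1, b2⟩ := lt_min_iff.1 q2
  have c1 := abs_lt.1 a1
  have c2 := abs_lt.1 a2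
  have c3 := abs_lt.1 b2
  simp only at c1 c2 c3 b1
  have hq2 : q.2 ∈ heights := ⟨by linarith, by linarith⟩
  have := (abs_le.1 (kap_lipschitz hN (h := y) ⟨by linarith, by linarith⟩ hq2)).2
  rw [image_Qset hN]
  exact ⟨hq2, by linarith, by linarith⟩

lemma isGreatest_image {N : ℕ} (hN : IsLong N) :
    IsGreatest (Prod.snd '' (phi^[N] '' Qset N)) (0.22 : ℝ) := by
  have e : (0.22 : ℝ) = 22 / 100 := by norm_num
  rw [e]
  refine ⟨⟨(1001 / 1000, 22 / 100), ?_, rfl⟩, ?_⟩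
  · have hh : (22 / 100 : ℝ) ∈ heights := by constructor <;> norm_num
    rw [image_Qset hN]
    exact ⟨hh, (kap_lt hN hh).le, le_rfl⟩
  · rintro _ ⟨q, hq, rfl⟩
    exact (image_bounds hN hq).2.2.2

lemma phi_image_half {N : ℕ} (hN : IsLong N) {q : ℝ × ℝ} (hq : q ∈ phi^[N] '' Qset N) :
    7 / 10 ≤ (phi q).1 := by
  obtain ⟨h1, h2, h3, h4⟩ := image_bounds hN hq
  rw [phi_fst]
  nlinarith

lemma injOn_phi_image {N : ℕ} (hN : IsLong N) : InjOn phi (phi^[N] '' Qset N) :=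
  phi_injOn.mono fun q hq => by
    have := (image_bounds hN hq).1
    simp only [mem_ofPred_eq]; linarith

lemma injOn_phi_two_image {N : ℕ} (hN : IsLong N) : InjOn phi^[2] (phi^[N] '' Qset N) :=
  fun p hp q hq e => injOn_phi_image hN hp hq (phi_injOn
    (by have := phi_image_half hN hp; simp only [mem_ofPred_eq]; linarith)
    (by have := phi_image_half hN hq; simp only [mem_ofPred_eq]; linarith) e)

lemma isCompact_image_Qset (N : ℕ) : IsCompact (phi^[N] '' Qset N) :=
  (isCompact_Qset N).image (continuous_iterate N)

lemma image_iterate_succ (N : ℕ) (S : Set (ℝ × ℝ)) :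
    phi^[N + 1] '' S = phi '' (phi^[N] '' S) := by
  rw [image_image]
  exact image_congr fun p _ => Function.iterate_succ_apply' phi N p

lemma isTopologicalSquare_image_succ {N : ℕ} (hN : IsLong N) :
    IsTopologicalSquare (phi^[N + 1] '' Qset N) := by
  obtain ⟨e⟩ := isTopologicalSquare_image hN
  obtain ⟨e'⟩ := nonempty_homeomorph_image (isCompact_image_Qset N) continuous_phi.continuousOn
    (injOn_phi_image hN)
  rw [image_iterate_succ]
  exact ⟨e'.trans e⟩

lemma isTopologicalSquare_image_add_two {N : ℕ} (hN : IsLong N) :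
    IsTopologicalSquare (phi^[N + 2] '' Qset N) := by
  obtain ⟨e⟩ := isTopologicalSquare_image hN
  obtain ⟨e'⟩ := nonempty_homeomorph_image (isCompact_image_Qset N)
    (continuous_iterate 2).continuousOn (injOn_phi_two_image hN)
  have : phi^[N + 2] '' Qset N = phi^[2] '' (phi^[N] '' Qset N) := by
    rw [image_image]
    exact image_congr fun p _ => iterate_add_two N p
  rw [this]
  exact ⟨e'.trans e⟩

/-- `phi` is a local diffeomorphism to the right of the fold. -/
lemma phi_mem_interior {S : Set (ℝ × ℝ)} {q : ℝ × ℝ} (hq : q ∈ interior S) (h : 1 / 2 < q.1) :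
    phi q ∈ interior (phi '' S) := by
  have hd : HasStrictFDerivAt phi (fderiv ℝ phi q) q :=
    (contDiff_phi (n := 1)).contDiffAt.hasStrictFDerivAt (by simp)
  have hinj : Function.Injective (fderiv ℝ phi q).toLinearMap := by
    rw [injective_iff_map_eq_zero]
    intro v hv
    exact phiLin_eq_zero (phiLin_det _ h).ne' (by rw [← fderiv_phi]; exact hv)
  have hr : (fderiv ℝ phi q).range = ⊤ :=
    LinearMap.range_eq_top.2 (LinearMap.injective_iff_surjective.1 hinj)
  rw [mem_interior_iff_mem_nhds, ← hd.map_nhds_eq_of_surj hr]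
  exact image_mem_map (mem_interior_iff_mem_nhds.1 hq)

lemma arc_mem_interior {N : ℕ} (hN : IsLong N) {y : ℝ} (hy : y ∈ Icc (0 : ℝ) 0.2) :
    (1 - y, 5 * (1 - y) * (1 - (1 - y))) ∈ interior (phi^[N + 1] '' Qset N) := by
  have := phi_mem_interior (mem_interior_image hN hy) (by norm_num)
  rw [image_iterate_succ]
  convert this using 1
  ext
  · rw [phi_fst]; ring
  · rw [phi_snd]; ring

/-- Near the edge `x = 1`, the image under `phi` is near the parabola. -/
lemma phi_near_parabola {q : ℝ × ℝ} (h1 : 93 / 100 ≤ q.1) (h2 : q.1 ≤ 1001 / 1000)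
    (h3 : -(1 / 1000) ≤ q.2) (h4 : q.2 ≤ 22 / 100) : ∃ x ∈ Icc (0 : ℝ) 1,
      ((phi q).1 - x) ^ 2 + ((phi q).2 - 5 * x * (1 - x)) ^ 2 ≤ 0.1 ^ 2 := by
  obtain ⟨X, h⟩ := q
  simp only at h1 h2 h3 h4
  rw [phi_fst, phi_snd]
  simp only
  rcases le_total 0 h with h0 | h0
  -- On the line `X = 1` the map `phi` takes height `h` to the point of the parabola over `1 - h`.
  · refine ⟨1 - h, ⟨by linarith, by linarith⟩, ?_⟩
    have e : (1 - X * (99 / 100 * (1 - X) + h) - (1 - h)) ^ 2 +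
        (5 * h * (X - h) - 5 * (1 - h) * (1 - (1 - h))) ^ 2 =
        (1 - X) ^ 2 * ((99 / 100 * X - h) ^ 2 + 25 * h ^ 2) := by ring
    rw [e]
    have b1 : (1 - X) ^ 2 ≤ 49 / 10000 := by nlinarith
    have b2 : (99 / 100 * X - h) ^ 2 + 25 * h ^ 2 ≤ 2 := by nlinarith
    calc (1 - X) ^ 2 * ((99 / 100 * X - h) ^ 2 + 25 * h ^ 2) ≤ 49 / 10000 * 2 :=
          mul_le_mul b1 b2 (by positivity) (by norm_num)
      _ ≤ _ := by norm_num
  · refine ⟨1, ⟨zero_le_one, le_rfl⟩, ?_⟩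
    have b1 : |99 / 100 * (1 - X) + h| ≤ 8 / 100 := abs_le.2 ⟨by linarith, by linarith⟩
    have b2 : |h * (X - h)| ≤ 2 / 1000 := by
      rw [abs_le]; constructor <;> nlinarith
    have c1 : |1 - X * (99 / 100 * (1 - X) + h) - 1| ≤ 9 / 100 := by
      have : |1 - X * (99 / 100 * (1 - X) + h) - 1| = X * |99 / 100 * (1 - X) + h| := by
        rw [show 1 - X * (99 / 100 * (1 - X) + h) - 1 = -(X * (99 / 100 * (1 - X) + h)) by ring,
          abs_neg, abs_mul, abs_of_nonneg (by linarith)]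
      rw [this]; nlinarith [abs_nonneg (99 / 100 * (1 - X) + h)]
    have c2 : |5 * h * (X - h) - 5 * 1 * (1 - 1)| ≤ 1 / 100 := by
      rw [show 5 * h * (X - h) - 5 * 1 * (1 - 1) = 5 * (h * (X - h)) by ring, abs_mul,
        abs_of_pos (by norm_num)]
      linarith
    have d1 := sq_le_sq' (neg_le_of_abs_le c1) (le_of_abs_le c1)
    have d2 := sq_le_sq' (neg_le_of_abs_le c2) (le_of_abs_le c2)
    norm_num at d1 d2 ⊢
    linarith

lemma phi_snd_sub_fst_le {q : ℝ × ℝ} (h1 : 93 / 100 ≤ q.1) (h2 : q.1 ≤ 1001 / 1000)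
    (h4 : q.2 ≤ 22 / 100) : (phi q).2 - (phi q).1 ≤ 0.1 := by
  have e : (phi q).2 - (phi q).1 = 6 * q.1 * q.2 - 5 * q.2 ^ 2 - 1
      + 99 / 100 * (q.1 * (1 - q.1)) := by
    rw [phi_snd, phi_fst]; ring
  have b1 : q.1 * (1 - q.1) ≤ 7 / 100 * (7 / 10) + (1001 / 1000 - q.1) := by nlinarith
  rw [e]
  norm_num
  nlinarith

lemma phi_diagonal {q : ℝ × ℝ} (h1 : 93 / 100 ≤ q.1) (h2 : q.1 ≤ 1001 / 1000)
    (h3 : -(1 / 1000) ≤ q.2) (h4 : q.2 ≤ 22 / 100) (h : (phi q).1 = (phi q).2) :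
    0 < (phi q).1 ∧ (phi q).1 < 1 := by
  constructor
  · rw [phi_fst]; nlinarith
  · by_contra hge
    push Not at hge
    have hb : 99 / 100 * (1 - q.1) + q.2 ≤ 0 := by
      rw [phi_fst] at hge
      nlinarith
    have hy : (phi q).2 ≤ 1 / 100 := by rw [phi_snd]; nlinarith
    linarith

lemma exists_below_diagonal {N : ℕ} (hN : IsLong N) : ∃ p ∈ phi^[N + 1] '' Qset N, p.2 < p.1 := by
  rw [image_iterate_succ]
  refine ⟨phi (1, 0), mem_image_of_mem _ ?_, ?_⟩
  · exact interior_subset (mem_interior_image hN (y := 0) (by constructor <;> norm_num))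
  · rw [phi_fst, phi_snd]; norm_num

lemma exists_above_diagonal {N : ℕ} (hN : IsLong N) : ∃ p ∈ phi^[N + 1] '' Qset N, p.1 < p.2 := by
  have hh : (22 / 100 : ℝ) ∈ heights := by constructor <;> norm_num
  rw [image_iterate_succ]
  refine ⟨phi (1001 / 1000, 22 / 100), mem_image_of_mem _ ?_, ?_⟩
  · rw [image_Qset hN]
    exact ⟨hh, (kap_lt hN hh).le, le_rfl⟩
  · rw [phi_fst, phi_snd]; norm_num

lemma phi_one_zero : phi (1, 0) = (1, 0) := by
  ext
  · rw [phi_fst]; norm_num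
  · rw [phi_snd]; norm_num

lemma iterate_one_zero (j : ℕ) : phi^[j] (1, 0) = (1, 0) :=
  Function.iterate_fixed phi_one_zero j

lemma one_zero_mem_Qset {N : ℕ} (hN : IsLong N) : ((1 : ℝ), (0 : ℝ)) ∈ Qset N := by
  refine mem_Qset_of_start hN ⟨?_, fun j _ _ => ?_⟩ (by norm_num) (by norm_num) ?_
  · refine ⟨by norm_num, by norm_num, by norm_num⟩
  · rw [iterate_one_zero]; refine ⟨by norm_num, by norm_num, by norm_num⟩
  · rw [iterate_one_zero]; constructor <;> norm_num

/-! ### Existence of orbits with prescribed itinerary -/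

/-- Compactness: if all finite itineraries are realized, so are the bi-infinite ones. -/
theorem exists_full_orbit {X ι : Type*} [TopologicalSpace X] [T2Space X] {f : X → X}
    (hf : Continuous f) {K : ι → Set X} (hK : ∀ i, IsCompact (K i))
    (h : ∀ (a : ℕ → ι) (n : ℕ), ∃ x, ∀ k < n, f^[k] x ∈ K (a k)) (a : ℤ → ι) :
    ∃ ω : ℤ → X, ∀ k, ω k ∈ K (a k) ∧ f (ω k) = ω (k + 1) := by
  have hne : ∀ i, (K i).Nonempty := fun i => by
    obtain ⟨x, hx⟩ := h (fun _ => i) 1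
    exact ⟨x, hx 0 one_pos⟩
  choose y hy using hne
  obtain ⟨ω, h1, h2⟩ := (isCompact_univ_pi fun k => hK (a k)).inter_iInter_nonempty
    (fun k : ℤ => {ω : ℤ → X | f (ω k) = ω (k + 1)})
    (fun k => isClosed_eq (hf.comp (continuous_apply k)) (continuous_apply (k + 1))) (by
      intro u
      -- Finitely many of the orbit relations only involve times up to some `m`; a finite orbit
      -- started at time `-m` satisfies them.
      obtain ⟨m, hm⟩ : ∃ m : ℕ, ∀ k ∈ u, k.natAbs ≤ m :=
        ⟨u.sup Int.natAbs, fun k hk => Finset.le_sup (f := Int.natAbs) hk⟩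
      obtain ⟨x, hx⟩ := h (fun j => a (j - m)) (2 * m + 2)
      refine ⟨fun k => if -m ≤ k ∧ k ≤ m + 1 then f^[(k + m).toNat] x else y (a k), ?_, ?_⟩
      · intro k _
        by_cases hk : -(m : ℤ) ≤ k ∧ k ≤ m + 1
        · simp only [if_pos hk]
          have := hx (k + m).toNat (by omega)
          rwa [show (((k + m).toNat : ℕ) : ℤ) - m = k by omega] at this
        · simp only [if_neg hk]; exact hy _
      · simp only [mem_iInter, mem_ofPred_eq]
        intro k hk
        have := hm k hk
        rw [if_pos (by omega), if_pos (by omega), ← Function.iterate_succ_apply' f]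
        congr 2
        omega)
  exact ⟨ω, fun k => ⟨h1 k (mem_univ k), mem_iInter.1 h2 k⟩⟩

/-- The graph of `X` is a nearly vertical curve in the image of `Q`. -/
def IsVerticalCurve (N : ℕ) (X : ℝ → ℝ) : Prop :=
  (∀ h ∈ heights, kap N h ≤ X h ∧ X h ≤ 1001 / 1000) ∧
    ∀ h ∈ heights, ∀ h' ∈ heights, |X h' - X h| ≤ 7 / 5 * |h' - h|

lemma IsVerticalCurve.continuousOn {N : ℕ} {X : ℝ → ℝ} (hX : IsVerticalCurve N X) :
    ContinuousOn X heights := by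
  have : LipschitzOnWith (7 / 5) X heights :=
    LipschitzOnWith.of_dist_le_mul fun x hx y hy => by
      rw [Real.dist_eq, Real.dist_eq]
      simpa using hX.2 y hy x hx
  exact this.continuousOn

/-- The graph transform: the part of a vertical curve in a window is stretched over a full
vertical curve. -/
lemma IsVerticalCurve.transform {N : ℕ} (hN : IsLong N) {X : ℝ → ℝ} (hX : IsVerticalCurve N X)
    (i : Fin 2) : ∃ X', IsVerticalCurve N X' ∧ ∀ c ∈ heights, ∃ h ∈ heights,
      (X h, h) ∈ Pset N i ∧ phi^[N + 2] (X h, h) = (X' c, c) := by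
  have ex : ∀ c, ∃ h, c ∈ heights → h ∈ bracket i ∧ Returns N i (X h, h) ∧
      (phi^[N + 2] (X h, h)).2 = c := fun c => by
    by_cases hc : c ∈ heights
    · have hb : ∀ h ∈ bracket i, (X h, h) ∈ box i := fun h hh =>
        mem_box_of_le hh (hX.1 h (bracket_subset i hh)).2
          ((kap_ge hN (bracket_subset i hh)).trans (hX.1 h (bracket_subset i hh)).1)
      obtain ⟨h, hh, k1, k2⟩ :=
        exists_crossing hN (hX.continuousOn.mono (bracket_subset i)) hb hc
      exact ⟨h, fun _ => ⟨hh, ⟨hb h hh, k1⟩, k2⟩⟩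
    · exact ⟨0, fun h => absurd h hc⟩
  choose g hg using ex
  have hP : ∀ c ∈ heights, (X (g c), g c) ∈ Pset N i := fun c hc => by
    obtain ⟨g1, g2, g3⟩ := hg c hc
    obtain ⟨k1, k2⟩ := hX.1 _ (bracket_subset i g1)
    exact (mem_Pset hN).2 ⟨⟨bracket_subset i g1, k1, k2⟩, g2, by rw [g3]; exact hc⟩
  refine ⟨fun c => (phi^[N + 2] (X (g c), g c)).1, ⟨fun c hc => ?_, fun c hc c' hc' => ?_⟩,
    fun c hc => ⟨g c, bracket_subset i (hg c hc).1, hP c hc, Prod.ext rfl (hg c hc).2.2⟩⟩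
  · obtain ⟨⟨q1, q2, q3⟩, q4, q5⟩ := (mem_Pset hN).1 (hP c hc)
    have hQ := q4.mem_Qset hN q3 q5
    have := mem_image_of_mem phi^[N] hQ
    rw [image_Qset hN] at this
    have e : (phi^[N] (phi (phi (X (g c), g c)))).2 = c := (hg c hc).2.2
    rw [mem_ofPred_eq, e] at this
    exact this.2
  · obtain ⟨g1, g2, g3⟩ := hg c hc
    obtain ⟨k1, k2, k3⟩ := hg c' hc'
    have hcone : Cone (7 / 5) ((X (g c'), g c') - (X (g c), g c)) :=
      hX.2 _ (bracket_subset i g1) _ (bracket_subset i k1)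
    have h2 := (g2.2.cone_sub hN.two_le k2.2
      (ret_sub g2.1 k2.1 g2.2.1 k2.2.1 hcone).1).1
    unfold Cone at h2
    rw [iterate_add_two'] at g3 k3
    rwa [Prod.fst_sub, Prod.snd_sub, g3, k3] at h2

/-- Every finite itinerary is realized on every vertical curve. -/
lemma IsVerticalCurve.exists_itinerary {N : ℕ} (hN : IsLong N) (n : ℕ) {X : ℝ → ℝ}
    (hX : IsVerticalCurve N X) (a : ℕ → Fin 2) :
    ∃ h ∈ heights, ∀ k < n, (phi^[N + 2])^[k] (X h, h) ∈ Pset N (a k) := by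
  induction n generalizing X a with
  | zero => exact ⟨0, by constructor <;> norm_num, fun k hk => absurd hk (by omega)⟩
  | succ n ih =>
    obtain ⟨X', h1, h2⟩ := hX.transform hN (a 0)
    obtain ⟨c, hc, h3⟩ := ih h1 fun k => a (k + 1)
    obtain ⟨h, hh, h4, h5⟩ := h2 c hc
    refine ⟨h, hh, fun k hk => ?_⟩
    cases k with
    | zero => exact h4
    | succ k =>
      rw [Function.iterate_succ_apply, h5]
      exact h3 k (by omega)

/-- A full orbit of the return map with itinerary `a`. -/
def IsOrbit (N : ℕ) (a : ℤ → Fin 2) (ω : ℤ → ℝ × ℝ) : Prop :=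
  ∀ k, ω k ∈ Rset N (a k) ∧ phi^[N + 2] (ω k) = ω (k + 1)

/-- Every itinerary is realized. The orbit is found at the ends of the passages, in `Pset`, and
moved on by two steps. -/
theorem exists_isOrbit {N : ℕ} (hN : IsLong N) (a : ℤ → Fin 2) : ∃ ω, IsOrbit N a ω := by
  have hkap : IsVerticalCurve N (kap N) :=
    ⟨fun h hh => ⟨le_rfl, (kap_lt hN hh).le⟩, fun h hh h' hh' => kap_lipschitz hN hh hh'⟩
  obtain ⟨η, hη⟩ := exists_full_orbit (continuous_iterate (N + 2)) (isCompact_Pset N)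
    (fun a n => by
      obtain ⟨h, -, hh⟩ := hkap.exists_itinerary hN n a
      exact ⟨_, hh⟩) a
  have e : ∀ k, phi^[N] (phi (phi (η (k - 1)))) = η k := fun k => by
    have := (hη (k - 1)).2
    rwa [sub_add_cancel] at this
  refine ⟨fun k => phi (phi (η (k - 1))), fun k => ⟨?_, ?_⟩⟩
  · obtain ⟨⟨-, -, q3⟩, q4, q5⟩ := (mem_Pset hN).1 (hη (k - 1)).1
    obtain ⟨-, r4, r5⟩ := (mem_Pset hN).1 (hη k).1
    exact mem_Rset hN (q4.mem_Qset hN q3 q5) (by rw [e]; exact r4) (by rw [e]; exact r5)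
  · simp only
    rw [iterate_add_two, e, add_sub_cancel_right]

/-! ### Uniqueness of orbits with prescribed itinerary -/

/-- Horizontal contraction along a passage of two orbits whose difference stays outside the vertical
cone, with `a` and `b` the sizes of its horizontal and vertical components. By `h1` the bound on `b
/ a` improves geometrically as one goes back in time from the end, so that by `h2` the factors of
`a` are `497/500` up to errors that decay geometrically backwards; their product is absorbed in the
weights `exp (6 * (3/5) ^ (N - j))`, and `729 = 3 ^ 6` bounds `exp 6`. -/
lemma contraction_sequence {N : ℕ} (hN : 1 ≤ N) {a b : ℕ → ℝ} (ha : ∀ j, 0 ≤ a j)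
    (h1 : ∀ j, 1 ≤ j → j < N → 61 / 20 * b j ≤ b (j + 1) + 11 / 10 * (3 / 5) ^ (N - j) * a j)
    (h2 : ∀ j, 1 ≤ j → j < N →
      a (j + 1) ≤ (497 / 500 + 22 / 100 * (3 / 10) ^ (N - j)) * a j + 501 / 500 * b j)
    (h3 : ∀ j < N, 3 * b j ≤ a j) (h4 : b N ≤ a N) :
    a N ≤ 729 * (497 / 500) ^ (N - 1) * a 1 := by
  have hb : ∀ k j, 1 ≤ j → j + k = N → b j ≤ 2 * (3 / 5 : ℝ) ^ k * a j := by
    intro k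
    induction k with
    | zero =>
      intro j hj hjN
      obtain rfl : j = N := by omega
      rw [pow_zero]; linarith [ha j]
    | succ k ih =>
      intro j hj hjN
      have e1 := ih (j + 1) (by omega) (by omega)
      have e2 := h1 j hj (by omega)
      have e3 := h2 j hj (by omega)
      have e4 := h3 j (by omega)
      rw [show N - j = k + 1 by omega] at e2 e3
      have e5 : (3 / 10 : ℝ) ^ (k + 1) ≤ 3 / 10 := by
        rw [pow_succ]
        have : (3 / 10 : ℝ) ^ k ≤ 1 := pow_le_one₀ (by norm_num) (by norm_num)
        linarith
      have e6 : a (j + 1) ≤ 14 / 10 * a j := by nlinarith [ha j]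
      have e7 : (0 : ℝ) < (3 / 5) ^ k := by positivity
      have e8 : b (j + 1) ≤ 2 * (3 / 5 : ℝ) ^ k * (14 / 10 * a j) :=
        e1.trans (mul_le_mul_of_nonneg_left e6 (by positivity))
      rw [pow_succ] at e2 ⊢
      nlinarith [mul_nonneg e7.le (ha j)]
  have key : ∀ j, 1 ≤ j → j ≤ N →
      a j ≤ (497 / 500) ^ (j - 1) * Real.exp (6 * (3 / 5) ^ (N - j)) * a 1 := by
    intro j hj
    induction j, hj using Nat.le_induction with
    | base =>
      intro _
      have : 1 ≤ Real.exp (6 * (3 / 5) ^ (N - 1)) := Real.one_le_exp (by positivity)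
      rw [Nat.sub_self, pow_zero, one_mul]
      nlinarith [ha 1]
    | succ j hj ih =>
      intro hjN
      have e1 := ih (by omega)
      have e2 := hb (N - j) j hj (by omega)
      have e3 := h2 j hj (by omega)
      obtain ⟨k, hk⟩ : ∃ k, N - j = k + 1 := ⟨N - j - 1, by omega⟩
      rw [show N - (j + 1) = k by omega]
      rw [hk] at e1 e2 e3
      have e4 : (3 / 10 : ℝ) ^ (k + 1) ≤ (3 / 5) ^ (k + 1) :=
        pow_le_pow_left₀ (by norm_num) (by norm_num) _
      have e5 : a (j + 1) ≤ 497 / 500 * (1 + 4 * (3 / 5) ^ (k + 1)) * a j := by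
        nlinarith [ha j, mul_nonneg (by positivity : (0 : ℝ) ≤ (3 / 5) ^ (k + 1)) (ha j),
          mul_nonneg (sub_nonneg.2 e4) (ha j)]
      have e6 : (1 + 4 * (3 / 5 : ℝ) ^ (k + 1)) * Real.exp (6 * (3 / 5) ^ (k + 1)) ≤
          Real.exp (6 * (3 / 5) ^ k) := by
        have : (6 * (3 / 5) ^ k : ℝ) = 4 * (3 / 5) ^ (k + 1) + 6 * (3 / 5) ^ (k + 1) := by
          rw [pow_succ]; ring
        rw [this, Real.exp_add]
        refine mul_le_mul_of_nonneg_right ?_ (Real.exp_pos _).le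
        linarith [Real.add_one_le_exp (4 * (3 / 5 : ℝ) ^ (k + 1))]
      obtain ⟨l, rfl⟩ : ∃ l, j = l + 1 := ⟨j - 1, by omega⟩
      simp only [Nat.add_sub_cancel] at e1 ⊢
      calc a (l + 1 + 1) ≤ 497 / 500 * (1 + 4 * (3 / 5) ^ (k + 1)) * a (l + 1) := e5
        _ ≤ 497 / 500 * (1 + 4 * (3 / 5) ^ (k + 1)) *
            ((497 / 500) ^ l * Real.exp (6 * (3 / 5) ^ (k + 1)) * a 1) :=
          mul_le_mul_of_nonneg_left e1 (by positivity)
        _ = (497 / 500) ^ (l + 1) *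
            ((1 + 4 * (3 / 5) ^ (k + 1)) * Real.exp (6 * (3 / 5) ^ (k + 1))) * a 1 := by ring
        _ ≤ _ := by
          refine mul_le_mul_of_nonneg_right (mul_le_mul_of_nonneg_left e6 (by positivity)) (ha 1)
  have h6 : Real.exp 6 ≤ 729 := by
    have h7 : Real.exp 6 = Real.exp 1 ^ 6 := by rw [← Real.exp_nat_mul]; norm_num
    rw [h7]
    calc Real.exp 1 ^ 6 ≤ 3 ^ 6 :=
          pow_le_pow_left₀ (Real.exp_pos 1).le (by linarith [Real.exp_one_lt_d9]) 6
      _ = 729 := by norm_num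
  have := key N hN le_rfl
  rw [Nat.sub_self, pow_zero, mul_one] at this
  refine this.trans (mul_le_mul_of_nonneg_right ?_ (ha 1))
  rw [mul_comm]
  exact mul_le_mul_of_nonneg_right h6 (by positivity)

lemma abs_mid_le {p q : ℝ × ℝ} {c : ℝ} (hp : |p.2| ≤ c) (hq : |q.2| ≤ c) : |(mid p q).2| ≤ c := by
  rw [abs_le] at *
  simp only [mid]
  constructor <;> linarith [hp.1, hp.2, hq.1, hq.2]

lemma abs_phiLin_fst (m v : ℝ × ℝ) : |(phiLin m v).1| ≤
    |99 / 100 * (2 * m.1 - 1) - m.2| * |v.1| + |m.1| * |v.2| := by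
  rw [← abs_mul, ← abs_mul]
  exact abs_sub _ _

lemma abs_phiLin_snd (m v : ℝ × ℝ) : |(phiLin m v).2| ≤
    |5 * m.2| * |v.1| + |5 * (m.1 - 2 * m.2)| * |v.2| := by
  rw [← abs_mul, ← abs_mul]
  exact abs_add_le _ _

lemma le_abs_phiLin_snd (m v : ℝ × ℝ) :
    |5 * (m.1 - 2 * m.2)| * |v.2| ≤ |(phiLin m v).2| + |5 * m.2| * |v.1| := by
  rw [← abs_mul, ← abs_mul]
  have := abs_sub (phiLin m v).2 (5 * m.2 * v.1)
  have e : (phiLin m v).2 - 5 * m.2 * v.1 = 5 * (m.1 - 2 * m.2) * v.2 := by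
    simp only [phiLin]; ring
  rwa [e] at this

lemma Rset.block {N : ℕ} {i : Fin 2} {p : ℝ × ℝ} (hp : p ∈ Rset N i) : Block N i p :=
  ⟨hp.1.1, hp.2.1, hp.2.2.1.1⟩

/-- Outside the vertical cone the return map contracts horizontally. -/
lemma Rset.contract {N : ℕ} (hN : IsLong N) {i : Fin 2} {p q : ℝ × ℝ} (hp : p ∈ Rset N i)
    (hq : q ∈ Rset N i) (hp1 : p.1 ≤ 1 + 1 / 1000) (hq1 : q.1 ≤ 1 + 1 / 1000)
    (h : ¬ Cone 3 (phi^[N + 2] q - phi^[N + 2] p)) :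
    |(phi^[N + 2] q - phi^[N + 2] p).1| ≤ 1 / 2 * |(q - p).1| := by
  have hN2 := hN.two_le
  set v : ℕ → ℝ × ℝ := fun j => phi^[j] q - phi^[j] p with hv
  set m : ℕ → ℝ × ℝ := fun j => mid (phi^[j] p) (phi^[j] q) with hm
  have hstep : ∀ j, v (j + 1) = phiLin (m j) (v j) := fun j => secant_succ p q j
  have hmc : ∀ j, 1 ≤ j → j < N → m j ∈ corridor := fun j h1 h2 =>
    mid_corridor (hp.1.1.2 j h1 h2) (hq.1.1.2 j h1 h2)
  have hcN : ¬ Cone (7 / 5) (v N) := by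
    intro hc
    have := (ret_sub hp.2.1 hq.2.1 (Rset.returns hp).2.1 (Rset.returns hq).2.1 hc).1
    rw [← iterate_add_two, ← iterate_add_two] at this
    exact h this
  have hcj : ∀ j < N, ¬ Cone 3 (v j) := by
    intro j hj hc
    rcases Nat.eq_zero_or_pos j with rfl | hj0
    · exact hcN (hp.1.1.cone_sub hN2 hq.1.1 hc).1
    · have := (chain_corridor (n := N - j) (m := fun k => m (j + k)) (v := fun k => v (j + k))
        (fun k _ => hstep (j + k)) (fun k hk => hmc _ (by omega) (by omega)) hc).1 (by omega)
      simp only [show j + (N - j) = N by omega] at this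
      exact hcN this
  have ybd : ∀ p ∈ Rset N i, ∀ j, 1 ≤ j → j ≤ N →
      |(phi^[j] p).2| ≤ 22 / 100 * (3 / 10) ^ (N - j) := by
    intro p hp j h1 hj
    have e1 := hp.1.1.abs_snd_le h1 hj
    have e2 : |(phi^[N] p).2| ≤ 22 / 100 :=
      abs_le.2 ⟨by linarith [hp.1.2.2.2.1], hp.1.2.2.2.2⟩
    have e3 : (1 : ℝ) ≤ (3 / 10) ^ (N - j) * (17 / 5) ^ (N - j) := by
      rw [← mul_pow]; exact one_le_pow₀ (by norm_num)
    have e4 : (0 : ℝ) < (3 / 10) ^ (N - j) := by positivity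
    calc |(phi^[j] p).2| ≤ (3 / 10) ^ (N - j) * (17 / 5) ^ (N - j) * |(phi^[j] p).2| :=
          le_mul_of_one_le_left (abs_nonneg _) e3
      _ = (3 / 10) ^ (N - j) * ((17 / 5) ^ (N - j) * |(phi^[j] p).2|) := by ring
      _ ≤ (3 / 10) ^ (N - j) * (22 / 100) := mul_le_mul_of_nonneg_left (e1.trans e2) e4.le
      _ = _ := by ring
  have mbd : ∀ j, 1 ≤ j → j ≤ N → |(m j).2| ≤ 22 / 100 * (3 / 10) ^ (N - j) := fun j h1 hj =>
    abs_mid_le (ybd p hp j h1 hj) (ybd q hq j h1 hj)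
  have xbd : ∀ p ∈ Rset N i, p.1 ≤ 1 + 1 / 1000 → ∀ j ≤ N, (phi^[j] p).1 ≤ 1 + 2 / 1000 :=
    fun p hp h0 j hj => hp.1.1.fst_le_of_start hp.1.2.2.2.1 h0 hj
  have mx : ∀ j ≤ N, (m j).1 ≤ 501 / 500 := fun j hj => by
    have e1 := xbd p hp hp1 j hj
    have e2 := xbd q hq hq1 j hj
    simp only [hm, mid]; linarith
  have main := contraction_sequence (N := N) (a := fun j => |(v j).1|) (b := fun j => |(v j).2|)
    (by omega) (fun j => abs_nonneg _) (fun j h1 h2 => ?_) (fun j h1 h2 => ?_) (fun j hj => ?_) ?_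
  · have b0 := abs_nonneg (v 0).2
    have b1 := hcj 0 (by omega)
    unfold Cone at b1
    push Not at b1
    -- the first step, in the strip
    have s1 : |(v 1).1| ≤ 2 * |(v 0).1| := by
      obtain ⟨c1, c2, c3⟩ : m 0 ∈ strip := mid_strip hp.1.1.1 hq.1.1.1
      have c4 := mx 0 (by omega)
      rw [abs_le] at c3
      have e := abs_phiLin_fst (m 0) (v 0)
      rw [← hstep 0] at e
      have f1 : |99 / 100 * (2 * (m 0).1 - 1) - (m 0).2| ≤ 1 :=
        abs_le.2 ⟨by linarith, by linarith⟩
      have f2 : |(m 0).1| ≤ 501 / 500 := abs_le.2 ⟨by linarith, c4⟩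
      have g1 := mul_le_mul_of_nonneg_right f1 (abs_nonneg (v 0).1)
      have g2 := mul_le_mul_of_nonneg_right f2 b0
      linarith
    -- the last two steps, through the window
    have s2 : |(v (N + 2)).1| ≤ 9 * |(v N).1| := by
      have k0 : 7 / 5 * |(v N).2| < |(v N).1| := by
        unfold Cone at hcN; push Not at hcN; exact hcN
      have n0 := abs_nonneg (v N).2
      have hb : m N ∈ box i := mid_box hp.2.1 hq.2.1
      have hb' : m (N + 1) ∈ box' i := by
        simp only [hm, Function.iterate_succ_apply' phi N]
        exact mid_box' (phi_mem_box' hp.2.1 (Rset.returns hp).2.1)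
          (phi_mem_box' hq.2.1 (Rset.returns hq).2.1)
      have f : |99 / 100 * (2 * (m N).1 - 1) - (m N).2| ≤ 13 / 10 ∧ |(m N).1| ≤ 51 / 50 ∧
          |5 * (m N).2| ≤ 105 / 100 ∧ |5 * ((m N).1 - 2 * (m N).2)| ≤ 51 / 10 := by
        clear_value m
        simp only [abs_le]
        fin_cases i
        · obtain ⟨d1, d2, d3, d4⟩ := mem_box_zero.1 hb
          refine ⟨⟨?_, ?_⟩, ⟨?_, ?_⟩, ⟨?_, ?_⟩, ?_, ?_⟩ <;> linarith
        · obtain ⟨d1, d2, d3, d4⟩ := mem_box_one.1 hb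
          refine ⟨⟨?_, ?_⟩, ⟨?_, ?_⟩, ⟨?_, ?_⟩, ?_, ?_⟩ <;> linarith
      have f' : |99 / 100 * (2 * (m (N + 1)).1 - 1) - (m (N + 1)).2| ≤ 11 / 10 ∧
          |(m (N + 1)).1| ≤ 51 / 50 := by
        clear_value m
        rw [abs_le, abs_le]
        fin_cases i
        · obtain ⟨d1, d2, d3⟩ : 9 / 10 ≤ (m (N + 1)).1 ∧ (m (N + 1)).1 ≤ 51 / 50 ∧
            |(m (N + 1)).2| ≤ 1 / 100 := hb'
          rw [abs_le] at d3
          refine ⟨⟨?_, ?_⟩, ?_, ?_⟩ <;> linarith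
        · obtain ⟨d1, d2, d3⟩ : 7 / 10 ≤ (m (N + 1)).1 ∧ (m (N + 1)).1 ≤ 83 / 100 ∧
            |(m (N + 1)).1 - (m (N + 1)).2| ≤ 1 / 1000 := hb'
          rw [abs_le] at d3
          refine ⟨⟨?_, ?_⟩, ?_, ?_⟩ <;> linarith
      obtain ⟨f1, f2, f3, f4⟩ := f
      obtain ⟨f5, f6⟩ := f'
      have a0 := abs_nonneg (v N).1
      have e1 := abs_phiLin_fst (m N) (v N)
      have e2 := abs_phiLin_snd (m N) (v N)
      have e3 := abs_phiLin_fst (m (N + 1)) (v (N + 1))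
      rw [← hstep] at e1 e2 e3
      have g1 := mul_le_mul_of_nonneg_right f1 a0
      have g2 := mul_le_mul_of_nonneg_right f2 n0
      have g3 := mul_le_mul_of_nonneg_right f3 a0
      have g4 := mul_le_mul_of_nonneg_right f4 n0
      have g5 := mul_le_mul_of_nonneg_right f5 (abs_nonneg (v (N + 1)).1)
      have g6 := mul_le_mul_of_nonneg_right f6 (abs_nonneg (v (N + 1)).2)
      rw [show N + 2 = N + 1 + 1 by ring]
      linarith
    have hpow : 729 * (497 / 500 : ℝ) ^ (N - 1) ≤ 1 / 36 := by
      have := hN.2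
      rw [show N = N - 1 + 1 by omega, pow_succ] at this
      norm_num at this ⊢
      linarith
    have hv0 : v 0 = q - p := rfl
    rw [← hv0]
    change |(v (N + 2)).1| ≤ _
    have := mul_le_mul_of_nonneg_right hpow (abs_nonneg (v 1).1)
    linarith
  · obtain ⟨c1, c2, c3⟩ := hmc j h1 h2
    have e := le_abs_phiLin_snd (m j) (v j)
    rw [← hstep] at e
    have f1 : 61 / 20 ≤ |5 * ((m j).1 - 2 * (m j).2)| := le_abs.2 (Or.inl (by linarith))
    have f2 : |5 * (m j).2| ≤ 11 / 10 * (3 / 5) ^ (N - j) := by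
      have h3 : (3 / 10 : ℝ) ^ (N - j) ≤ (3 / 5) ^ (N - j) :=
        pow_le_pow_left₀ (by norm_num) (by norm_num) _
      rw [abs_mul, abs_of_pos (by norm_num : (0 : ℝ) < 5)]
      linarith [mbd j h1 h2.le]
    have g1 := mul_le_mul_of_nonneg_right f1 (abs_nonneg (v j).2)
    have g2 := mul_le_mul_of_nonneg_right f2 (abs_nonneg (v j).1)
    linarith
  · obtain ⟨c1, c2, c3⟩ := hmc j h1 h2
    have e := abs_phiLin_fst (m j) (v j)
    rw [← hstep] at e
    have c4 := mx j h2.le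
    have f1 : |99 / 100 * (2 * (m j).1 - 1) - (m j).2| ≤
        497 / 500 + 22 / 100 * (3 / 10) ^ (N - j) := by
      have := abs_le.1 (mbd j h1 h2.le)
      exact abs_le.2 ⟨by linarith, by linarith⟩
    have f2 : |(m j).1| ≤ 501 / 500 := abs_le.2 ⟨by linarith, c4⟩
    have g1 := mul_le_mul_of_nonneg_right f1 (abs_nonneg (v j).1)
    have g2 := mul_le_mul_of_nonneg_right f2 (abs_nonneg (v j).2)
    linarith
  · have := hcj j hj
    unfold Cone at this
    push Not at this
    exact this.le
  · unfold Cone at hcN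
    push Not at hcN
    linarith [abs_nonneg (v N).2]

/-- Orbits through the same windows whose difference is nearly vertical separate, unless they
coincide. -/
lemma eq_of_forward {N : ℕ} (hN : 2 ≤ N) {a : ℕ → Fin 2} {p q : ℕ → ℝ × ℝ}
    (hp : ∀ k, Block N (a k) (p k) ∧ phi^[N + 2] (p k) = p (k + 1))
    (hq : ∀ k, Block N (a k) (q k) ∧ phi^[N + 2] (q k) = q (k + 1))
    (h : Cone 3 (q 0 - p 0)) : q 0 = p 0 := by
  have key : ∀ k, Cone 3 (q k - p k) ∧ (4 : ℝ) ^ k * |(q 0 - p 0).2| ≤ |(q k - p k).2| := by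
    intro k
    induction k with
    | zero => exact ⟨h, by simp⟩
    | succ k ih =>
      have e1 := (hp k).1.sub hN (hq k).1 ih.1
      have e2 := (hp k).1.abs_le hN (hq k).1 ih.1
      rw [(hp k).2, (hq k).2] at e1 e2
      refine ⟨e1.1, ?_⟩
      rw [pow_succ]
      linarith [ih.2]
  refine sub_eq_zero.1 (h.eq_zero (abs_eq_zero.1 ?_))
  by_contra hne
  have hpos : 0 < |(q 0 - p 0).2| := lt_of_le_of_ne (abs_nonneg _) (Ne.symm hne)
  obtain ⟨k, hk⟩ := pow_unbounded_of_one_lt (1 / |(q 0 - p 0).2|) (by norm_num : (1 : ℝ) < 4)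
  have e1 := (key k).2
  have e2 : |(q k - p k).2| ≤ 1 := by
    have b1 := abs_le.1 (hp k).1.1.1.2.2
    have b2 := abs_le.1 (hq k).1.1.1.2.2
    rw [Prod.snd_sub]
    exact abs_le.2 ⟨by linarith [b1.2, b2.1], by linarith [b1.1, b2.2]⟩
  rw [div_lt_iff₀ hpos] at hk
  linarith

lemma IsOrbit.fst_le {N : ℕ} {a : ℤ → Fin 2} {ω : ℤ → ℝ × ℝ} (h : IsOrbit N a ω) (k : ℤ) :
    (ω k).1 ≤ 1 + 1 / 1000 := by
  have e := (h (k - 1)).2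
  rw [sub_add_cancel] at e
  rw [← e]
  exact (mem_image_Rset (mem_image_of_mem _ (h (k - 1)).1)).2.2

lemma IsOrbit.mem_image {N : ℕ} {a : ℤ → Fin 2} {ω : ℤ → ℝ × ℝ} (h : IsOrbit N a ω) (k : ℤ) :
    ω (k + 1) ∈ phi^[N + 2] '' Rset N (a k) :=
  (h k).2 ▸ mem_image_of_mem _ (h k).1

/-- The itinerary determines the orbit. -/
theorem IsOrbit.unique {N : ℕ} (hN : IsLong N) {a : ℤ → Fin 2} {ω ω' : ℤ → ℝ × ℝ}
    (h : IsOrbit N a ω) (h' : IsOrbit N a ω') : ω = ω' := by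
  -- A difference in the cone is expanded forever in forward time; a difference outside the cone at
  -- all earlier times would be expanded forever in backward time.
  have hcone : ∀ k, Cone 3 (ω' k - ω k) → ω' k = ω k := by
    intro k hk
    have := eq_of_forward hN.two_le (a := fun j : ℕ => a (k + j)) (p := fun j : ℕ => ω (k + j))
      (q := fun j : ℕ => ω' (k + j))
      (fun j => ⟨Rset.block (h _).1, by rw [(h _).2]; push_cast; rw [add_assoc]⟩)
      (fun j => ⟨Rset.block (h' _).1, by rw [(h' _).2]; push_cast; rw [add_assoc]⟩)
      (by simpa using hk)
    simpa using this
  have hback : ∀ k, ω' (k - 1) = ω (k - 1) → ω' k = ω k := by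
    intro k hk
    have e1 := (h (k - 1)).2
    have e2 := (h' (k - 1)).2
    rw [sub_add_cancel] at e1 e2
    rw [← e1, ← e2, hk]
  have hhalf : ∀ k, ω' k ≠ ω k → |(ω' k - ω k).1| ≤ 1 / 2 * |(ω' (k - 1) - ω (k - 1)).1| := by
    intro k hk
    have e1 := (h (k - 1)).2
    have e2 := (h' (k - 1)).2
    rw [sub_add_cancel] at e1 e2
    have := Rset.contract hN (h (k - 1)).1 (h' (k - 1)).1 (h.fst_le _) (h'.fst_le _)
    rw [e1, e2] at this
    exact this fun hc => hk (hcone k hc)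
  funext k
  by_contra hne
  have key : ∀ n : ℕ, ω' (k - n) ≠ ω (k - n) ∧
      |(ω' k - ω k).1| ≤ (1 / 2) ^ n * |(ω' (k - n) - ω (k - n)).1| := by
    intro n
    induction n with
    | zero => simpa using Ne.symm hne
    | succ n ih =>
      have e : k - ((n + 1 : ℕ) : ℤ) = k - n - 1 := by push_cast; ring
      rw [e]
      refine ⟨fun hc => ih.1 (hback _ hc), ih.2.trans ?_⟩
      rw [pow_succ, mul_assoc]
      exact mul_le_mul_of_nonneg_left (hhalf _ ih.1) (by positivity)
  have bd : ∀ n : ℕ, |(ω' k - ω k).1| ≤ (1 / 2) ^ n * 2 := by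
    intro n
    refine (key n).2.trans (mul_le_mul_of_nonneg_left ?_ (by positivity))
    have b1 := (h (k - n)).1.1.1.1
    have b2 := (h' (k - n)).1.1.1.1
    rw [Prod.fst_sub]
    exact abs_le.2 ⟨by linarith [b1.2.1, b2.1], by linarith [b1.1, b2.2.1]⟩
  have lim : Tendsto (fun n : ℕ => (1 / 2 : ℝ) ^ n * 2) atTop (𝓝 (0 * 2)) :=
    (tendsto_pow_atTop_nhds_zero_of_lt_one (by norm_num) (by norm_num)).mul_const 2
  have h0 : |(ω' k - ω k).1| ≤ 0 := by
    have := ge_of_tendsto' lim bd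
    linarith
  exact hne (hcone k (cone_vertical (by norm_num) (abs_eq_zero.1 (le_antisymm h0 (abs_nonneg _))))).symm

/-! ### Symbolic coding of the orbits of the return map -/

lemma Rset_disjoint {N : ℕ} {i j : Fin 2} {p : ℝ × ℝ} (hi : p ∈ Rset N i) (hj : p ∈ Rset N j) :
    i = j := by
  by_contra hne
  have h01 : p ∈ Rset N 0 ∧ p ∈ Rset N 1 := by
    fin_cases i <;> fin_cases j <;> simp_all
  have h1 := (mem_box_zero.1 h01.1.2.1).2.2.2
  have h2 := (mem_box_one.1 h01.2.2.1).2.2.1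
  linarith

/-- The return map is injective on the part of its image that returns again. -/
lemma return_injective {N : ℕ} (hN : IsLong N) {i j i' j' : Fin 2} {p q : ℝ × ℝ}
    (hp : p ∈ Rset N i) (hq : q ∈ Rset N j) (hp' : p ∈ phi^[N + 2] '' Rset N i')
    (hq' : q ∈ phi^[N + 2] '' Rset N j') (h : phi^[N + 2] p = phi^[N + 2] q) : p = q := by
  have hi : ∀ k l : Fin 2, phi^[N + 2] p ∈ phi^[N + 2] '' Rset N k →
      phi^[N + 2] p ∈ phi^[N + 2] '' Rset N l → k = l := by
    intro k l hk hl
    by_contra hne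
    have h01 : phi^[N + 2] p ∈ phi^[N + 2] '' Rset N 0 ∧
        phi^[N + 2] p ∈ phi^[N + 2] '' Rset N 1 := by
      fin_cases k <;> fin_cases l <;> simp_all
    exact disjoint_left.1 (disjoint_image_Rset N) h01.1 h01.2
  obtain rfl : i = j := hi i j (mem_image_of_mem _ hp) (h ▸ mem_image_of_mem _ hq)
  have hF : phi^[N] p = phi^[N] q := by
    rw [iterate_add_two, iterate_add_two] at h
    have h1 := phi_mem_box' hp.2.1 (Rset.returns hp).2.1
    have h2 := phi_mem_box' hq.2.1 (Rset.returns hq).2.1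
    exact phi_injOn (box_half_lt hp.2.1) (box_half_lt hq.2.1)
      (phi_injOn (box'_half_lt h1) (box'_half_lt h2) h)
  have h1 := hp.1.1.phi_eq_of_iterate_eq hN.two_le hq.1.1 hF
  have yp := abs_le.1 hp.1.1.1.2.2
  have yq := abs_le.1 hq.1.1.1.2.2
  -- Only the first step of the passage can fail to be injective. The two images lie on different
  -- sides of the fold and are kept apart by `phi`.
  have big : ∀ {i : Fin 2} {z : ℝ × ℝ}, z ∈ phi^[N + 2] '' Rset N i →
      (9 / 10 ≤ z.1 ∧ z.1 ≤ 1 + 1 / 1000) ∨ (193 / 1000 ≤ z.1 ∧ z.1 ≤ 262 / 1000) := by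
    intro i z hz
    fin_cases i
    · exact Or.inl ⟨image_Rset_zero hz, (mem_image_Rset hz).2.2⟩
    · exact Or.inr (image_Rset_one hz)
  have h2 := congrArg Prod.fst h1
  rw [phi_fst, phi_fst] at h2
  rcases big hp' with ⟨a1, a2⟩ | ⟨a1, a2⟩ <;> rcases big hq' with ⟨b1, b2⟩ | ⟨b1, b2⟩
  · exact phi_injOn (by simp only [mem_ofPred_eq]; linarith)
      (by simp only [mem_ofPred_eq]; linarith) h1
  · nlinarith
  · nlinarith
  · -- both points lie to the left of the fold
    have hdet : (99 / 100 * (2 * (mid p q).1 - 1) - (mid p q).2) *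
        ((mid p q).1 - 2 * (mid p q).2) + (mid p q).1 * (mid p q).2 ≠ 0 := by
      have m1 : 193 / 1000 ≤ (mid p q).1 := by simp only [mid]; linarith
      have m2 : (mid p q).1 ≤ 262 / 1000 := by simp only [mid]; linarith
      have m3 : -(1 / 100000) ≤ (mid p q).2 := by simp only [mid]; linarith
      have m4 : (mid p q).2 ≤ 1 / 100000 := by simp only [mid]; linarith
      have : (99 / 100 * (2 * (mid p q).1 - 1) - (mid p q).2) *
        ((mid p q).1 - 2 * (mid p q).2) + (mid p q).1 * (mid p q).2 < 0 := by nlinarith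
      exact this.ne
    exact (sub_eq_zero.1 (phiLin_eq_zero hdet (by rw [← phi_sub, h1, sub_self]))).symm

open Classical in
/-- The orbit with itinerary `a`; the value is `0` if there is none. -/
noncomputable def orbitOf (N : ℕ) (a : ℤ → Fin 2) : ℤ → ℝ × ℝ :=
  if H : ∃ ω, IsOrbit N a ω then H.choose else 0

lemma orbitOf_spec {N : ℕ} (hN : IsLong N) (a : ℤ → Fin 2) : IsOrbit N a (orbitOf N a) := by
  have H := exists_isOrbit hN a
  unfold orbitOf
  rw [dif_pos H]
  exact H.choose_spec

/-- The point with itinerary `a`. -/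
noncomputable def codePt (N : ℕ) (a : ℤ → Fin 2) : ℝ × ℝ := orbitOf N a 0

lemma codePt_shift {N : ℕ} (hN : IsLong N) (a : ℤ → Fin 2) :
    codePt N (shift a) = phi^[N + 2] (codePt N a) := by
  have h := orbitOf_spec hN a
  have : IsOrbit N (shift a) fun k => orbitOf N a (k + 1) := fun k => h (k + 1)
  unfold codePt
  rw [(orbitOf_spec hN (shift a)).unique hN this, (h 0).2]

lemma codePt_mem {N : ℕ} (hN : IsLong N) (a : ℤ → Fin 2) : codePt N a ∈ Rset N (a 0) :=
  (orbitOf_spec hN a 0).1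

lemma codePt_mem_image {N : ℕ} (hN : IsLong N) (a : ℤ → Fin 2) :
    codePt N a ∈ phi^[N + 2] '' Rset N (a (-1)) := by
  have := (orbitOf_spec hN a).mem_image (-1)
  rwa [neg_add_cancel] at this

lemma isCompact_orbits (N : ℕ) :
    IsCompact {x : (ℤ → Fin 2) × (ℤ → ℝ × ℝ) | IsOrbit N x.1 x.2} := by
  have h1 : IsCompact ((univ : Set (ℤ → Fin 2)) ×ˢ
      (Set.pi univ fun _ : ℤ => Qset N : Set (ℤ → ℝ × ℝ))) :=
    isCompact_univ.prod (isCompact_univ_pi fun _ => isCompact_Qset N)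
  refine h1.of_isClosed_subset ?_ fun x hx => ⟨mem_univ _, fun k _ => (hx k).1.1⟩
  have e : {x : (ℤ → Fin 2) × (ℤ → ℝ × ℝ) | IsOrbit N x.1 x.2} = ⋂ k : ℤ,
      ((⋃ i : Fin 2, {x | x.1 k = i} ∩ {x | x.2 k ∈ Rset N i}) ∩
        {x | phi^[N + 2] (x.2 k) = x.2 (k + 1)}) := by
    ext x
    simp [IsOrbit, mem_iInter]
  rw [e]
  refine isClosed_iInter fun k => (isClosed_iUnion_of_finite fun i => ?_).inter ?_
  · exact (isClosed_eq ((continuous_apply k).comp continuous_fst) continuous_const).inter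
      ((isCompact_Rset N i).isClosed.preimage ((continuous_apply k).comp continuous_snd))
  · exact isClosed_eq ((continuous_iterate (N + 2)).comp
      ((continuous_apply k).comp continuous_snd)) ((continuous_apply (k + 1)).comp continuous_snd)

/-- The space of all orbits is compact and by uniqueness projects injectively to itineraries. -/
lemma continuous_codePt {N : ℕ} (hN : IsLong N) : Continuous (codePt N) := by
  have h : ContinuousOn (fun a : ℤ → Fin 2 => (a, orbitOf N a)) univ :=
    continuousOn_of_comp_compact (isCompact_orbits N) continuous_fst.continuousOn
      (fun x hx y hy e => Prod.ext e (IsOrbit.unique hN hx (by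
        have hy' : IsOrbit N y.1 y.2 := hy
        rwa [show y.1 = x.1 from e.symm] at hy')))
      (fun a _ => orbitOf_spec hN a) continuousOn_id
  exact (continuous_apply 0).comp (continuous_snd.comp (continuousOn_univ.1 h))

/-- Orbits through the same point agree, also in the past by `return_injective`, hence have the same
itinerary. -/
lemma injective_codePt {N : ℕ} (hN : IsLong N) : Function.Injective (codePt N) := by
  intro a b h
  have ha := orbitOf_spec hN a
  have hb := orbitOf_spec hN b
  have fwd : ∀ k : ℕ, orbitOf N a k = orbitOf N b k := by
    intro k
    induction k with
    | zero => exact h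
    | succ k ih => push_cast; rw [← (ha k).2, ← (hb k).2, ih]
  have bwd : ∀ k : ℕ, orbitOf N a (-k) = orbitOf N b (-k) := by
    intro k
    induction k with
    | zero => exact h
    | succ k ih =>
      have e : (-((k + 1 : ℕ) : ℤ)) = -k - 1 := by push_cast; ring
      have e1 := (ha (-k - 1)).2
      have e2 := (hb (-k - 1)).2
      rw [sub_add_cancel] at e1 e2
      have m1 := ha.mem_image (-k - 1 - 1)
      have m2 := hb.mem_image (-k - 1 - 1)
      rw [sub_add_cancel] at m1 m2
      rw [e]
      exact return_injective hN (ha _).1 (hb _).1 m1 m2 (by rw [e1, e2, ih])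
  funext k
  have : orbitOf N a k = orbitOf N b k := by
    rcases Int.eq_nat_or_neg k with ⟨n, rfl | rfl⟩
    · exact fwd n
    · exact bwd n
  have h1 := (ha k).1
  rw [this] at h1
  exact Rset_disjoint h1 (hb k).1

lemma codePt_zero {N : ℕ} (hN : IsLong N) : codePt N 0 = (1, 0) := by
  have : IsOrbit N 0 fun _ => (1, 0) := by
    intro k
    refine ⟨⟨one_zero_mem_Qset hN, ?_, ?_⟩, iterate_one_zero _⟩
    · rw [iterate_one_zero, Pi.zero_apply, mem_box_zero]; norm_num
    · rw [iterate_one_zero]; exact one_zero_mem_Qset hN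
  unfold codePt
  rw [(orbitOf_spec hN 0).unique hN this]

/-! ### The full shift -/

lemma iterate_shift {A : Type*} (n : ℕ) (a : ℤ → A) (k : ℤ) : shift^[n] a k = a (k + n) := by
  induction n generalizing a with
  | zero => simp
  | succ n ih =>
    rw [Function.iterate_succ_apply, ih]
    simp only [shift]
    push_cast
    rw [add_assoc]

lemma shift_injective {A : Type*} : Function.Injective (shift : (ℤ → A) → ℤ → A) := by
  intro a b h
  funext k
  have := congrFun h (k - 1)
  simpa [shift] using this

lemma shift_surjective {A : Type*} : Function.Surjective (shift : (ℤ → A) → ℤ → A) := fun a =>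
  ⟨fun k => a (k - 1), by funext k; simp [shift]⟩

lemma continuous_shift {A : Type*} [TopologicalSpace A] :
    Continuous (shift : (ℤ → A) → ℤ → A) :=
  continuous_pi fun k => continuous_apply (k + 1)

/-- Open sets of sequences are determined by finitely many symbols near each of their points. -/
lemma exists_window {U : Set (ℤ → Fin 2)} (hU : IsOpen U) {a : ℤ → Fin 2} (ha : a ∈ U) :
    ∃ m : ℕ, ∀ b : ℤ → Fin 2, (∀ k : ℤ, -m ≤ k → k ≤ m → b k = a k) → b ∈ U := by
  obtain ⟨I, u, h1, h2⟩ := isOpen_pi_iff.1 hU a ha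
  refine ⟨I.sup Int.natAbs, fun b hb => h2 fun k hk => ?_⟩
  have : k.natAbs ≤ I.sup Int.natAbs := Finset.le_sup (f := Int.natAbs) hk
  rw [hb k (by omega) (by omega)]
  exact (h1 k hk).2

/-- The full shift is topologically mixing. -/
lemma shift_mixing {U V : Set (ℤ → Fin 2)} (hU : IsOpen U) (hV : IsOpen V) (hU' : U.Nonempty)
    (hV' : V.Nonempty) : ∃ n₀ : ℕ, ∀ n ≥ n₀, ∃ a ∈ U, shift^[n] a ∈ V := by
  obtain ⟨a, ha⟩ := hU'
  obtain ⟨b, hb⟩ := hV'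
  obtain ⟨m, hm⟩ := exists_window hU ha
  obtain ⟨l, hl⟩ := exists_window hV hb
  refine ⟨m + l + 1, fun n hn => ⟨fun k => if k ≤ m then a k else b (k - n), ?_, ?_⟩⟩
  · exact hm _ fun k _ hk => if_pos hk
  · refine hl _ fun k hk _ => ?_
    rw [iterate_shift, if_neg (by omega), add_sub_cancel_right]

lemma exists_periodic_mem {U : Set (ℤ → Fin 2)} (hU : IsOpen U) (hU' : U.Nonempty) :
    ∃ a ∈ U, ∃ n > 0, shift^[n] a = a := by
  obtain ⟨a, ha⟩ := hU'
  obtain ⟨m, hm⟩ := exists_window hU ha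
  -- The central word of `a` of length `2m + 1` is repeated periodically.
  refine ⟨fun k => a ((k + m) % (2 * m + 1) - m), hm _ fun k h1 h2 => ?_, 2 * m + 1, by omega, ?_⟩
  · congr 1
    rw [Int.emod_eq_of_lt (by omega) (by omega)]
    ring
  · funext k
    rw [iterate_shift]
    congr 2
    push_cast
    rw [show k + (2 * (m : ℤ) + 1) + m = k + m + (2 * m + 1) by ring, Int.add_emod_right]

/-- Baire category: for each nonempty open set, the sequences whose forward orbit visits it form a
dense open set. -/
lemma exists_dense_shift_orbit : ∃ a : ℤ → Fin 2, ∀ V : Set (ℤ → Fin 2), IsOpen V → V.Nonempty →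
    ∃ n : ℕ, shift^[n] a ∈ V := by
  have hd : Dense (⋂ V ∈ TopologicalSpace.countableBasis (ℤ → Fin 2),
      ⋃ n : ℕ, shift^[n] ⁻¹' V) := by
    refine dense_biInter_of_isOpen (fun V hV => ?_) (TopologicalSpace.countable_countableBasis _)
      fun V hV => ?_
    · exact isOpen_iUnion fun n =>
        (TopologicalSpace.isOpen_of_mem_countableBasis hV).preimage (continuous_shift.iterate n)
    · rw [dense_iff_inter_open]
      intro U hU hU'
      obtain ⟨n, hn⟩ := shift_mixing hU (TopologicalSpace.isOpen_of_mem_countableBasis hV) hU'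
        (TopologicalSpace.nonempty_of_mem_countableBasis hV)
      obtain ⟨a, ha, ha'⟩ := hn n le_rfl
      exact ⟨a, ha, mem_iUnion.2 ⟨n, ha'⟩⟩
  obtain ⟨a, ha⟩ := hd.nonempty
  refine ⟨a, fun V hV ⟨b, hb⟩ => ?_⟩
  obtain ⟨W, hW, -, hWV⟩ :=
    (TopologicalSpace.isBasis_countableBasis (ℤ → Fin 2)).exists_subset_of_mem_open hb hV
  obtain ⟨n, hn⟩ := mem_iUnion.1 (mem_iInter₂.1 ha W hW)
  exact ⟨n, hWV hn⟩

/-! ### Chaos inherited from the full shift -/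

lemma iterate_code {X : Type*} {f : X → X} {M : ℕ} {θ : (ℤ → Fin 2) → X}
    (hθ : ∀ a, f^[M] (θ a) = θ (shift a)) (n : ℕ)
    (a : ℤ → Fin 2) :
    f^[M * n] (θ a) = θ (shift^[n] a) := by
  induction n with
  | zero => rfl
  | succ n ih =>
    rw [mul_add, mul_one, add_comm, Function.iterate_add_apply, ih, hθ,
      Function.iterate_succ_apply']

section Coding

variable {X : Type*} [MetricSpace X] {f : X → X} {M : ℕ} {θ : (ℤ → Fin 2) → X}

/-- If `θ` embeds the full shift into an iterate `f^[M]`, then `f` is chaotic on the forward images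
of the embedded set. -/
theorem isDevaneyChaoticOn_of_code (hf : Continuous f) (hM : 0 < M) (hc : Continuous θ)
    (hi : Function.Injective θ) (hθ : ∀ a, f^[M] (θ a) = θ (shift a)) :
    IsDevaneyChaoticOn f (⋃ n : ℕ, f^[n] '' range θ) := by
  have hcj : ∀ j : ℕ, Continuous fun a => f^[j] (θ a) := fun j => (hf.iterate j).comp hc
  have mem : ∀ (j : ℕ) (a : ℤ → Fin 2), f^[j] (θ a) ∈ ⋃ n : ℕ, f^[n] '' range θ := fun j a =>
    mem_iUnion.2 ⟨j, _, mem_range_self a, rfl⟩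
  have rep : ∀ p ∈ ⋃ n : ℕ, f^[n] '' range θ, ∃ j a, f^[j] (θ a) = p := by
    intro p hp
    obtain ⟨j, _, ⟨a, rfl⟩, h⟩ := mem_iUnion.1 hp
    exact ⟨j, a, h⟩
  constructor
  · intro p hp
    obtain ⟨j, a, rfl⟩ := rep p hp
    rw [← Function.iterate_succ_apply' f]
    exact mem _ _
  · rintro U V hU hV ⟨p, hpU, hp⟩ ⟨q, hqV, hq⟩
    obtain ⟨i, a, rfl⟩ := rep p hp
    obtain ⟨j, b, rfl⟩ := rep q hq
    obtain ⟨n₀, hn⟩ := shift_mixing (hU.preimage (hcj i)) (hV.preimage (hcj j)) ⟨a, hpU⟩ ⟨b, hqV⟩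
    obtain ⟨c, hc1, hc2⟩ := hn (n₀ + i) (by omega)
    have hle : i ≤ M * (n₀ + i) := by nlinarith
    refine ⟨M * (n₀ + i) - i + j, f^[j] (f^[M * (n₀ + i)] (θ c)),
      ⟨f^[i] (θ c), ⟨hc1, mem _ _⟩, ?_⟩, ?_⟩
    · rw [← Function.iterate_add_apply, ← Function.iterate_add_apply]
      congr 1
      omega
    · rw [iterate_code hθ]; exact hc2
  · intro p hp
    obtain ⟨j, a, rfl⟩ := rep p hp
    rw [mem_closure_iff]
    intro U hU hpU
    obtain ⟨b, hb, n, hn, hbn⟩ := exists_periodic_mem (hU.preimage (hcj j)) ⟨a, hpU⟩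
    refine ⟨f^[j] (θ b), hb, mem _ _, M * n, by positivity, ?_⟩
    change f^[M * n] (f^[j] (θ b)) = f^[j] (θ b)
    rw [← Function.iterate_add_apply, add_comm, Function.iterate_add_apply, iterate_code hθ, hbn]
  -- The sensitivity constant is the distance between the sets of points with symbol `0` and with
  -- symbol `1` at time `0`.
  · have hK : ∀ i : Fin 2, IsCompact (θ '' {a | a 0 = i}) := fun i =>
      (isClosed_eq (continuous_apply 0) continuous_const).isCompact.image hc
    obtain ⟨⟨x, y⟩, ⟨⟨a₀, ha₀, hx⟩, b₀, hb₀, hy⟩, hmin⟩ :=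
      ((hK 0).prod (hK 1)).exists_isMinOn
        (f := fun z : X × X => dist z.1 z.2)
        ⟨(θ fun _ => 0, θ fun _ => 1), mem_image_of_mem _ rfl, mem_image_of_mem _ rfl⟩
        continuous_dist.continuousOn
    have hpos : 0 < dist x y := by
      rw [dist_pos]
      rintro rfl
      have := hi (hx.trans hy.symm)
      rw [this] at ha₀
      rw [mem_ofPred_eq] at ha₀ hb₀
      rw [ha₀] at hb₀
      exact zero_ne_one hb₀
    have hsep : ∀ a b : ℤ → Fin 2, a 0 ≠ b 0 → dist x y ≤ dist (θ a) (θ b) := by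
      intro a b hab
      have h01 : (a 0 = 0 ∧ b 0 = 1) ∨ (a 0 = 1 ∧ b 0 = 0) := by omega
      rcases h01 with ⟨h0, h1⟩ | ⟨h1, h0⟩
      · exact hmin (show (θ a, θ b) ∈ _ from ⟨mem_image_of_mem _ h0, mem_image_of_mem _ h1⟩)
      · rw [dist_comm (θ a)]
        exact hmin (show (θ b, θ a) ∈ _ from ⟨mem_image_of_mem _ h0, mem_image_of_mem _ h1⟩)
    refine ⟨dist x y, hpos, fun p hp δ hδ => ?_⟩
    obtain ⟨j, a, rfl⟩ := rep p hp
    obtain ⟨m, hm⟩ := exists_window (Metric.isOpen_ball.preimage (hcj j))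
      (show a ∈ (fun a => f^[j] (θ a)) ⁻¹' Metric.ball (f^[j] (θ a)) δ from
        Metric.mem_ball_self hδ)
    -- change a symbol that is read only after time `j`
    set n : ℕ := m + j + 1 with hn
    set b : ℤ → Fin 2 := Function.update a n (1 - a n) with hb
    have hbU := hm b fun k _ hk => Function.update_of_ne (by omega) _ _
    have hle : j ≤ M * n := by nlinarith
    refine ⟨f^[j] (θ b), mem _ _, hbU, M * n - j, ?_⟩
    rw [← Function.iterate_add_apply, ← Function.iterate_add_apply,
      show M * n - j + j = M * n by omega, iterate_code hθ, iterate_code hθ]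
    refine hsep _ _ ?_
    rw [iterate_shift, iterate_shift, zero_add, hb, Function.update_self]
    generalize a n = c
    omega

theorem exists_dense_orbit_of_code (hf : Continuous f) (hc : Continuous θ)
    (hθ : ∀ a, f^[M] (θ a) = θ (shift a)) :
    ∃ p ∈ range θ, (⋃ n : ℕ, f^[n] '' range θ) ⊆ closure (range fun n : ℕ => f^[n] p) := by
  obtain ⟨a, ha⟩ := exists_dense_shift_orbit
  refine ⟨θ a, mem_range_self a, fun q hq => ?_⟩
  obtain ⟨j, _, ⟨b, rfl⟩, rfl⟩ := mem_iUnion.1 hq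
  rw [mem_closure_iff]
  intro U hU hqU
  obtain ⟨n, hn⟩ := ha _ (hU.preimage ((hf.iterate j).comp hc)) ⟨b, hqU⟩
  refine ⟨f^[j] (θ (shift^[n] a)), hn, j + M * n, ?_⟩
  simp only
  rw [Function.iterate_add_apply, iterate_code hθ]

end Coding

/-- The indicator sequence of the multiples of `n + 1` codes a point of period more than `n`. -/
theorem exists_long_period_of_code {X : Type*} {f : X → X} {M : ℕ} {θ : (ℤ → Fin 2) → X}
    (hM : 0 < M) (hi : Function.Injective θ)
    (hθ : ∀ a, f^[M] (θ a) = θ (shift a)) (n : ℕ) :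
    ∃ p ∈ range θ, n < Function.minimalPeriod f p := by
  set a : ℤ → Fin 2 := fun k => if ((n + 1 : ℕ) : ℤ) ∣ k then 1 else 0 with ha
  refine ⟨θ a, mem_range_self a, ?_⟩
  have hper : f^[M * (n + 1)] (θ a) = θ a := by
    rw [iterate_code hθ]
    congr 1
    funext k
    rw [iterate_shift]
    simp only [ha, dvd_add_self_right]
  set r := Function.minimalPeriod f (θ a) with hr
  have hr0 : 0 < r := Function.IsPeriodicPt.minimalPeriod_pos (by positivity : 0 < M * (n + 1)) hper
  have hfix : f^[r] (θ a) = θ a := Function.iterate_minimalPeriod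
  have h1 : shift^[r] a = a := by
    apply hi
    rw [← iterate_code hθ, mul_comm, Function.iterate_mul]
    exact Function.iterate_fixed hfix M
  have h2 := congrFun h1 0
  rw [iterate_shift, zero_add] at h2
  simp only [ha, dvd_zero, if_true] at h2
  by_contra hlt
  rw [if_neg] at h2
  · exact zero_ne_one h2
  · intro hd
    have := Int.le_of_dvd (by exact_mod_cast hr0) hd
    omega

/-! ### Conjugacies -/

/-- Two continuous maps from a compact space with the same fibres have homeomorphic ranges. -/
lemma exists_homeomorph_range {D Y Z : Type*} [TopologicalSpace D] [CompactSpace D]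
    [TopologicalSpace Y] [T2Space Y] [TopologicalSpace Z] [T2Space Z] {g : D → Y} {h : D → Z}
    (hg : Continuous g) (hh : Continuous h) (hk : ∀ d d', g d = g d' ↔ h d = h d') :
    ∃ e : range g ≃ₜ range h, ∀ d, e ⟨g d, mem_range_self d⟩ = ⟨h d, mem_range_self d⟩ := by
  let e₀ : range g → range h := fun y => ⟨h y.2.choose, mem_range_self _⟩
  have he₀ : ∀ d, e₀ ⟨g d, mem_range_self d⟩ = ⟨h d, mem_range_self d⟩ := fun d =>
    Subtype.ext ((hk _ _).1 (⟨g d, mem_range_self d⟩ : range g).2.choose_spec)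
  have hinj : Function.Injective e₀ := by
    rintro ⟨_, d, rfl⟩ ⟨_, d', rfl⟩ he
    rw [he₀, he₀] at he
    exact Subtype.ext ((hk d d').2 (congrArg Subtype.val he))
  have hsurj : Function.Surjective e₀ := by
    rintro ⟨_, d, rfl⟩
    exact ⟨_, he₀ d⟩
  have hq : IsQuotientMap (rangeFactorization g) :=
    hg.rangeFactorization.isClosedMap.isQuotientMap hg.rangeFactorization
      rangeFactorization_surjective
  have hcont : Continuous e₀ := by
    rw [hq.continuous_iff]
    have : e₀ ∘ rangeFactorization g = rangeFactorization h := funext he₀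
    rw [this]
    exact hh.rangeFactorization
  have : CompactSpace (range g) := isCompact_iff_compactSpace.1 (isCompact_range hg)
  exact ⟨Continuous.homeoOfEquivCompactToT2 (f := Equiv.ofBijective e₀ ⟨hinj, hsurj⟩) hcont, he₀⟩

/-- Two quotients of the same system with the same identifications are conjugate. -/
lemma conjugateOn_range {D Y Z : Type*} [TopologicalSpace D] [CompactSpace D]
    [TopologicalSpace Y] [T2Space Y] [TopologicalSpace Z] [T2Space Z] {g : D → Y} {h : D → Z}
    {T : D → D} {f : Y → Y} {s : Z → Z} (hg : Continuous g) (hh : Continuous h)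
    (hk : ∀ d d', g d = g d' ↔ h d = h d') (hf : ∀ d, f (g d) = g (T d))
    (hs : ∀ d, s (h d) = h (T d)) : ConjugateOn f (range g) s (range h) := by
  obtain ⟨e, he⟩ := exists_homeomorph_range hg hh hk
  refine ⟨?_, ?_, e, ?_⟩
  · rintro _ ⟨d, rfl⟩; exact ⟨T d, (hf d).symm⟩
  · rintro _ ⟨d, rfl⟩; exact ⟨T d, (hs d).symm⟩
  · rintro ⟨_, d, rfl⟩
    have e1 : (⟨f (g d), ⟨T d, (hf d).symm⟩⟩ : range g) = ⟨g (T d), mem_range_self _⟩ :=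
      Subtype.ext (hf d)
    refine Subtype.ext ?_
    change (e ⟨f (g d), _⟩ : Z) = s (e ⟨g d, _⟩ : Z)
    rw [e1, he, he, hs]

/-! ### Reading the itinerary off the orbit of `phi` -/

/-- The second coordinate exceeds `1/2` exactly one step after passing through the upper
window. -/
lemma Rset.half_lt_snd_iff {N : ℕ} {i : Fin 2} {p : ℝ × ℝ} (hp : p ∈ Rset N i) {j : ℕ}
    (hj : j < N + 2) : 1 / 2 < (phi^[j] p).2 ↔ j = N + 1 ∧ i = 1 := by
  constructor
  · intro h
    rcases Nat.eq_zero_or_pos j with rfl | h0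
    · have := (abs_le.1 hp.1.1.1.2.2).2
      rw [Function.iterate_zero, id] at h
      linarith
    rcases lt_or_ge j N with h1 | h1
    · linarith [(hp.1.1.2 j h0 h1).2.2]
    rcases h1.eq_or_lt with rfl | h1
    · linarith [hp.1.2.2.2.2]
    obtain rfl : j = N + 1 := by omega
    refine ⟨rfl, ?_⟩
    by_contra hi
    obtain rfl : i = 0 := by omega
    have h2 : |(phi (phi^[N] p)).2| ≤ 1 / 200000 :=
      (abs_snd_le_of_return hp.2.1 (Rset.returns hp).2.1).1
    rw [Function.iterate_succ_apply'] at h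
    linarith [(abs_le.1 h2).2]
  · rintro ⟨rfl, rfl⟩
    obtain ⟨h1, -, h3⟩ : 7 / 10 ≤ (phi (phi^[N] p)).1 ∧ (phi (phi^[N] p)).1 ≤ 83 / 100 ∧
        |(phi (phi^[N] p)).1 - (phi (phi^[N] p)).2| ≤ 1 / 1000 :=
      phi_mem_box' hp.2.1 (Rset.returns hp).2.1
    rw [Function.iterate_succ_apply']
    linarith [(abs_le.1 h3).2]

lemma half_lt_snd_iff {N : ℕ} (hN : IsLong N) (a : ℤ → Fin 2) (t : ℕ) :
    1 / 2 < (phi^[t] (codePt N a)).2 ↔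
      t % (N + 2) = N + 1 ∧ a ((t / (N + 2) : ℕ) : ℤ) = 1 := by
  have e : phi^[t] (codePt N a) =
      phi^[t % (N + 2)] (codePt N (shift^[t / (N + 2)] a)) := by
    rw [← iterate_code (fun a => (codePt_shift hN a).symm), ← Function.iterate_add_apply,
      Nat.mod_add_div]
  rw [e, Rset.half_lt_snd_iff (codePt_mem hN _) (Nat.mod_lt _ (by omega)), iterate_shift, zero_add]

/-! ### Orbits on the axis -/

lemma axis_step {x : ℝ} (h0 : 31 / 200 ≤ x) (h1 : x ≤ 1) :
    phi (x, 0) = (1 - 99 / 100 * x * (1 - x), 0) ∧ 3 / 4 ≤ 1 - 99 / 100 * x * (1 - x) ∧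
      1 - 99 / 100 * x * (1 - x) ≤ 1 := by
  refine ⟨?_, by nlinarith [sq_nonneg (x - 1 / 2)], by nlinarith⟩
  ext
  · rw [phi_fst]; ring
  · rw [phi_snd]; ring

/-- Points of the axis stay on it and, after the first step, to the right of the fold. -/
lemma axis_iterate {x : ℝ} (h0 : 31 / 200 ≤ x) (h1 : x ≤ 1) (j : ℕ) :
    ∃ x', phi^[j + 1] (x, 0) = (x', 0) ∧ 3 / 4 ≤ x' ∧ x' ≤ 1 := by
  induction j with
  | zero => exact ⟨_, axis_step h0 h1⟩
  | succ j ih =>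
    obtain ⟨x', e, k1, k2⟩ := ih
    rw [Function.iterate_succ_apply', e]
    exact ⟨_, axis_step (by linarith) k2⟩

/-- Points of the axis move towards the fixed point and return through the lower window. -/
lemma axis_block {N : ℕ} (hN : IsLong N) {x : ℝ} (h0 : 31 / 200 ≤ x) (h1 : x ≤ 1) :
    Block N 0 (x, 0) := by
  have hN2 := hN.two_le
  have hpass : Passes N (x, 0) := by
    refine ⟨⟨h0, by simp only; linarith, by simp⟩, fun j hj _ => ?_⟩
    obtain ⟨x', e, k1, k2⟩ := axis_iterate h0 h1 (j - 1)
    rw [show j - 1 + 1 = j by omega] at e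
    rw [e]
    exact ⟨k1, by norm_num, by norm_num⟩
  refine ⟨hpass, ?_, ?_⟩
  · obtain ⟨x', e, k1, k2⟩ := axis_iterate h0 h1 (N - 1)
    rw [show N - 1 + 1 = N by omega] at e
    have := hpass.end_fst_ge hN (by rw [e]; norm_num)
    rw [e] at this ⊢
    rw [mem_box_zero]
    simp only at this ⊢
    exact ⟨this, by linarith, by norm_num, by norm_num⟩
  · obtain ⟨x', e, k1, k2⟩ := axis_iterate h0 h1 (N + 1)
    rw [show N + 1 + 1 = N + 2 by omega] at e
    rw [e]
    exact ⟨by simp only; linarith, by simp only; linarith, by simp⟩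

/-- A point whose itinerary has only zeros from now on lies on the axis. -/
lemma codePt_snd_eq_zero {N : ℕ} (hN : IsLong N) {a : ℤ → Fin 2} (ha : ∀ k ≥ 0, a k = 0)
    (h1 : (codePt N a).1 ≤ 1) : (codePt N a).2 = 0 := by
  have h := orbitOf_spec hN a
  have h0 : 31 / 200 ≤ (codePt N a).1 := (codePt_mem hN a).1.1.1.1
  have ax : ∀ k : ℕ, ∃ x, (phi^[N + 2])^[k] ((codePt N a).1, 0) = (x, 0) ∧ 31 / 200 ≤ x ∧ x ≤ 1 := by
    intro k
    induction k with
    | zero => exact ⟨_, rfl, h0, h1⟩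
    | succ k ih =>
      obtain ⟨x, e, k1, k2⟩ := ih
      rw [Function.iterate_succ_apply', e]
      obtain ⟨x', e', k1', k2'⟩ := axis_iterate k1 k2 (N + 1)
      exact ⟨x', e', by linarith, k2'⟩
  have := eq_of_forward hN.two_le (a := fun _ => 0) (p := fun k : ℕ => orbitOf N a k)
    (q := fun k : ℕ => (phi^[N + 2])^[k] ((codePt N a).1, 0))
    (fun k => ⟨by have := Rset.block (h k).1; rwa [ha k (by omega)] at this,
      by rw [(h k).2]; push_cast; rfl⟩)
    (fun k => ⟨by
      obtain ⟨x, e, k1, k2⟩ := ax k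
      rw [e]; exact axis_block hN k1 k2, (Function.iterate_succ_apply' _ _ _).symm⟩)
    (cone_vertical (by norm_num) (by simp [codePt]))
  have := congrArg Prod.snd this
  exact this.symm

/-- Orbits on the axis that start where returns through the upper window land do not meet at
different times. -/
lemma axis_disjoint {w w' : ℝ} (hw : w ∈ Icc (193 / 1000 : ℝ) (262 / 1000))
    (hw' : w' ∈ Icc (193 / 1000 : ℝ) (262 / 1000)) (s t : ℕ) :
    phi^[s] (w, 0) ≠ phi^[s + t + 1] (w', 0) := by
  have i1 : 31 / 200 ≤ w := by linarith [hw.1]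
  have i2 : w ≤ 1 := by linarith [hw.2]
  have i1' : 31 / 200 ≤ w' := by linarith [hw'.1]
  have i2' : w' ≤ 1 := by linarith [hw'.2]
  induction s with
  | zero =>
    obtain ⟨x', e, k1, k2⟩ := axis_iterate i1' i2' (0 + t)
    rw [e]
    intro h
    have := congrArg Prod.fst h
    simp only [Function.iterate_zero, id] at this
    linarith [hw.2]
  | succ s ih =>
    rcases Nat.eq_zero_or_pos s with rfl | hs
    · -- after one step the first orbit is still farther from `1` than the second ever after
      have key : ∀ t : ℕ, ∃ x', phi^[t + 2] (w', 0) = (x', 0) ∧ 1 - 1534 / 10000 ≤ x' ∧ x' ≤ 1 := by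
        intro t
        induction t with
        | zero =>
          obtain ⟨e, k1, k2⟩ := axis_step i1' i2'
          have k3 : 1 - 1916 / 10000 ≤ 1 - 99 / 100 * w' * (1 - w') := by nlinarith [hw'.1, hw'.2]
          obtain ⟨e', k1', k2'⟩ := axis_step (by linarith) k2
          refine ⟨_, ?_, ?_, k2'⟩
          · rw [zero_add, Function.iterate_succ_apply', Function.iterate_one, e, e']
          · nlinarith
        | succ t ih =>
          obtain ⟨x', e, k1, k2⟩ := ih
          obtain ⟨e', -, k2'⟩ := axis_step (x := x') (by linarith) k2
          refine ⟨_, ?_, ?_, k2'⟩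
          · rw [show t + 1 + 2 = t + 2 + 1 by ring, Function.iterate_succ_apply', e, e']
          · nlinarith
      obtain ⟨x', e, k1, k2⟩ := key t
      rw [show 0 + 1 + t + 1 = t + 2 by ring, e, zero_add, Function.iterate_one,
        (axis_step i1 i2).1]
      intro h
      have := congrArg Prod.fst h
      simp only at this
      nlinarith [hw.1, hw.2]
    · intro h
      -- Both points are to the right of the fold, where `phi` is injective.
      obtain ⟨x, e, k1, k2⟩ := axis_iterate i1 i2 (s - 1)
      rw [show s - 1 + 1 = s by omega] at e
      obtain ⟨x', e', k1', k2'⟩ := axis_iterate i1' i2' (s + t)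
      rw [show s + 1 + t + 1 = s + t + 1 + 1 by ring, Function.iterate_succ_apply',
        Function.iterate_succ_apply' phi (s + t + 1)] at h
      refine ih (phi_injOn ?_ ?_ h)
      · rw [e]; simp only [mem_ofPred_eq]; linarith
      · rw [e']; simp only [mem_ofPred_eq]; linarith

lemma axis_ne_fixed {w : ℝ} (hw : w ∈ Icc (193 / 1000 : ℝ) (262 / 1000)) (s : ℕ) :
    phi^[s] (w, 0) ≠ (1, 0) := by
  induction s with
  | zero =>
    intro h
    have := congrArg Prod.fst h
    simp only [Function.iterate_zero, id] at this
    linarith [hw.2]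
  | succ s ih =>
    intro h
    rcases Nat.eq_zero_or_pos s with rfl | hs
    · rw [zero_add, Function.iterate_one,
        (axis_step (by linarith [hw.1]) (by linarith [hw.2])).1] at h
      have := congrArg Prod.fst h
      simp only at this
      nlinarith [hw.1, hw.2]
    · obtain ⟨x, e, k1, k2⟩ :=
        axis_iterate (x := w) (by linarith [hw.1]) (by linarith [hw.2]) (s - 1)
      rw [show s - 1 + 1 = s by omega] at e
      rw [Function.iterate_succ_apply', ← phi_one_zero] at h
      refine ih (phi_injOn ?_ ?_ h)
      · rw [e]; simp only [mem_ofPred_eq]; linarith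
      · simp only [mem_ofPred_eq]; norm_num

/-- A point whose itinerary has only zeros from now on is the fixed point, or lies on the orbit of a
point of the axis where returns through the upper window land: the one after the last symbol `1`. -/
lemma codePt_eq_axis {N : ℕ} (hN : IsLong N) {a : ℤ → Fin 2} (ha : ∀ k ≥ 0, a k = 0)
    (hne : a ≠ 0) : ∃ w ∈ Icc (193 / 1000 : ℝ) (262 / 1000), ∃ n : ℕ,
      codePt N a = phi^[(N + 2) * n] (w, 0) := by
  classical
  have hex : ∃ n : ℕ, a (-1 - n) ≠ 0 := by
    by_contra hcon
    push Not at hcon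
    refine hne (funext fun k => ?_)
    rcases le_or_gt 0 k with hk | hk
    · exact ha k hk
    · have := hcon (-1 - k).toNat
      rwa [show -1 - (((-1 - k).toNat : ℕ) : ℤ) = k by omega] at this
  set n := Nat.find hex with hn
  have h1 : a (-1 - n) ≠ 0 := Nat.find_spec hex
  set b : ℤ → Fin 2 := fun k => a (k - n) with hb
  have hbz : ∀ k ≥ 0, b k = 0 := by
    intro k hk
    rcases le_or_gt (n : ℤ) k with hk' | hk'
    · exact ha _ (by omega)
    · have := Nat.find_min hex (m := (n - 1 - k).toNat) (by omega)
      push Not at this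
      simp only [hb]
      rwa [show -1 - (((n - 1 - k).toNat : ℕ) : ℤ) = k - n by omega] at this
  have hbs : shift^[n] b = a := by
    funext k
    rw [iterate_shift]
    simp [hb]
  have hb1 : b (-1) = 1 := by
    have : b (-1) ≠ 0 := h1
    omega
  have hm := codePt_mem_image hN b
  rw [hb1] at hm
  obtain ⟨k1, k2⟩ := image_Rset_one hm
  refine ⟨(codePt N b).1, ⟨k1, k2⟩, n, ?_⟩
  rw [← hbs, ← iterate_code (fun a => (codePt_shift hN a).symm)]
  congr 1
  exact Prod.ext rfl (codePt_snd_eq_zero hN hbz (by linarith))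

/-- Different phases of coded orbits meet only at the fixed point. -/
lemma eq_zero_of_phase {N : ℕ} (hN : IsLong N) {a a' : ℤ → Fin 2} {j j' : ℕ} (hj : j < N + 2)
    (hj' : j' < N + 2) (hne : j ≠ j') (h : phi^[j] (codePt N a) = phi^[j'] (codePt N a')) :
    a = 0 ∧ a' = 0 := by
  -- A symbol `1` shows in the orbit, as a height above `1/2`, only at times in a residue class
  -- modulo `N + 2` that depends on the phase. Hence neither itinerary has symbols `1` in the
  -- future, and both orbits lie on the axis.
  have zeros : ∀ {a a' : ℤ → Fin 2} {j j' : ℕ}, j < N + 2 → j' < N + 2 → j ≠ j' →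
      phi^[j] (codePt N a) = phi^[j'] (codePt N a') → ∀ k ≥ 0, a k = 0 := by
    intro a a' j j' hj hj' hne h k hk
    by_contra hak
    have hak1 : a k = 1 := by omega
    obtain ⟨n, rfl⟩ := Int.eq_ofNat_of_zero_le hk
    have e1 : 1 / 2 < (phi^[(N + 2) * n + (N + 1)] (codePt N a)).2 := by
      rw [half_lt_snd_iff hN, Nat.mul_add_mod, Nat.mod_eq_of_lt (by omega),
        Nat.mul_add_div (by omega), Nat.div_eq_of_lt (by omega : N + 1 < N + 2), add_zero]
      exact ⟨rfl, hak1⟩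
    rw [show (N + 2) * n + (N + 1) = (N + 2) * n + (N + 1) - j + j by omega,
      Function.iterate_add_apply, h, ← Function.iterate_add_apply, half_lt_snd_iff hN] at e1
    have e2 := e1.1
    have e3 : ((N + 2) * n + (N + 1) - j + j') % (N + 2) = (N + 1 - j + j') % (N + 2) := by
      rw [show (N + 2) * n + (N + 1) - j + j' = (N + 2) * n + (N + 1 - j + j') by omega,
        Nat.mul_add_mod]
    rw [e3] at e2
    rcases lt_or_ge (N + 1 - j + j') (N + 2) with hlt | hge
    · rw [Nat.mod_eq_of_lt hlt] at e2
      omega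
    · rw [Nat.mod_eq_sub_mod hge, Nat.mod_eq_of_lt (by omega)] at e2
      omega
  have z := zeros hj hj' hne h
  have z' := zeros hj' hj hne.symm h.symm
  by_cases ha : a = 0 <;> by_cases ha' : a' = 0
  · exact ⟨ha, ha'⟩
  · obtain ⟨w, hw, n, e⟩ := codePt_eq_axis hN z' ha'
    rw [ha, codePt_zero hN, iterate_one_zero, e, ← Function.iterate_add_apply] at h
    exact absurd h.symm (axis_ne_fixed hw _)
  · obtain ⟨w, hw, n, e⟩ := codePt_eq_axis hN z ha
    rw [ha', codePt_zero hN, iterate_one_zero, e, ← Function.iterate_add_apply] at h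
    exact absurd h (axis_ne_fixed hw _)
  · exfalso
    obtain ⟨w, hw, n, e⟩ := codePt_eq_axis hN z ha
    obtain ⟨w', hw', n', e'⟩ := codePt_eq_axis hN z' ha'
    rw [e, e', ← Function.iterate_add_apply, ← Function.iterate_add_apply] at h
    -- The orbits on the axis started at times that differ, being in different residue classes.
    have hmod : j + (N + 2) * n ≠ j' + (N + 2) * n' := by
      intro hc
      have := congrArg (· % (N + 2)) hc
      simp only [Nat.add_mul_mod_self_left] at this
      rw [Nat.mod_eq_of_lt hj, Nat.mod_eq_of_lt hj'] at this
      exact hne this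
    rcases hmod.lt_or_gt with hlt | hlt
    · obtain ⟨t, ht⟩ := Nat.exists_eq_add_of_lt hlt
      rw [ht] at h
      exact axis_disjoint hw hw' _ _ h
    · obtain ⟨t, ht⟩ := Nat.exists_eq_add_of_lt hlt
      rw [ht] at h
      exact axis_disjoint hw' hw _ _ h.symm

/-! ### The subshift coding `phi` -/

/-- Time step on pairs of a phase and an itinerary: the phase advances, and after a full turn
the itinerary is shifted. -/
def tick (N : ℕ) (d : Fin (N + 2) × (ℤ → Fin 2)) : Fin (N + 2) × (ℤ → Fin 2) :=
  if h : d.1.val + 1 < N + 2 then (⟨d.1.val + 1, h⟩, d.2) else (⟨0, by omega⟩, shift d.2)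

lemma tick_surjective (N : ℕ) : Function.Surjective (tick N) := by
  rintro ⟨⟨j, hj⟩, a⟩
  cases j with
  | zero =>
    obtain ⟨b, hb⟩ := shift_surjective a
    refine ⟨(⟨N + 1, by omega⟩, b), ?_⟩
    unfold tick
    rw [dif_neg (by simp)]
    simp only [hb]
  | succ j =>
    refine ⟨(⟨j, by omega⟩, a), ?_⟩
    unfold tick
    rw [dif_pos (by simpa using hj)]

/-- The itinerary spread out in time: the symbols of `a` are placed at the times congruent to
minus the phase modulo `N + 2`, all other symbols are `0`. -/
def spread (N : ℕ) (d : Fin (N + 2) × (ℤ → Fin 2)) : ℤ → Fin 2 := fun n =>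
  if (n + d.1.val) % ((N + 2 : ℕ) : ℤ) = 0 then d.2 ((n + d.1.val) / ((N + 2 : ℕ) : ℤ)) else 0

/-- The point of the orbit of `codePt N a` with the given phase. -/
noncomputable def phasePt (N : ℕ) (d : Fin (N + 2) × (ℤ → Fin 2)) : ℝ × ℝ :=
  phi^[d.1.val] (codePt N d.2)

lemma continuous_spread (N : ℕ) : Continuous (spread N) := by
  refine continuous_prod_of_discrete_left.2 fun j => continuous_pi fun n => ?_
  by_cases h : (n + j.val) % ((N + 2 : ℕ) : ℤ) = 0
  · simp only [spread, if_pos h]; exact continuous_apply _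
  · simp only [spread, if_neg h]; exact continuous_const

lemma continuous_phasePt {N : ℕ} (hN : IsLong N) : Continuous (phasePt N) :=
  continuous_prod_of_discrete_left.2 fun j =>
    (continuous_iterate j.val).comp (continuous_codePt hN)

lemma spread_tick (N : ℕ) (d : Fin (N + 2) × (ℤ → Fin 2)) :
    shift (spread N d) = spread N (tick N d) := by
  funext n
  unfold tick
  split_ifs with h
  · simp only [shift, spread]
    have e : n + 1 + ((d.1.val : ℕ) : ℤ) = n + ((d.1.val + 1 : ℕ) : ℤ) := by push_cast; ring
    rw [e]
  · have hj : d.1.val = N + 1 := by have := d.1.isLt; omega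
    simp only [shift, spread, hj]
    have e : n + 1 + ((N + 1 : ℕ) : ℤ) = n + ((N + 2 : ℕ) : ℤ) := by push_cast; ring
    have e0 : n + ((0 : ℕ) : ℤ) = n := by simp
    rw [e, e0, Int.add_emod_right, Int.add_ediv_of_dvd_right (dvd_refl _),
      Int.ediv_self (by positivity)]

lemma phi_phasePt {N : ℕ} (hN : IsLong N) (d : Fin (N + 2) × (ℤ → Fin 2)) :
    phi (phasePt N d) = phasePt N (tick N d) := by
  unfold tick phasePt
  rw [← Function.iterate_succ_apply' phi]
  split_ifs with h
  · rfl
  · have hj : d.1.val = N + 1 := by have := d.1.isLt; omega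
    simp only [hj, Function.iterate_zero, id]
    exact (codePt_shift hN d.2).symm

lemma spread_at {N : ℕ} (j : Fin (N + 2)) (a : ℤ → Fin 2) (k : ℤ) :
    spread N (j, a) (((N + 2 : ℕ) : ℤ) * k - j.val) = a k := by
  simp only [spread, sub_add_cancel, Int.mul_emod_right, if_true]
  rw [Int.mul_ediv_cancel_left _ (by positivity)]

lemma spread_zero (N : ℕ) (j : Fin (N + 2)) : spread N (j, 0) = 0 := by
  funext n; simp [spread]

lemma eq_zero_of_spread {N : ℕ} {j j' : Fin (N + 2)} {a a' : ℤ → Fin 2} (hne : j ≠ j')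
    (h : spread N (j, a) = spread N (j', a')) : a = 0 := by
  funext k
  rw [← spread_at j a k, h]
  simp only [spread, Pi.zero_apply]
  refine if_neg fun hc => hne (Fin.ext ?_)
  have h1 := j.isLt
  have h2 := j'.isLt
  obtain ⟨c, hc⟩ := Int.dvd_of_emod_eq_zero hc
  have hd : ((N + 2 : ℕ) : ℤ) ∣ (j'.val : ℤ) - j.val := ⟨c - k, by linear_combination hc⟩
  have := Int.eq_zero_of_abs_lt_dvd hd (abs_lt.2 ⟨by omega, by omega⟩)
  omega

/-- Points of the same phase coincide only for equal itineraries, points of different phases only at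
the fixed point, and the spread sequences behave in the same way. -/
lemma phasePt_eq_iff {N : ℕ} (hN : IsLong N) (d d' : Fin (N + 2) × (ℤ → Fin 2)) :
    phasePt N d = phasePt N d' ↔ spread N d = spread N d' := by
  obtain ⟨j, a⟩ := d
  obtain ⟨j', a'⟩ := d'
  have same : j = j' → a = a' → (phasePt N (j, a) = phasePt N (j', a') ↔
      spread N (j, a) = spread N (j', a')) := by
    rintro rfl rfl; exact Iff.of_eq (by simp)
  have zero : a = 0 → a' = 0 → (phasePt N (j, a) = phasePt N (j', a') ↔
      spread N (j, a) = spread N (j', a')) := by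
    rintro rfl rfl
    simp [phasePt, codePt_zero hN, iterate_one_zero, spread_zero]
  constructor
  · intro h
    by_cases hj : j = j'
    · refine (same hj ?_).1 h
      subst hj
      -- complete the turn and use the injectivity of the coding
      have h1 := congrArg (phi^[N + 2 - j.val]) h
      simp only [phasePt] at h1
      rw [← Function.iterate_add_apply, ← Function.iterate_add_apply,
        show N + 2 - j.val + j.val = N + 2 by have := j.isLt; omega, ← codePt_shift hN,
        ← codePt_shift hN] at h1
      exact shift_injective (injective_codePt hN h1)
    · obtain ⟨z, z'⟩ := eq_zero_of_phase hN j.isLt j'.isLt (fun e => hj (Fin.ext e)) h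
      exact (zero z z').1 h
  · intro h
    by_cases hj : j = j'
    · refine (same hj ?_).2 h
      subst hj
      funext k
      rw [← spread_at j a k, h, spread_at]
    · exact (zero (eq_zero_of_spread hj h) (eq_zero_of_spread (Ne.symm hj) h.symm)).2 h

lemma range_phasePt {N : ℕ} (hN : IsLong N) :
    range (phasePt N) = ⋃ n : ℕ, phi^[n] '' range (codePt N) := by
  ext p
  constructor
  · rintro ⟨⟨j, a⟩, rfl⟩
    exact mem_iUnion.2 ⟨j, _, mem_range_self a, rfl⟩
  · intro hp
    obtain ⟨n, _, ⟨a, rfl⟩, rfl⟩ := mem_iUnion.1 hp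
    refine ⟨(⟨n % (N + 2), Nat.mod_lt _ (by omega)⟩, shift^[n / (N + 2)] a), ?_⟩
    simp only [phasePt]
    rw [← iterate_code (fun a => (codePt_shift hN a).symm), ← Function.iterate_add_apply,
      Nat.mod_add_div]

/-- The subshift consists of all spread itineraries, which have the same identifications as the
points `phasePt`. -/
theorem exists_subshift {N : ℕ} (hN : IsLong N) : ∃ (k : ℕ) (X : Set (ℤ → Fin k)), IsSubshift X ∧
    ConjugateOn phi (⋃ n : ℕ, phi^[n] '' range (codePt N)) shift X := by
  refine ⟨2, range (spread N), ⟨(isCompact_range (continuous_spread N)).isClosed, ?_⟩, ?_⟩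
  · rw [← range_comp]
    have : shift ∘ spread N = spread N ∘ tick N := funext (spread_tick N)
    rw [this, (tick_surjective N).range_comp]
  · rw [← range_phasePt hN]
    exact conjugateOn_range (continuous_phasePt hN) (continuous_spread N) (phasePt_eq_iff hN)
      (phi_phasePt hN) (spread_tick N)

/-- The return map on the coded set is the full shift. -/
theorem conjugateOn_shift {N : ℕ} (hN : IsLong N) :
    ConjugateOn phi^[N + 2] (range (codePt N)) (shift : (ℤ → Fin 2) → ℤ → Fin 2) univ := by
  rw [← range_id]
  exact conjugateOn_range (continuous_codePt hN) continuous_id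
    (fun a b => (injective_codePt hN).eq_iff) (fun a => (codePt_shift hN a).symm) fun a => rfl

lemma image_range_codePt {N : ℕ} (hN : IsLong N) :
    phi^[N + 2] '' range (codePt N) = range (codePt N) := by
  rw [← range_comp]
  have : phi^[N + 2] ∘ codePt N = codePt N ∘ shift := funext fun a => (codePt_shift hN a).symm
  rw [this, shift_surjective.range_comp]

lemma iUnion_image_range_codePt {N : ℕ} (hN : IsLong N) :
    ⋃ n : ℕ, (phi^[N + 2])^[n] '' range (codePt N) = range (codePt N) := by
  have : ∀ n : ℕ, (phi^[N + 2])^[n] '' range (codePt N) = range (codePt N) := by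
    intro n
    induction n with
    | zero => simp
    | succ n ih => rw [Function.iterate_succ, image_comp, image_range_codePt hN, ih]
  simp only [this, iUnion_const]

end FlipFlop

theorem theorem5p1 (Φ : ℝ × ℝ → ℝ × ℝ) (hΦ : Φ = FlipFlop.flipFlopMap 0.99 5) :
    ∃ (N : ℕ) (Q : FlipFlop.CurvRect), 0 < N ∧
      -- `Q` meets the triangle `T`
      (Q.region ∩ FlipFlop.triangle).Nonempty ∧
      -- (a) `F(Q)`, where `F = Φ^N`
      (FlipFlop.IsTopologicalSquare (Φ^[N] '' Q.region) ∧
        Φ^[N] '' Q.region ⊆ Set.Icc (0.875 : ℝ) 1.025 ×ˢ Set.Icc (-0.03 : ℝ) 0.22 ∧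
        (∀ y ∈ Set.Icc (0 : ℝ) 0.2, ((1 : ℝ), y) ∈ interior (Φ^[N] '' Q.region)) ∧
        IsGreatest (Prod.snd '' (Φ^[N] '' Q.region)) (0.22 : ℝ)) ∧
      -- (b) `G(Q)`, where `G = Φ^(N+1)`
      (FlipFlop.IsTopologicalSquare (Φ^[N + 1] '' Q.region) ∧
        (∀ y ∈ Set.Icc (0 : ℝ) 0.2,
          (1 - y, 5 * (1 - y) * (1 - (1 - y))) ∈ interior (Φ^[N + 1] '' Q.region)) ∧
        (∀ p ∈ Φ^[N + 1] '' Q.region, ∃ x ∈ Set.Icc (0 : ℝ) 1,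
          (p.1 - x) ^ 2 + (p.2 - 5 * x * (1 - x)) ^ 2 ≤ 0.1 ^ 2) ∧
        (∃ p ∈ Φ^[N + 1] '' Q.region, p.2 < p.1) ∧
        (∃ p ∈ Φ^[N + 1] '' Q.region, p.1 < p.2) ∧
        (∀ p ∈ Φ^[N + 1] '' Q.region, p.2 - p.1 ≤ 0.1) ∧
        (∀ p ∈ Φ^[N + 1] '' Q.region, p.1 = p.2 → 0 < p.1 ∧ p.1 < 1)) ∧
      -- (c) `H(Q)`, where `H = Φ^(N+2)`
      (Nonempty ((Φ^[N + 2] '' Q.region : Set (ℝ × ℝ)) ≃ₜ Q.region) ∧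
        ∃ C₀ C₁ R₀ R₁ : FlipFlop.CurvRect,
          FlipFlop.IsHorseshoe Φ^[N + 2] Q C₀ C₁ R₀ R₁) ∧
      -- the invariant set
      ∃ Λ : Set (ℝ × ℝ), Λ ⊆ Q.region ∧ IsCompact Λ ∧ Φ^[N + 2] '' Λ = Λ ∧
        -- `H` on `Λ` is conjugate to the full two-sided shift on two symbols
        FlipFlop.ConjugateOn Φ^[N + 2] Λ
          (FlipFlop.shift : (ℤ → Fin 2) → (ℤ → Fin 2)) Set.univ ∧
        -- `Φ`, on the union of the images of `Λ`, is conjugate to a subshift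
        (∃ (k : ℕ) (X : Set (ℤ → Fin k)), FlipFlop.IsSubshift X ∧
          FlipFlop.ConjugateOn Φ (⋃ n : ℕ, Φ^[n] '' Λ) FlipFlop.shift X) ∧
        -- chaotic dynamics
        FlipFlop.IsDevaneyChaoticOn Φ^[N + 2] Λ ∧
        FlipFlop.IsDevaneyChaoticOn Φ (⋃ n : ℕ, Φ^[n] '' Λ) ∧
        -- a dense orbit
        (∃ p ∈ Λ, Λ ⊆ closure (Set.range fun n : ℕ => (Φ^[N + 2])^[n] p)) ∧
        (∃ p ∈ Λ, (⋃ n : ℕ, Φ^[n] '' Λ) ⊆ closure (Set.range fun n : ℕ => Φ^[n] p)) ∧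
        -- cycles of arbitrarily large (least) period
        (∀ n : ℕ, ∃ p ∈ Λ, n < Function.minimalPeriod Φ p) := by
  open FlipFlop in
  obtain rfl : Φ = phi := hΦ
  obtain ⟨N, hN⟩ := exists_isLong
  obtain ⟨Q, hQ, hQh, hQl, hQr⟩ := exists_rect_Qset hN
  have hbd : ∀ p ∈ phi^[N + 1] '' Qset N, ∃ q, p = phi q ∧ 93 / 100 ≤ q.1 ∧ q.1 ≤ 1001 / 1000 ∧
      -(1 / 1000) ≤ q.2 ∧ q.2 ≤ 22 / 100 := by
    intro p hp
    rw [image_iterate_succ] at hp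
    obtain ⟨q, hq, rfl⟩ := hp
    exact ⟨q, rfl, image_bounds hN hq⟩
  have hcode : ∀ a, phi^[N + 2] (codePt N a) = codePt N (shift a) := fun a =>
    (codePt_shift hN a).symm
  have hcode1 : ∀ a, (phi^[N + 2])^[1] (codePt N a) = codePt N (shift a) := hcode
  have hcc := continuous_codePt hN
  have hci := injective_codePt hN
  have hU := iUnion_image_range_codePt hN
  refine ⟨N, Q, by have := hN.1; omega, ?_, ?_, ?_, ?_, range (codePt N), ?_,
    isCompact_range hcc, image_range_codePt hN, conjugateOn_shift hN, exists_subshift hN, ?_,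
    isDevaneyChaoticOn_of_code continuous_phi (by omega) hcc hci hcode, ?_,
    exists_dense_orbit_of_code continuous_phi hcc hcode,
    exists_long_period_of_code (by omega) hci hcode⟩
  · rw [hQ]
    exact ⟨(1, 0), one_zero_mem_Qset hN, by norm_num, by norm_num, by norm_num, by norm_num⟩
  · rw [hQ]
    refine ⟨isTopologicalSquare_image hN, fun q hq => ?_, fun y hy => mem_interior_image hN hy,
      isGreatest_image hN⟩
    obtain ⟨h1, h2, h3, h4⟩ := image_bounds hN hq
    refine ⟨⟨?_, ?_⟩, ?_, ?_⟩ <;> norm_num <;> linarith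
  · rw [hQ]
    refine ⟨isTopologicalSquare_image_succ hN, fun y hy => arc_mem_interior hN hy, ?_,
      exists_below_diagonal hN, exists_above_diagonal hN, ?_, ?_⟩
    · intro p hp
      obtain ⟨q, rfl, h1, h2, h3, h4⟩ := hbd p hp
      exact phi_near_parabola h1 h2 h3 h4
    · intro p hp
      obtain ⟨q, rfl, h1, h2, h3, h4⟩ := hbd p hp
      exact phi_snd_sub_fst_le h1 h2 h4
    · intro p hp
      obtain ⟨q, rfl, h1, h2, h3, h4⟩ := hbd p hp
      exact phi_diagonal h1 h2 h3 h4
  · refine ⟨?_, exists_horseshoe hN hQ hQh hQl hQr⟩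
    obtain ⟨e⟩ := isTopologicalSquare_image_add_two hN
    obtain ⟨e'⟩ := Q.nonempty_homeomorph
    rw [← hQ] at e
    exact ⟨e.trans e'.symm⟩
  · rw [hQ]
    rintro _ ⟨a, rfl⟩
    exact (codePt_mem hN a).1
  · have := isDevaneyChaoticOn_of_code (continuous_iterate (N + 2)) one_pos hcc hci hcode1
    rwa [hU] at this
  · obtain ⟨p, hp, h⟩ := exists_dense_orbit_of_code (continuous_iterate (N + 2)) hcc hcode1
    rw [hU] at h
    exact ⟨p, hp, h⟩
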